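/- **Setting.** Let $K$ be a field of characteristic $0$ with algebraic closure $\bar K$, let $\mathbb L$ be an intermediate field, $K\subseteq\mathbb L\subseteq\bar K$, and let $b\ge 2$ and $r\ge 0$ be integers. Let $\ell_0,\dots,\ell_r\in K[x]$ have no common factor, with $\ell_0\ne0$ and $\ell_r\neq 0$. Let $M$ be the Mahler operator $y(x)\mapsto y(x^b)$ and consider $$\text{(L)}\quad \ell_rM^ry+\dots+\ell_1My+\ell_0y=0,\qquad \text{(R)}\quad \ell_r\,u\,Mu\cdots M^{r-1}u+\dots+\ell_2\,u\,Mu+\ell_1u+\ell_0=0 .$$ For a field $F\supseteq K$ let $F((x^{1/*}))=\bigcup_{q\ge1}F((x^{1/q}))$ be the field of Puiseux series and $F(x^{1/*})=\bigcup_{q\geq 1}F(x^{1/q})$ the field of ramified rational functions. Let $\mathfrak D_F=\bigoplus_{\lambda\in F\setminus\{0\}}e_\lambda F((x^{1/*}))$ be the ring with $e_\lambda e_{\lambda'}=e_{\lambda\lambda'}$, $e_1=1$, with $M$ extended to it by $Me_\lambda=\lambda e_\lambda$. The lower Newton polygon of $L=\sum_k \ell_kM^k$, $\ell_k=\sum_j\ell_{k,j}x^j$,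 is the lower convex hull of the points $(b^k,j)$ with $\ell_{k,j}\ne0$. An edge with end points of abscissae $b^{k_1}<b^{k_2}$ has characteristic polynomial $\sum \ell_{k,j}X^{k-k_1}$, the sum being over the points $(b^k,j)$ on the edge. Let $\Lambda\subseteq\bar K$ be the set of the roots of these polynomials, and let $\Lambda'$ be the set of the $\lambda\in\Lambda$ such that (L) has a nonzero solution in $e_\lambda\bar K((x^{1/*}))$. An edge is $\lambda$-admissible if $\lambda$ is a root of its characteristic polynomial, and $q_\lambda$ is the least common multiple of those denominators of slopes of $\lambda$-admissible edges that are coprime with $b$. An element $y\in\mathfrak D_{\mathbb L}$ is hypergeometric if $My=uy$ for some $u\in\mathbb L(x^{1/*})$; two elements are similar if one is the product of the other with a nonzero element of $\mathbb L(x^{1/*})$. Below, "class" means a similarity class of nonzero hypergeometric solutions of (L) in $\mathfrak D_{\mathbb L}$. **Theorem.** (0) For each class $H$ there is a unique tuple $(\lambda,g,(p_1,\dots,p_s))$ with $\lambda\in\mathbb L\setminus\{0\}$, $g\in\mathbb L(x)$, $g(0)=1$, $s>0$, and $p_j\in\mathbb L[x,x^{-1}]$, such that the generalized series $e_\lambda\,p_j(x^{1/q_\lambda})\prod_{k\ge0}1/g(x^{b^k/q_\lambda})$,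 $1\le j\le s$, form an $\mathbb L$-basis of $H\cup\{0\}$, the family $(p_1,\dots,p_s)$ is in reduced echelon form with respect to ascending degree, and $p_1,\dots,p_s$ are coprime in $\mathbb L[x,x^{-1}]$. Distinct classes have distinct pairs $(\lambda,g)$. Denote by $H_{\lambda,g}$ the class with pair $(\lambda,g)$, and by $\mathfrak R_{\lambda,g}$ its image under $y\mapsto My/y$ (the elements of $H_{\lambda,g}$ are invertible). (1) The set $I$ of the pairs $(\lambda,g)$ so obtained is finite, each $(\lambda,g)\in I$ satisfies $\lambda\in\mathbb L\cap\Lambda'$ and $g(0)=1$, and the set of solutions of (R) in $\mathbb L(x^{1/*})$ is the disjoint union $$\coprod_{(\lambda,g)\in I}\mathfrak R_{\lambda,g}.$$ Moreover, for each $\lambda\in\mathbb L\cap\Lambda'$, the set of nonzero hypergeometric solutions of (L) in $e_\lambda\mathbb L((x^{1/*}))$ is the disjoint union of the $H_{\lambda,g}$ with $(\lambda,g)\in I$. (2) For each $(\lambda,g)\in I$, with tuple $(\lambda,g,(p_1,\dots,p_s))$, the map $$(c_1:\dots:c_s)\longmapsto u(x)=\lambda\,\frac{\sum_{j=1}^sc_jp_j(x^{b/q_\lambda})}{\sum_{j=1}^sc_jp_j(x^{1/q_\lambda})}\,g(x^{1/q_\lambda})$$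 is well defined (its denominators are nonzero) and is a bijection from $\mathbb P^{s-1}(\mathbb L)$ to $\mathfrak R_{\lambda,g}$. (3) Writing $s_{\lambda,g}$ for the integer $s$ of the tuple, $\sum_{(\lambda,g)\in I}(s_{\lambda,g}-1)\le r-\#I$. -/

import Mathlib

namespace Mahler

noncomputable section

/-! ### Puiseux series and the substitutions `x ↦ x^(m/q)` -/

/-- The substitution `y(x) ↦ y(x^(m/q))` on Hahn series with rational exponents. -/
def hahnSubst (F : Type*) [Field F] (m q : ℕ+) : HahnSeries ℚ F →+* HahnSeries ℚ F :=
  HahnSeries.embDomainRingHom (AddMonoidHom.mulLeft ((m : ℚ) / (q : ℚ)))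
    (fun x y h => by
      have hpos : (0 : ℚ) < (m : ℚ) / (q : ℚ) := div_pos (by exact_mod_cast m.pos)
        (by exact_mod_cast q.pos)
      exact mul_left_cancel₀ hpos.ne' h)
    (fun x y => by
      have hpos : (0 : ℚ) < (m : ℚ) / (q : ℚ) := div_pos (by exact_mod_cast m.pos)
        (by exact_mod_cast q.pos)
      exact mul_le_mul_iff_of_pos_left hpos)

/-- A Laurent series in `x`, seen as a Hahn series with rational exponents. -/
def laurentToHahn (F : Type*) [Field F] : LaurentSeries F →+* HahnSeries ℚ F :=
  HahnSeries.embDomainRingHom (Int.castAddHom ℚ) Int.cast_injective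
    (fun _ _ => Int.cast_le)

/-- All exponents of `y` lie in `(1/q)ℤ`. -/
def HasRamification {F : Type*} [Field F] (q : ℕ+) (y : HahnSeries ℚ F) : Prop :=
  ∀ a ∈ y.support, ∃ n : ℤ, a = (n : ℚ) / (q : ℚ)

theorem hahnSubst_support {F : Type*} [Field F] (m q : ℕ+) (y : HahnSeries ℚ F) {a : ℚ}
    (ha : a ∈ (hahnSubst F m q y).support) : ∃ c ∈ y.support, a = (m : ℚ) / (q : ℚ) * c := by
  obtain ⟨c, hc, h⟩ := HahnSeries.support_embDomain_subset ha
  exact ⟨c, hc, h.symm⟩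

theorem laurentToHahn_support {F : Type*} [Field F] (y : LaurentSeries F) {a : ℚ}
    (ha : a ∈ (laurentToHahn F y).support) : ∃ n : ℤ, a = n := by
  obtain ⟨c, hc, h⟩ := HahnSeries.support_embDomain_subset ha
  exact ⟨c, h.symm⟩

theorem HasRamification.mono {F : Type*} [Field F] {q : ℕ+} (q' : ℕ+) {y : HahnSeries ℚ F}
    (h : HasRamification q y) : HasRamification (q * q') y := by
  intro a ha
  obtain ⟨n, rfl⟩ := h a ha
  have h1 : (q : ℚ) ≠ 0 := by exact_mod_cast q.ne_zero
  have h2 : (q' : ℚ) ≠ 0 := by exact_mod_cast q'.ne_zero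
  refine ⟨n * q', ?_⟩
  push_cast
  field_simp

theorem HasRamification.add {F : Type*} [Field F] {q : ℕ+} {y z : HahnSeries ℚ F}
    (hy : HasRamification q y) (hz : HasRamification q z) : HasRamification q (y + z) := by
  intro a ha
  rcases HahnSeries.support_add_subset y z ha with h | h
  exacts [hy a h, hz a h]

theorem HasRamification.mul {F : Type*} [Field F] {q : ℕ+} {y z : HahnSeries ℚ F}
    (hy : HasRamification q y) (hz : HasRamification q z) : HasRamification q (y * z) := by
  intro a ha
  obtain ⟨c, hc, d, hd, rfl⟩ := Set.mem_add.1 (HahnSeries.support_mul_subset ha)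
  obtain ⟨n, rfl⟩ := hy c hc
  obtain ⟨n', rfl⟩ := hz d hd
  exact ⟨n + n', by push_cast; ring⟩

theorem HasRamification.exists_laurent {F : Type*} [Field F] {q : ℕ+} {y : HahnSeries ℚ F}
    (hy : HasRamification q y) :
    ∃ f : LaurentSeries F, hahnSubst F 1 q (laurentToHahn F f) = y := by
  have hq : (0 : ℚ) < (q : ℚ) := by exact_mod_cast q.pos
  let f : LaurentSeries F :=
    { coeff := fun n => y.coeff ((n : ℚ) / (q : ℚ))
      isPWO_support' := by
        intro u
        obtain ⟨i, j, hij, h⟩ := y.isPWO_support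
          (fun k => ⟨((u k : ℤ) : ℚ) / (q : ℚ), (u k).2⟩)
        refine ⟨i, j, hij, ?_⟩
        have := (div_le_div_iff_of_pos_right hq).1 (show ((u i : ℤ) : ℚ) / (q : ℚ) ≤ ((u j : ℤ) : ℚ) / (q : ℚ) from h)
        exact_mod_cast this }
  have key : ∀ n : ℤ, (hahnSubst F 1 q (laurentToHahn F f)).coeff ((n : ℚ) / (q : ℚ))
      = y.coeff ((n : ℚ) / (q : ℚ)) := by
    intro n
    have e : (n : ℚ) / (q : ℚ) = AddMonoidHom.mulLeft (((1 : ℕ+) : ℚ) / (q : ℚ)) (n : ℚ) := by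
      simp [AddMonoidHom.mulLeft]; ring
    have h1 : (hahnSubst F 1 q (laurentToHahn F f)).coeff
        (AddMonoidHom.mulLeft (((1 : ℕ+) : ℚ) / (q : ℚ)) (n : ℚ))
        = (laurentToHahn F f).coeff (n : ℚ) := HahnSeries.embDomain_mk_coeff _ _
    have h2 : (laurentToHahn F f).coeff (n : ℚ) = f.coeff n :=
      HahnSeries.embDomain_mk_coeff (f := (Int.castAddHom ℚ)) Int.cast_injective
        (fun _ _ => Int.cast_le)
    rw [e, h1, h2, ← e]
  refine ⟨f, HahnSeries.ext (funext fun a => ?_)⟩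
  by_cases ha : ∃ n : ℤ, a = (n : ℚ) / (q : ℚ)
  · obtain ⟨n, rfl⟩ := ha
    exact key n
  · have h1 : y.coeff a = 0 := by
      by_contra h
      exact ha (hy a h)
    rw [h1]
    by_contra h
    obtain ⟨c, hc, rfl⟩ := hahnSubst_support 1 q _ h
    obtain ⟨n, rfl⟩ := laurentToHahn_support f hc
    exact ha ⟨n, by push_cast; ring⟩

theorem hasRamification_laurent {F : Type*} [Field F] (q : ℕ+) (f : LaurentSeries F) :
    HasRamification q (hahnSubst F 1 q (laurentToHahn F f)) := by
  intro a ha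
  obtain ⟨c, hc, rfl⟩ := hahnSubst_support 1 q _ ha
  obtain ⟨n, rfl⟩ := laurentToHahn_support f hc
  exact ⟨n, by push_cast; ring⟩

theorem HasRamification.inv {F : Type*} [Field F] {q : ℕ+} {y : HahnSeries ℚ F}
    (hy : HasRamification q y) : HasRamification q y⁻¹ := by
  obtain ⟨f, rfl⟩ := hy.exists_laurent
  rw [← map_inv₀, ← map_inv₀]
  exact hasRamification_laurent q _

theorem hasRamification_C {F : Type*} [Field F] (c : F) :
    HasRamification 1 (HahnSeries.C c : HahnSeries ℚ F) := by
  intro a ha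
  rw [HahnSeries.C_apply] at ha
  have := HahnSeries.support_single_subset ha
  exact ⟨0, by simpa using this⟩

/-- The field of Puiseux series over `F`: the union over `q ≥ 1` of the fields `F((x^(1/q)))`,
inside the field of Hahn series with rational exponents. -/
def puiseux (F : Type*) [Field F] : Subfield (HahnSeries ℚ F) where
  carrier := {y | ∃ q : ℕ+, HasRamification q y}
  mul_mem' := by
    rintro y z ⟨q, hy⟩ ⟨q', hz⟩
    refine ⟨q * q', (hy.mono q').mul ?_⟩
    rw [mul_comm]
    exact hz.mono q
  one_mem' := ⟨1, hasRamification_C 1⟩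
  add_mem' := by
    rintro y z ⟨q, hy⟩ ⟨q', hz⟩
    refine ⟨q * q', (hy.mono q').add ?_⟩
    rw [mul_comm]
    exact hz.mono q
  zero_mem' := ⟨1, fun a ha => by simp at ha⟩
  neg_mem' := by
    rintro y ⟨q, hy⟩
    exact ⟨q, fun a ha => hy a (by rwa [HahnSeries.support_neg] at ha)⟩
  inv_mem' := by
    rintro y ⟨q, hy⟩
    exact ⟨q, hy.inv⟩

/-- The type of Puiseux series over `F`. -/
abbrev Puiseux (F : Type*) [Field F] : Type _ := ↥(puiseux F)

/-- The inclusion of the constants in the field of Puiseux series. -/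
def constP (F : Type*) [Field F] : F →+* Puiseux F :=
  (HahnSeries.C : F →+* HahnSeries ℚ F).codRestrict (puiseux F)
    (fun c => ⟨1, hasRamification_C c⟩)

instance instAlgebraPuiseux (F : Type*) [Field F] : Algebra F (Puiseux F) := (constP F).toAlgebra

/-- The substitution `y(x) ↦ y(x^(m/q))` on Puiseux series. -/
def subst (F : Type*) [Field F] (m q : ℕ+) : Puiseux F →+* Puiseux F :=
  ((hahnSubst F m q).comp (puiseux F).subtype).codRestrict (puiseux F) (by
    rintro ⟨y, q', hy⟩
    refine ⟨q * q', fun a ha => ?_⟩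
    obtain ⟨c, hc, rfl⟩ := hahnSubst_support m q _ ha
    obtain ⟨n, hn⟩ := hy c hc
    rw [hn]
    have h1 : (q : ℚ) ≠ 0 := by exact_mod_cast q.ne_zero
    have h2 : (q' : ℚ) ≠ 0 := by exact_mod_cast q'.ne_zero
    refine ⟨m * n, ?_⟩
    push_cast
    field_simp)

/-- The inclusion of Laurent series in Puiseux series. -/
def ofLaurent (F : Type*) [Field F] : LaurentSeries F →+* Puiseux F :=
  (laurentToHahn F).codRestrict (puiseux F) (by
    intro f
    refine ⟨1, fun a ha => ?_⟩
    obtain ⟨n, rfl⟩ := laurentToHahn_support f ha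
    exact ⟨n, by simp⟩)

open scoped RatFunc in
/-- `f(x^(m/q))` for a rational function `f`, expanded as a Laurent series in `x^(1/q)`. -/
def ratAt {F : Type*} [Field F] (m q : ℕ+) (f : RatFunc F) : Puiseux F :=
  subst F m q (ofLaurent F (algebraMap (RatFunc F) (LaurentSeries F) f))

/-- `f(x^(m/q))` for a formal power series `f`. -/
def powerSeriesAt {F : Type*} [Field F] (m q : ℕ+) (f : PowerSeries F) : Puiseux F :=
  subst F m q (ofLaurent F (HahnSeries.ofPowerSeries ℤ F f))

/-- `p(x^(m/q))` for a Laurent polynomial `p`. -/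
def laurentPolyAt {F : Type*} [Field F] (m q : ℕ+) (p : LaurentPolynomial F) : Puiseux F :=
  subst F m q (ofLaurent F (HahnSeries.ofFinsupp p.coeff))

/-- A polynomial with coefficients in `K`, as a Puiseux series over an extension `F` of `K`. -/
def polyCoeff {K : Type*} (F : Type*) [Field K] [Field F] [Algebra K F] (P : Polynomial K) :
    Puiseux F :=
  ratAt 1 1 (algebraMap (Polynomial F) (RatFunc F) (P.map (algebraMap K F)))

/-- The field of ramified rational functions over `F` (as a set of Puiseux series): the union over
`q ≥ 1` of the fields `F(x^(1/q))`. -/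
def ramRat (F : Type*) [Field F] : Set (Puiseux F) :=
  {u | ∃ (q : ℕ+) (f : RatFunc F), u = ratAt 1 q f}

/-! ### The difference ring of generalized series -/

/-- The algebra over the field of Puiseux series with basis `(e_lam)`, for `lam` a nonzero element
of `F`, and `e_lam * e_lam' = e_(lam * lam')`. The element `e_lam * p` is
`MonoidAlgebra.single lam p`. -/
abbrev DRing (F : Type*) [Field F] : Type _ := MonoidAlgebra (Puiseux F) Fˣ

/-- The Mahler operator `y(x) ↦ y(x^b)` on Puiseux series. -/
def mahlerP (F : Type*) [Field F] (b : ℕ+) : Puiseux F →+* Puiseux F := subst F b 1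

/-- The map `lam ↦ lam * e_lam`. -/
def eigenHom (F : Type*) [Field F] : Fˣ →* DRing F where
  toFun lam := MonoidAlgebra.single lam (algebraMap F (Puiseux F) (lam : F))
  map_one' := by simp [MonoidAlgebra.one_def]
  map_mul' lam lam' := by simp [MonoidAlgebra.single_mul_single]

/-- The Mahler operator on the difference ring: the ring endomorphism that extends the Mahler
operator of Puiseux series and satisfies `M e_lam = lam * e_lam`. -/
def mahler (F : Type*) [Field F] (b : ℕ+) : DRing F →+* DRing F :=
  MonoidAlgebra.liftNCRingHom (MonoidAlgebra.singleOneRingHom.comp (mahlerP F b)) (eigenHom F)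
    (fun _ _ => Commute.all _ _)

theorem mahler_single (F : Type*) [Field F] (b : ℕ+) (lam : Fˣ) (p : Puiseux F) :
    mahler F b (MonoidAlgebra.single lam p)
      = MonoidAlgebra.single lam (algebraMap F (Puiseux F) (lam : F) * mahlerP F b p) := by
  simp [mahler, eigenHom, MonoidAlgebra.single_mul_single, mul_comm]

/-! ### The linear equation and the Riccati equation -/

section Equations

variable {K : Type*} [Field K] (F : Type*) [Field F] [Algebra K F]
  (b : ℕ+) (r : ℕ) (l : ℕ → Polynomial K)

/-- `L y = l_r M^r y + ... + l_1 M y + l_0 y`. -/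
def applyL (y : DRing F) : DRing F :=
  ∑ k ∈ Finset.range (r + 1), polyCoeff F (l k) • (mahler F b)^[k] y

/-- The solutions `u` among the ramified rational functions over `F` of the Riccati equation
`l_r u (M u) ... (M^(r-1) u) + ... + l_2 u (M u) + l_1 u + l_0 = 0`. -/
def riccatiSolutions : Set (Puiseux F) :=
  {u | u ∈ ramRat F ∧
    ∑ k ∈ Finset.range (r + 1),
      polyCoeff F (l k) * ∏ i ∈ Finset.range k, (mahlerP F b)^[i] u = 0}

/-- Hypergeometric elements with respect to the field of ramified rational functions. -/
def IsHypergeometric (y : DRing F) : Prop :=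
  ∃ u ∈ ramRat F, mahler F b y = u • y

/-- The nonzero hypergeometric solutions of the linear equation. -/
def hypSolutions : Set (DRing F) :=
  {y | y ≠ 0 ∧ IsHypergeometric F b y ∧ applyL F b r l y = 0}

/-- Similarity with respect to the field of ramified rational functions. -/
def Similar (y z : DRing F) : Prop :=
  ∃ f ∈ ramRat F, f ≠ 0 ∧ y = f • z

/-- The nontrivial similarity classes of hypergeometric solutions of the linear equation
(they do not contain `0`). -/
def simClasses : Set (Set (DRing F)) :=
  {H | ∃ y ∈ hypSolutions F b r l, H = {z | z ∈ hypSolutions F b r l ∧ Similar F z y}}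

/-- The image of a set of generalized series under `y ↦ M y / y`. -/
def quotImage (H : Set (DRing F)) : Set (Puiseux F) :=
  {u | ∃ y ∈ H, IsUnit y ∧ mahler F b y = u • y}

end Equations

/-! ### The lower Newton polygon -/

section Newton

variable {K : Type*} [Field K] (b : ℕ+) (r : ℕ) (l : ℕ → Polynomial K)

/-- The slope of the line through the lowest points of abscissae `b^k₁` and `b^k₂`, among the
points `(b^k, j)` such that the coefficient of `x^j` in `l_k` is nonzero. -/
def edgeSlope (k₁ k₂ : ℕ) : ℚ :=
  (((l k₂).natTrailingDegree : ℚ) - ((l k₁).natTrailingDegree : ℚ))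
    / ((b : ℚ) ^ k₂ - (b : ℚ) ^ k₁)

/-- The ordinate at abscissa `b^k` of this line. -/
def lineAt (k₁ k₂ k : ℕ) : ℚ :=
  ((l k₁).natTrailingDegree : ℚ) + edgeSlope b l k₁ k₂ * ((b : ℚ) ^ k - (b : ℚ) ^ k₁)

/-- The lower convex hull of the points `(b^k, j)`, `k ≤ r`, such that the coefficient of `x^j` in
`l_k` is nonzero has an edge whose end points have abscissae `b^k₁ < b^k₂`. -/
def IsEdge (k₁ k₂ : ℕ) : Prop :=
  k₁ < k₂ ∧ k₂ ≤ r ∧ l k₁ ≠ 0 ∧ l k₂ ≠ 0 ∧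
    (∀ k ≤ r, ∀ j, (l k).coeff j ≠ 0 → lineAt b l k₁ k₂ k ≤ (j : ℚ)) ∧
    (∀ k ≤ r, ∀ j, (l k).coeff j ≠ 0 → (j : ℚ) = lineAt b l k₁ k₂ k → k₁ ≤ k ∧ k ≤ k₂)

open Classical in
/-- The characteristic polynomial of an edge: the sum over the points `(b^k, j)` of the edge of
`l_{k,j} X^(k - k₁)`. -/
def edgePoly (k₁ k₂ : ℕ) : Polynomial K :=
  ∑ k ∈ Finset.Icc k₁ k₂,
    Polynomial.C (∑ j ∈ (l k).support with (((j : ℕ) : ℚ) = lineAt b l k₁ k₂ k), (l k).coeff j)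
      * Polynomial.X ^ (k - k₁)

/-- The edge is `lam`-admissible: `lam` is a root of its characteristic polynomial. -/
def IsAdmissible {F : Type*} [Field F] [Algebra K F] (lam : F) (k₁ k₂ : ℕ) : Prop :=
  IsEdge b r l k₁ k₂ ∧ Polynomial.aeval lam (edgePoly b l k₁ k₂) = 0

/-- The set of the roots in `F` of the characteristic polynomials. -/
def Lam (F : Type*) [Field F] [Algebra K F] : Set F :=
  {lam | ∃ k₁ k₂, IsAdmissible b r l lam k₁ k₂}

/-- The set of the `lam` in `Lam` such that the linear equation has a nonzero solution of the form
`e_lam * p` with `p` a Puiseux series over `F`. -/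
def Lam' (F : Type*) [Field F] [Algebra K F] : Set F :=
  {lam | lam ∈ Lam b r l F ∧ ∃ e : Fˣ, (e : F) = lam ∧
    ∃ p : Puiseux F, p ≠ 0 ∧ applyL F b r l (MonoidAlgebra.single e p) = 0}

open Classical in
/-- The ramification bound with respect to `lam`: the least common multiple of those denominators
of slopes of `lam`-admissible edges that are coprime with `b`. -/
def ramBound {F : Type*} [Field F] [Algebra K F] (lam : F) : ℕ+ :=
  ⟨((Finset.range (r + 1) ×ˢ Finset.range (r + 1)).filter
      (fun k => IsAdmissible b r l lam k.1 k.2 ∧ Nat.Coprime (edgeSlope b l k.1 k.2).den b)).lcm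
      (fun k => (edgeSlope b l k.1 k.2).den),
    Nat.pos_of_ne_zero (by
      rw [Ne, Finset.lcm_eq_zero_iff]
      rintro ⟨k, -, hk⟩
      exact (edgeSlope b l k.1 k.2).den_ne_zero hk)⟩

end Newton

/-! ### Infinite products -/

/-- The power series expansion of `1/g`, for a rational function `g` with `g(0) = 1`. -/
def invSeries {F : Type*} [Field F] (g : RatFunc F) : PowerSeries F :=
  (g.denom : PowerSeries F) * (g.num : PowerSeries F)⁻¹

/-- The partial product of the `1/g(x^(b^k))` over `k < N`. -/
def partialProd {F : Type*} [Field F] (b : ℕ+) (g : RatFunc F) (N : ℕ) : PowerSeries F :=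
  ∏ k ∈ Finset.range N, PowerSeries.expand ((b ^ k : ℕ+) : ℕ) (b ^ k).ne_zero (invSeries g)

/-- The infinite product of the `1/g(x^(b^k))` over `k ≥ 0`, for a rational function `g` with
`g(0) = 1`. The coefficient of `x^n` in the partial products is constant from `n + 1` factors on,
see `coeff_partialProd`. -/
def infProd {F : Type*} [Field F] (b : ℕ+) (g : RatFunc F) : PowerSeries F :=
  PowerSeries.mk fun n => PowerSeries.coeff n (partialProd b g (n + 1))

theorem constantCoeff_invSeries {F : Type*} [Field F] {g : RatFunc F}
    (hg : RatFunc.eval (RingHom.id F) 0 g = 1) :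
    PowerSeries.constantCoeff (invSeries g) = 1 := by
  have h : g.num.coeff 0 / g.denom.coeff 0 = 1 := by
    simpa [RatFunc.eval, Polynomial.coeff_zero_eq_eval_zero] using hg
  have hd : g.denom.coeff 0 ≠ 0 := by
    intro h0
    simp [h0] at h
  have hn : g.num.coeff 0 = g.denom.coeff 0 := by
    field_simp at h
    exact h
  simp [invSeries, hn, hd]

theorem coeff_partialProd {F : Type*} [Field F] {b : ℕ+} (hb : 2 ≤ b) {g : RatFunc F}
    (hg : RatFunc.eval (RingHom.id F) 0 g = 1) {n N : ℕ} (hN : n < N) :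
    PowerSeries.coeff n (partialProd b g N) = PowerSeries.coeff n (infProd b g) := by
  induction N, Nat.succ_le_of_lt hN using Nat.le_induction with
  | base => simp [infProd]
  | succ N hle ih =>
    rw [← ih hle, partialProd, Finset.prod_range_succ, ← partialProd]
    have hlt : n < b ^ N := lt_trans hle (Nat.lt_pow_self (by exact_mod_cast hb))
    rw [PowerSeries.coeff_mul]
    have hz : ∀ j ≤ n, PowerSeries.coeff j
        (PowerSeries.expand ((b ^ N : ℕ+) : ℕ) (b ^ N).ne_zero (invSeries g))
          = if j = 0 then 1 else 0 := by
      intro j hj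
      rw [PowerSeries.coeff_expand]
      split_ifs with h1 h2 h2
      · subst h2
        simpa using constantCoeff_invSeries hg
      · have := Nat.le_of_dvd (Nat.pos_of_ne_zero h2) h1
        simp only [PNat.pow_coe] at this
        omega
      · subst h2
        simp at h1
      · rfl
    rw [Finset.sum_eq_single (n, 0)]
    · rw [hz 0 (Nat.zero_le _)]
      simp
    · rintro ⟨i, j⟩ hij hne
      have hij' : i + j = n := by simpa using hij
      rw [hz j (by omega), if_neg, mul_zero]
      rintro rfl
      exact hne (by simp at hij'; simp [hij'])
    · intro h
      simp at h

/-! ### The tuple attached to a similarity class -/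

/-- A tuple `(lam, g, (p_1, ..., p_s))`. -/
structure ClassData (F : Type*) [Field F] where
  lam : Fˣ
  g : RatFunc F
  s : ℕ
  p : Fin s → LaurentPolynomial F

/-- Reduced echelon form with respect to ascending degree: the minimal degrees `v i` of the `p i`
are increasing, the coefficient of `x^(v i)` is `1` in `p i` and `0` in the other `p j`. -/
def IsReducedEchelon {F : Type*} [Field F] {s : ℕ} (p : Fin s → LaurentPolynomial F) : Prop :=
  ∃ v : Fin s → ℤ, StrictMono v ∧ ∀ i,
    (∀ n < v i, (p i).coeff n = 0) ∧ (p i).coeff (v i) = 1 ∧ ∀ j ≠ i, (p j).coeff (v i) = 0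

section Tuple

variable {K : Type*} [Field K] {F : Type*} [Field F] [Algebra K F]
  (b : ℕ+) (r : ℕ) (l : ℕ → Polynomial K)

/-- The generalized series `e_lam * p_j(x^(1/q)) * ∏_{k ≥ 0} 1/g(x^(b^k/q))`, where `q` is the
ramification bound with respect to `lam`. -/
def ClassData.series (d : ClassData F) (j : Fin d.s) : DRing F :=
  MonoidAlgebra.single d.lam
    (laurentPolyAt 1 (ramBound b r l (d.lam : F)) (d.p j)
      * powerSeriesAt 1 (ramBound b r l (d.lam : F)) (infProd b d.g))

/-- The tuple is the normal form of the class `H`: `s > 0`, `g(0) = 1`, the above series form a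
basis of the vector space obtained by adjoining `0` to `H`, the family `(p_j)` is in reduced
echelon form, and the `p_j` are coprime. -/
structure ClassData.Represents (d : ClassData F) (H : Set (DRing F)) : Prop where
  s_pos : 0 < d.s
  g_zero : RatFunc.eval (RingHom.id F) 0 d.g = 1
  linearIndependent : LinearIndependent F (d.series b r l)
  span_eq : (Submodule.span F (Set.range (d.series b r l)) : Set (DRing F)) = insert 0 H
  echelon : IsReducedEchelon d.p
  coprime : ∀ c : LaurentPolynomial F, (∀ j, c ∣ d.p j) → IsUnit c

/-- The pairs `(lam, g)` extracted from the tuples of all similarity classes. -/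
def classIndices (F : Type*) [Field F] [Algebra K F] : Set (Fˣ × RatFunc F) :=
  {i | ∃ H ∈ simClasses F b r l, ∃ d : ClassData F, d.Represents b r l H ∧ (d.lam, d.g) = i}

/-- The elements of the similarity class(es) whose tuple starts with the given pair `(lam, g)`. -/
def classOf (i : Fˣ × RatFunc F) : Set (DRing F) :=
  {y | ∃ H ∈ simClasses F b r l, y ∈ H ∧
    ∃ d : ClassData F, d.Represents b r l H ∧ (d.lam, d.g) = i}

/-- `∑_j c_j p_j(x^(m/q))`, where `q` is the ramification bound with respect to `lam`. -/
def ClassData.combination (d : ClassData F) (m : ℕ+) (c : Fin d.s → F) : Puiseux F :=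
  ∑ j, c j • laurentPolyAt m (ramBound b r l (d.lam : F)) (d.p j)

end Tuple

end

end Mahler

/-!
The constants of the Mahler operator `M` on Puiseux series are the elements of `F`, and `M` has no
other eigenvalue than `1` there. Hence a hypergeometric element is a single term `e_lam * p`, it is
determined by `u = M y / y` up to a constant factor, and the solutions of the Riccati equation are
the quotients `M y / y` of the hypergeometric solutions `y` of the linear equation.

Comparing the terms of lowest order shows that a solution `e_lam * p` singles out an admissible edge
of the lower Newton polygon and that `p` is a Laurent series in `x^(1/q)`, where `q` is the
ramification bound with respect to `lam`. The class of `e_lam * p` therefore consists of the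
`e_lam * f(x^(1/q)) * p` for `f ≠ 0` in a vector space of rational functions, which has dimension at
most `r` by a Casoratian argument. Clearing denominators and a greatest common divisor makes this
space a space of coprime Laurent polynomials, times a series `w` with constant term `1` such that
`g = M w / w` is rational; then `w` is the product of the `1 / g(x^(b^k))`. Another choice of
coprime Laurent polynomials changes `w` by a unit of the ring of Laurent polynomials, so by `1`.

Finally, pairwise dissimilar hypergeometric elements are linearly independent over the ramified
rational functions, so bases of distinct classes are jointly independent over `F`, and the sum of
the dimensions of the classes is at most `r`.
-/

namespace Mahler

noncomputable section

/-! ### Coefficients and orders of Puiseux series -/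

section Coefficients

variable {F : Type*} [Field F]

theorem puiseux_ext {y z : Puiseux F} (h : ∀ a, y.1.coeff a = z.1.coeff a) : y = z :=
  Subtype.ext (HahnSeries.ext (funext h))

theorem coeff_subst (m q : ℕ+) (y : Puiseux F) (a : ℚ) :
    (subst F m q y).1.coeff a = y.1.coeff (a * q / m) := by
  have hcoeff : (subst F m q y).1.coeff (AddMonoidHom.mulLeft ((m : ℚ) / q) (a * q / m))
      = y.1.coeff (a * q / m) := HahnSeries.embDomain_mk_coeff _ _
  have harg : (m : ℚ) / q * (a * q / m) = a := by field_simp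
  rwa [AddMonoidHom.coe_mulLeft, harg] at hcoeff

theorem coeff_mahlerP (b : ℕ+) (y : Puiseux F) (a : ℚ) :
    (mahlerP F b y).1.coeff a = y.1.coeff (a / b) := by
  simp [mahlerP, coeff_subst]

theorem coeff_ofLaurent (f : LaurentSeries F) (n : ℤ) :
    (ofLaurent F f).1.coeff (n : ℚ) = f.coeff n :=
  HahnSeries.embDomain_mk_coeff (f := Int.castAddHom ℚ) Int.cast_injective
    (fun _ _ => Int.cast_le)

theorem coeff_ofLaurent_eq_zero (f : LaurentSeries F) {a : ℚ} (ha : ∀ n : ℤ, a ≠ n) :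
    (ofLaurent F f).1.coeff a = 0 := by
  by_contra h
  obtain ⟨n, rfl⟩ := laurentToHahn_support f h
  exact ha n rfl

theorem mahlerP_subst (b m q : ℕ+) (y : Puiseux F) :
    mahlerP F b (subst F m q y) = subst F (b * m) q y := by
  refine puiseux_ext fun a => ?_
  rw [coeff_mahlerP, coeff_subst, coeff_subst]
  congr 1
  push_cast
  field_simp

/-- The monomial `c * x^a`. -/
def monomialP (a : ℚ) (c : F) : Puiseux F :=
  ⟨HahnSeries.single a c, a.pnatDen, fun e he => by
    obtain rfl := HahnSeries.eq_of_mem_support_single he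
    exact ⟨e.num, by simp [Rat.num_div_den]⟩⟩

theorem coeff_monomialP (a e : ℚ) (c : F) :
    (monomialP a c).1.coeff e = if e = a then c else 0 := by
  change (HahnSeries.single a c).coeff e = _
  split_ifs with h
  · rw [h, HahnSeries.coeff_single_same]
  · exact HahnSeries.coeff_single_of_ne h

theorem monomialP_mul (a a' : ℚ) (c c' : F) :
    monomialP a c * monomialP a' c' = monomialP (a + a') (c * c') :=
  Subtype.ext HahnSeries.single_mul_single

theorem algebraMap_eq_monomialP (c : F) : algebraMap F (Puiseux F) c = monomialP 0 c := rfl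

theorem monomialP_ne_zero {a : ℚ} {c : F} (hc : c ≠ 0) : monomialP a c ≠ 0 := by
  intro h
  have hcoeff := coeff_monomialP a a c
  rw [h, if_pos rfl] at hcoeff
  exact hc hcoeff.symm

theorem coeff_monomialP_mul (a e : ℚ) (c : F) (y : Puiseux F) :
    (monomialP a c * y).1.coeff e = c * y.1.coeff (e - a) := by
  have := HahnSeries.coeff_single_mul_add (r := c) (x := y.1) (a := e - a) (b := a)
  rw [sub_add_cancel] at this
  exact this

theorem coeff_algebraMap_mul (c : F) (y : Puiseux F) (e : ℚ) :
    (algebraMap F (Puiseux F) c * y).1.coeff e = c * y.1.coeff e := by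
  rw [algebraMap_eq_monomialP, coeff_monomialP_mul, sub_zero]

theorem coeff_smul (c : F) (y : Puiseux F) (e : ℚ) : (c • y).1.coeff e = c * y.1.coeff e := by
  rw [Algebra.smul_def, coeff_algebraMap_mul]

theorem subst_monomialP (m q : ℕ+) (a : ℚ) (c : F) :
    subst F m q (monomialP a c) = monomialP (m / q * a) c := by
  refine puiseux_ext fun e => ?_
  have hiff : e * q / m = a ↔ e = m / q * a := by
    constructor <;> rintro rfl <;> field_simp
  simp only [coeff_subst, coeff_monomialP, hiff]

theorem subst_algebraMap (m q : ℕ+) (c : F) :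
    subst F m q (algebraMap F _ c) = algebraMap F _ c := by
  rw [algebraMap_eq_monomialP, subst_monomialP, mul_zero]

theorem mahlerP_algebraMap (b : ℕ+) (c : F) :
    mahlerP F b (algebraMap F _ c) = algebraMap F _ c := subst_algebraMap b 1 c

theorem mahlerP_smul (b : ℕ+) (c : F) (y : Puiseux F) :
    mahlerP F b (c • y) = c • mahlerP F b y := by
  rw [Algebra.smul_def, map_mul, mahlerP_algebraMap, Algebra.smul_def]

theorem mahlerP_iterate_smul (b : ℕ+) (k : ℕ) (c : F) (y : Puiseux F) :
    (mahlerP F b)^[k] (c • y) = c • (mahlerP F b)^[k] y :=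
  Function.Commute.iterate_left (g := (c • ·)) (mahlerP_smul b c) k y

/-- The order of a Puiseux series: its lowest exponent, with the convention that `0` has order
`0`. -/
def orderP (y : Puiseux F) : ℚ := y.1.order

/-- The coefficient of the term of lowest exponent of a Puiseux series. -/
def leadingCoeffP (y : Puiseux F) : F := y.1.coeff (orderP y)

theorem leadingCoeffP_ne_zero {y : Puiseux F} (hy : y ≠ 0) : leadingCoeffP y ≠ 0 :=
  fun h => hy (Subtype.ext (HahnSeries.coeff_order_eq_zero.1 h))

theorem coeff_eq_zero_of_lt {y : Puiseux F} {a : ℚ} (h : a < orderP y) : y.1.coeff a = 0 :=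
  HahnSeries.coeff_eq_zero_of_lt_order h

theorem orderP_le {y : Puiseux F} {a : ℚ} (h : y.1.coeff a ≠ 0) : orderP y ≤ a :=
  HahnSeries.order_le_of_coeff_ne_zero h

theorem orderP_eq {y : Puiseux F} {a : ℚ} (h : y.1.coeff a ≠ 0) (h' : ∀ e < a, y.1.coeff e = 0) :
    orderP y = a := by
  refine le_antisymm (orderP_le h) (le_of_not_gt fun hlt => ?_)
  have hy : y ≠ 0 := by rintro rfl; exact h rfl
  exact leadingCoeffP_ne_zero hy (h' _ hlt)

theorem orderP_mul {y z : Puiseux F} (hy : y ≠ 0) (hz : z ≠ 0) :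
    orderP (y * z) = orderP y + orderP z :=
  HahnSeries.order_mul (fun h => hy (Subtype.ext h)) (fun h => hz (Subtype.ext h))

theorem leadingCoeffP_mul (y z : Puiseux F) :
    leadingCoeffP (y * z) = leadingCoeffP y * leadingCoeffP z := by
  have := HahnSeries.leadingCoeff_mul y.1 z.1
  rw [HahnSeries.leadingCoeff_eq, HahnSeries.leadingCoeff_eq, HahnSeries.leadingCoeff_eq] at this
  exact this

theorem orderP_subst (m q : ℕ+) {y : Puiseux F} (hy : y ≠ 0) :
    orderP (subst F m q y) = m / q * orderP y := by
  apply orderP_eq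
  · rw [coeff_subst, show (m : ℚ) / q * orderP y * q / m = orderP y by field_simp]
    exact leadingCoeffP_ne_zero hy
  · intro e he
    rw [coeff_subst]
    apply coeff_eq_zero_of_lt
    have hm : (0 : ℚ) < m := by exact_mod_cast m.pos
    have hq : (0 : ℚ) < q := by exact_mod_cast q.pos
    rw [div_mul_eq_mul_div, lt_div_iff₀ hq] at he
    rw [div_lt_iff₀ hm]
    linarith

theorem leadingCoeffP_subst (m q : ℕ+) {y : Puiseux F} (hy : y ≠ 0) :
    leadingCoeffP (subst F m q y) = leadingCoeffP y := by
  rw [leadingCoeffP, orderP_subst m q hy, coeff_subst, leadingCoeffP]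
  congr 1
  field_simp

theorem orderP_mahlerP (b : ℕ+) {y : Puiseux F} (hy : y ≠ 0) :
    orderP (mahlerP F b y) = b * orderP y := by
  rw [mahlerP, orderP_subst b 1 hy]; simp

theorem leadingCoeffP_mahlerP (b : ℕ+) {y : Puiseux F} (hy : y ≠ 0) :
    leadingCoeffP (mahlerP F b y) = leadingCoeffP y :=
  leadingCoeffP_subst b 1 hy

theorem orderP_algebraMap {c : F} (hc : c ≠ 0) : orderP (algebraMap F (Puiseux F) c) = 0 :=
  HahnSeries.order_single hc

theorem leadingCoeffP_algebraMap (c : F) : leadingCoeffP (algebraMap F (Puiseux F) c) = c := by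
  rcases eq_or_ne c 0 with rfl | hc
  · simp [leadingCoeffP]
  · rw [leadingCoeffP, orderP_algebraMap hc, algebraMap_eq_monomialP, coeff_monomialP, if_pos rfl]

theorem eq_algebraMap_of_mahlerP_eq {b : ℕ+} (hb : 2 ≤ b) {y : Puiseux F}
    (h : mahlerP F b y = y) : ∃ c, y = algebraMap F _ c := by
  set c := y.1.coeff 0
  refine ⟨c, by_contra fun hne => ?_⟩
  have hz : y - algebraMap F _ c ≠ 0 := sub_ne_zero.2 hne
  have hord : orderP (y - algebraMap F _ c) = 0 := by
    have hM := orderP_mahlerP b hz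
    rw [map_sub, h, mahlerP_algebraMap] at hM
    have hb' : (2 : ℚ) ≤ b := by exact_mod_cast hb
    nlinarith
  apply leadingCoeffP_ne_zero hz
  change (y - algebraMap F _ c).1.coeff _ = 0
  rw [hord]
  change y.1.coeff 0 - (monomialP 0 c).1.coeff 0 = 0
  rw [coeff_monomialP, if_pos rfl, sub_self]

theorem eq_algebraMap_of_mahlerP_eq_mul {b : ℕ+} (hb : 2 ≤ b) {y : Puiseux F} (hy : y ≠ 0)
    {c c' : F} (hc : c ≠ 0)
    (h : algebraMap F _ c * mahlerP F b y = algebraMap F _ c' * y) :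
    c = c' ∧ ∃ e, y = algebraMap F _ e := by
  have hl := congrArg leadingCoeffP h
  rw [leadingCoeffP_mul, leadingCoeffP_mul, leadingCoeffP_algebraMap, leadingCoeffP_algebraMap,
    leadingCoeffP_mahlerP b hy] at hl
  obtain rfl := mul_right_cancel₀ (leadingCoeffP_ne_zero hy) hl
  refine ⟨rfl, eq_algebraMap_of_mahlerP_eq hb (mul_left_cancel₀ ?_ h)⟩
  exact (map_ne_zero _).2 hc

end Coefficients

/-! ### Linear Mahler operators -/

section Operator

variable {K : Type*} [Field K] {F : Type*} [Field F] [Algebra K F]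
  (b : ℕ+) (r : ℕ) (l : ℕ → Polynomial K)

theorem coeff_mahler (y : DRing F) (lam : Fˣ) :
    (mahler F b y).coeff lam = algebraMap F _ (lam : F) * mahlerP F b (y.coeff lam) := by
  classical
  induction y using MonoidAlgebra.induction_linear with
  | zero => simp
  | add y z hy hz => simp [hy, hz, mul_add]
  | single m p =>
    rw [mahler_single, MonoidAlgebra.coeff_single, MonoidAlgebra.coeff_single, Finsupp.single_apply,
      Finsupp.single_apply]
    split_ifs with h
    · rw [h]
    · simp

theorem mahler_iterate_single (k : ℕ) (lam : Fˣ) (p : Puiseux F) :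
    (mahler F b)^[k] (MonoidAlgebra.single lam p)
      = MonoidAlgebra.single lam (algebraMap F _ (lam : F) ^ k * (mahlerP F b)^[k] p) := by
  induction k with
  | zero => simp
  | succ k ih =>
    rw [Function.iterate_succ_apply', ih, mahler_single, map_mul, map_pow, mahlerP_algebraMap,
      Function.iterate_succ_apply', pow_succ']
    ring_nf

/-- The operator `p ↦ ∑ k, l_k lam^k M^k p` on Puiseux series, which is `L` conjugated by `e_lam`:
its kernel consists of the `p` such that `e_lam p` is a solution of the linear equation. -/
def twistedOp (lam : F) : Puiseux F →ₗ[F] Puiseux F where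
  toFun p := ∑ k ∈ Finset.range (r + 1),
    polyCoeff F (l k) * (algebraMap F _ lam ^ k * (mahlerP F b)^[k] p)
  map_add' p p' := by
    simp only [iterate_map_add, mul_add, Finset.sum_add_distrib]
  map_smul' c p := by
    simp only [mahlerP_iterate_smul, mul_smul_comm, Finset.smul_sum, RingHom.id_apply]

theorem twistedOp_apply (lam : F) (p : Puiseux F) :
    twistedOp b r l lam p = ∑ k ∈ Finset.range (r + 1),
      polyCoeff F (l k) * (algebraMap F _ lam ^ k * (mahlerP F b)^[k] p) := rfl

theorem applyL_single (lam : Fˣ) (p : Puiseux F) :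
    applyL F b r l (MonoidAlgebra.single lam p)
      = MonoidAlgebra.single lam (twistedOp b r l (lam : F) p) := by
  simp only [applyL, mahler_iterate_single, MonoidAlgebra.smul_single, smul_eq_mul,
    twistedOp_apply]
  exact (map_sum (MonoidAlgebra.singleAddHom lam) _ _).symm

theorem applyL_single_eq_zero_iff (lam : Fˣ) (p : Puiseux F) :
    applyL F b r l (MonoidAlgebra.single lam p) = 0 ↔ twistedOp b r l (lam : F) p = 0 := by
  rw [applyL_single, MonoidAlgebra.single_eq_zero]

end Operator

/-! ### Rational functions and Laurent polynomials in `x^(1/q)` -/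

section Embeddings

variable {F : Type*} [Field F]

theorem monomialP_pow (a : ℚ) (c : F) (n : ℕ) :
    monomialP a c ^ n = monomialP (n * a) (c ^ n) := by
  rw [← nsmul_eq_mul]
  exact Subtype.ext (HahnSeries.single_pow a n c)

theorem ofLaurent_single (n : ℤ) (c : F) :
    ofLaurent F (HahnSeries.single n c) = monomialP (n : ℚ) c := by
  refine puiseux_ext fun a => ?_
  rw [coeff_monomialP]
  by_cases h : ∃ k : ℤ, a = k
  · obtain ⟨k, rfl⟩ := h
    simp only [coeff_ofLaurent, HahnSeries.coeff_single, Int.cast_inj]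
    split_ifs <;> rfl
  · push Not at h
    rw [coeff_ofLaurent_eq_zero _ h, if_neg (h n)]

open scoped RatFunc in
/-- The ring homomorphism `f ↦ f(x^(m/q))` on rational functions. -/
def ratHom (F : Type*) [Field F] (m q : ℕ+) : RatFunc F →+* Puiseux F :=
  ((subst F m q).comp (ofLaurent F)).comp (algebraMap (RatFunc F) (LaurentSeries F))

theorem ratAt_eq (m q : ℕ+) (f : RatFunc F) : ratAt m q f = ratHom F m q f := rfl

theorem ratHom_X (m q : ℕ+) : ratHom F m q RatFunc.X = monomialP (m / q : ℚ) 1 := by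
  change subst F m q (ofLaurent F (RatFunc.X : RatFunc F)) = _
  rw [RatFunc.coe_X, ofLaurent_single, subst_monomialP, Int.cast_one, mul_one]

theorem ratHom_polynomial (m q : ℕ+) (P : Polynomial F) :
    ratHom F m q (algebraMap _ _ P)
      = subst F m q (ofLaurent F (HahnSeries.ofPowerSeries ℤ F (P : PowerSeries F))) := by
  rw [RatFunc.coe_coe]
  rfl

theorem ratHom_C (m q : ℕ+) (c : F) : ratHom F m q (RatFunc.C c) = algebraMap F _ c := by
  have hC : HahnSeries.ofPowerSeries ℤ F (PowerSeries.C c) = HahnSeries.single 0 c :=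
    HahnSeries.ofPowerSeries_C c
  rw [← RatFunc.algebraMap_C, ratHom_polynomial, Polynomial.coe_C, hC, ofLaurent_single,
    Int.cast_zero, ← algebraMap_eq_monomialP, subst_algebraMap]

theorem ratFunc_ringHom_ext {R : Type*} [CommRing R] {φ ψ : RatFunc F →+* R}
    (hC : ∀ c, φ (RatFunc.C c) = ψ (RatFunc.C c)) (hX : φ RatFunc.X = ψ RatFunc.X) : φ = ψ := by
  refine IsLocalization.ringHom_ext (nonZeroDivisors (Polynomial F)) ?_
  refine Polynomial.ringHom_ext (fun c => ?_) ?_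
  · simpa using hC c
  · simpa using hX

theorem mahlerP_ratHom (b m q : ℕ+) (f : RatFunc F) :
    mahlerP F b (ratHom F m q f) = ratHom F (b * m) q f :=
  mahlerP_subst b m q _

theorem nonZeroDivisors_le_comap_expand (n : ℕ+) :
    nonZeroDivisors (Polynomial F)
      ≤ (nonZeroDivisors (Polynomial F)).comap (Polynomial.expand F n).toRingHom := by
  intro P hP
  rw [mem_nonZeroDivisors_iff_ne_zero] at hP
  rw [Submonoid.mem_comap, mem_nonZeroDivisors_iff_ne_zero]
  exact (Polynomial.expand_ne_zero n.pos).2 hP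

/-- The ring homomorphism `f(x) ↦ f(x^n)` on rational functions. -/
def expandRat (F : Type*) [Field F] (n : ℕ+) : RatFunc F →+* RatFunc F :=
  RatFunc.mapRingHom (Polynomial.expand F n).toRingHom (nonZeroDivisors_le_comap_expand n)

theorem expandRat_algebraMap (n : ℕ+) (P : Polynomial F) :
    expandRat F n (algebraMap _ _ P) = algebraMap _ _ (Polynomial.expand F n P) := by
  have hdiv := RatFunc.map_apply_div (Polynomial.expand F n).toRingHom
    (nonZeroDivisors_le_comap_expand n) P 1
  simp only [map_one, div_one] at hdiv
  exact hdiv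

theorem ratHom_expandRat (n m q : ℕ+) (f : RatFunc F) :
    ratHom F m q (expandRat F n f) = ratHom F (n * m) q f := by
  have hcomp : (ratHom F m q).comp (expandRat F n) = ratHom F (n * m) q := by
    refine ratFunc_ringHom_ext (fun c => ?_) ?_
    · rw [RingHom.comp_apply, ← RatFunc.algebraMap_C, expandRat_algebraMap, Polynomial.expand_C,
        RatFunc.algebraMap_C, ratHom_C, ratHom_C]
    · rw [RingHom.comp_apply, ← RatFunc.algebraMap_X, expandRat_algebraMap, Polynomial.expand_X,
        map_pow, map_pow, RatFunc.algebraMap_X, ratHom_X, ratHom_X, monomialP_pow, one_pow]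
      congr 1
      push_cast
      ring
  exact DFunLike.congr_fun hcomp f

theorem ratHom_mul_mul (n m q : ℕ+) (f : RatFunc F) :
    ratHom F (n * m) (n * q) f = ratHom F m q f := by
  have heq : ratHom F (n * m) (n * q) = ratHom F m q := by
    refine ratFunc_ringHom_ext (fun c => by rw [ratHom_C, ratHom_C]) ?_
    rw [ratHom_X, ratHom_X]
    congr 1
    push_cast
    field_simp
  rw [heq]

theorem ratHom_mem_ramRat (m q : ℕ+) (f : RatFunc F) : ratHom F m q f ∈ ramRat F :=
  ⟨q, expandRat F m f, by rw [ratAt_eq, ratHom_expandRat, mul_one]⟩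

theorem exists_common_ramification {y z : Puiseux F} (hy : y ∈ ramRat F) (hz : z ∈ ramRat F) :
    ∃ (q : ℕ+) (f g : RatFunc F), y = ratHom F 1 q f ∧ z = ratHom F 1 q g := by
  obtain ⟨q, f, rfl⟩ := hy
  obtain ⟨q', g, rfl⟩ := hz
  refine ⟨q * q', expandRat F q' f, expandRat F q g, ?_, ?_⟩
  · rw [ratHom_expandRat, mul_comm q, ratHom_mul_mul, ratAt_eq]
  · rw [ratHom_expandRat, ratHom_mul_mul, ratAt_eq]

/-- The set `ramRat F` of ramified rational functions as a subfield of the field of Puiseux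
series. -/
def ramRatField (F : Type*) [Field F] : Subfield (Puiseux F) where
  carrier := ramRat F
  mul_mem' hy hz := by
    obtain ⟨q, f, g, rfl, rfl⟩ := exists_common_ramification hy hz
    exact ⟨q, f * g, (map_mul (ratHom F 1 q) f g).symm⟩
  one_mem' := ⟨1, 1, (map_one (ratHom F 1 1)).symm⟩
  add_mem' hy hz := by
    obtain ⟨q, f, g, rfl, rfl⟩ := exists_common_ramification hy hz
    exact ⟨q, f + g, (map_add (ratHom F 1 q) f g).symm⟩
  zero_mem' := ⟨1, 0, (map_zero (ratHom F 1 1)).symm⟩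
  neg_mem' := by
    rintro _ ⟨q, f, rfl⟩
    exact ⟨q, -f, (map_neg (ratHom F 1 q) f).symm⟩
  inv_mem' := by
    rintro _ ⟨q, f, rfl⟩
    exact ⟨q, f⁻¹, (map_inv₀ (ratHom F 1 q) f).symm⟩

theorem algebraMap_mem_ramRatField (c : F) : algebraMap F _ c ∈ ramRatField F :=
  ⟨1, RatFunc.C c, (ratHom_C 1 1 c).symm⟩

theorem mahlerP_mem_ramRatField (b : ℕ+) {y : Puiseux F} (hy : y ∈ ramRatField F) :
    mahlerP F b y ∈ ramRatField F := by
  obtain ⟨q, f, rfl⟩ := hy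
  rw [ratAt_eq, mahlerP_ratHom]
  exact ratHom_mem_ramRat _ _ _

theorem laurentPolyAt_single (m q : ℕ+) (n : ℤ) (c : F) :
    laurentPolyAt m q (AddMonoidAlgebra.single n c) = monomialP (m / q * n : ℚ) c := by
  have hsingle : HahnSeries.ofFinsupp (AddMonoidAlgebra.single n c : LaurentPolynomial F).coeff
      = HahnSeries.single n c := by
    ext a
    simp only [HahnSeries.coeff_ofFinsupp, AddMonoidAlgebra.coeff_single, Finsupp.single_apply,
      HahnSeries.coeff_single, eq_comm]
  rw [laurentPolyAt, hsingle, ofLaurent_single, subst_monomialP]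

theorem laurentPolyAt_add (m q : ℕ+) (p p' : LaurentPolynomial F) :
    laurentPolyAt m q (p + p') = laurentPolyAt m q p + laurentPolyAt m q p' := by
  rw [laurentPolyAt, AddMonoidAlgebra.coeff_add]
  exact map_add ((subst F m q).comp (ofLaurent F)) (HahnSeries.ofFinsupp p.coeff)
    (HahnSeries.ofFinsupp p'.coeff)

theorem laurentPolyAt_mul (m q : ℕ+) (p p' : LaurentPolynomial F) :
    laurentPolyAt m q (p * p') = laurentPolyAt m q p * laurentPolyAt m q p' := by
  have hzero : laurentPolyAt m q (0 : LaurentPolynomial F) = 0 :=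
    map_zero ((subst F m q).comp (ofLaurent F))
  induction p using AddMonoidAlgebra.induction_linear with
  | zero => rw [zero_mul, hzero, zero_mul]
  | add x y hx hy => simp only [add_mul, laurentPolyAt_add, hx, hy]
  | single n c =>
    induction p' using AddMonoidAlgebra.induction_linear with
    | zero => rw [mul_zero, hzero, mul_zero]
    | add x y hx hy => simp only [mul_add, laurentPolyAt_add, hx, hy]
    | single n' c' =>
      simp only [AddMonoidAlgebra.single_mul_single, laurentPolyAt_single, monomialP_mul,
        Int.cast_add, mul_add]

/-- The algebra homomorphism `p ↦ p(x^(m/q))` on Laurent polynomials. -/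
def laurentHom (F : Type*) [Field F] (m q : ℕ+) : LaurentPolynomial F →ₐ[F] Puiseux F where
  toFun := laurentPolyAt m q
  map_zero' := map_zero ((subst F m q).comp (ofLaurent F))
  map_add' := laurentPolyAt_add m q
  map_one' := by
    rw [AddMonoidAlgebra.one_def, laurentPolyAt_single, Int.cast_zero, mul_zero]
    rfl
  map_mul' := laurentPolyAt_mul m q
  commutes' c := by
    rw [algebraMap_eq_monomialP, LaurentPolynomial.algebraMap_apply,
      ← LaurentPolynomial.single_eq_C, laurentPolyAt_single, Int.cast_zero, mul_zero]
    rfl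

theorem laurentPolyAt_eq (m q : ℕ+) (p : LaurentPolynomial F) :
    laurentPolyAt m q p = laurentHom F m q p := rfl

theorem mahlerP_laurentHom (b m q : ℕ+) (p : LaurentPolynomial F) :
    mahlerP F b (laurentHom F m q p) = laurentHom F (b * m) q p :=
  mahlerP_subst b m q _

theorem coeff_laurentHom (q : ℕ+) (p : LaurentPolynomial F) (n : ℤ) :
    (laurentHom F 1 q p).1.coeff (n / q : ℚ) = p.coeff n := by
  change (subst F 1 q _).1.coeff _ = _
  rw [coeff_subst, show (n / q : ℚ) * q / ((1 : ℕ+) : ℚ) = n by simp, coeff_ofLaurent]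
  rfl

theorem laurentHom_injective (q : ℕ+) : Function.Injective (laurentHom F 1 q) := by
  intro p p' h
  ext n
  rw [← coeff_laurentHom q, h, coeff_laurentHom]

theorem laurentHom_toLaurent (m q : ℕ+) (P : Polynomial F) :
    laurentHom F m q (Polynomial.toLaurent P) = ratHom F m q (algebraMap _ _ P) := by
  have hcomp : (laurentHom F m q).toRingHom.comp Polynomial.toLaurent
      = (ratHom F m q).comp (algebraMap _ _) := by
    refine Polynomial.ringHom_ext (fun c => ?_) ?_
    · simp only [RingHom.comp_apply, Polynomial.toLaurent_C, RatFunc.algebraMap_C, ratHom_C]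
      exact (laurentHom F m q).commutes c
    · simp only [RingHom.comp_apply, Polynomial.toLaurent_X, RatFunc.algebraMap_X, ratHom_X]
      change laurentPolyAt m q (AddMonoidAlgebra.single 1 1) = _
      rw [laurentPolyAt_single, Int.cast_one, mul_one]
  exact DFunLike.congr_fun hcomp P

end Embeddings

/-! ### Power series and polynomial coefficients -/

section PolyCoeff

variable {K : Type*} [Field K] {F : Type*} [Field F] [Algebra K F]

theorem coeff_powerSeriesAt (q : ℕ+) (s : PowerSeries F) (n : ℕ) :
    (powerSeriesAt 1 q s).1.coeff (n / q : ℚ) = PowerSeries.coeff n s := by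
  rw [powerSeriesAt, coeff_subst,
    show (n / q : ℚ) * q / ((1 : ℕ+) : ℚ) = ((n : ℤ) : ℚ) by simp, coeff_ofLaurent]
  exact HahnSeries.ofPowerSeries_apply_coeff s n

theorem coeff_powerSeriesAt_eq_zero (q : ℕ+) (s : PowerSeries F) {a : ℚ}
    (ha : ∀ n : ℕ, a ≠ n / q) : (powerSeriesAt 1 q s).1.coeff a = 0 := by
  have hq : (q : ℚ) ≠ 0 := by exact_mod_cast q.ne_zero
  rw [powerSeriesAt, coeff_subst, PNat.val_ofNat, Nat.cast_one, div_one]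
  by_cases h : ∃ k : ℤ, a * q = k
  · obtain ⟨k, hk⟩ := h
    rw [hk, coeff_ofLaurent, HahnSeries.ofPowerSeries_apply]
    refine HahnSeries.embDomain_notin_image_support ?_
    rintro ⟨n, -, rfl⟩
    apply ha n
    rw [eq_div_iff hq, hk]
    simp
  · push Not at h
    exact coeff_ofLaurent_eq_zero _ h

theorem ratHom_polynomial_eq_powerSeriesAt (m q : ℕ+) (P : Polynomial F) :
    ratHom F m q (algebraMap _ _ P) = powerSeriesAt m q (P : PowerSeries F) :=
  ratHom_polynomial m q P

theorem coeff_ratHom_polynomial (q : ℕ+) (P : Polynomial F) (n : ℕ) :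
    (ratHom F 1 q (algebraMap _ _ P)).1.coeff (n / q : ℚ) = P.coeff n := by
  rw [ratHom_polynomial_eq_powerSeriesAt, coeff_powerSeriesAt, Polynomial.coeff_coe]

theorem coeff_ratHom_polynomial_eq_zero (q : ℕ+) (P : Polynomial F) {a : ℚ}
    (ha : ∀ n : ℕ, a ≠ n / q) : (ratHom F 1 q (algebraMap _ _ P)).1.coeff a = 0 := by
  rw [ratHom_polynomial_eq_powerSeriesAt, coeff_powerSeriesAt_eq_zero q _ ha]

theorem orderP_ratHom_polynomial (q : ℕ+) {P : Polynomial F} (hP : P ≠ 0) :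
    orderP (ratHom F 1 q (algebraMap _ _ P)) = P.natTrailingDegree / q := by
  have hq : (0 : ℚ) < q := by exact_mod_cast q.pos
  apply orderP_eq
  · rw [coeff_ratHom_polynomial]
    exact Polynomial.trailingCoeff_nonzero_iff_nonzero.2 hP
  · intro e he
    by_cases h : ∃ n : ℕ, e = n / q
    · obtain ⟨n, rfl⟩ := h
      rw [div_lt_div_iff_of_pos_right hq, Nat.cast_lt] at he
      rw [coeff_ratHom_polynomial, Polynomial.coeff_eq_zero_of_lt_natTrailingDegree he]
    · exact coeff_ratHom_polynomial_eq_zero q P (not_exists.1 h)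

theorem leadingCoeffP_ratHom_polynomial (q : ℕ+) {P : Polynomial F} (hP : P ≠ 0) :
    leadingCoeffP (ratHom F 1 q (algebraMap _ _ P)) = P.trailingCoeff := by
  rw [leadingCoeffP, orderP_ratHom_polynomial q hP, coeff_ratHom_polynomial,
    Polynomial.trailingCoeff]

theorem polyCoeff_eq (P : Polynomial K) :
    polyCoeff F P = ratHom F 1 1 (algebraMap _ _ (P.map (algebraMap K F))) := rfl

theorem coeff_polyCoeff_eq_zero (P : Polynomial K) {a : ℚ} (ha : ∀ n : ℕ, a ≠ n) :
    (polyCoeff F P).1.coeff a = 0 :=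
  coeff_ratHom_polynomial_eq_zero 1 _ (by simpa using ha)

theorem polyCoeff_zero : polyCoeff F (0 : Polynomial K) = 0 := by
  rw [polyCoeff_eq, Polynomial.map_zero, map_zero, map_zero]

theorem natTrailingDegree_map_algebraMap (P : Polynomial K) :
    (P.map (algebraMap K F)).natTrailingDegree = P.natTrailingDegree := by
  rcases eq_or_ne P 0 with rfl | hP
  · rw [Polynomial.map_zero, Polynomial.natTrailingDegree_zero, Polynomial.natTrailingDegree_zero]
  · simp only [Polynomial.natTrailingDegree_eq_support_min' hP,
      Polynomial.natTrailingDegree_eq_support_min' ((Polynomial.map_ne_zero_iff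
        (algebraMap K F).injective).2 hP),
      Polynomial.support_map_of_injective P (algebraMap K F).injective]

theorem orderP_polyCoeff {P : Polynomial K} (hP : P ≠ 0) :
    orderP (polyCoeff F P) = P.natTrailingDegree := by
  rw [polyCoeff_eq, orderP_ratHom_polynomial 1 (Polynomial.map_ne_zero hP),
    natTrailingDegree_map_algebraMap, PNat.one_coe, Nat.cast_one, div_one]

theorem leadingCoeffP_polyCoeff {P : Polynomial K} (hP : P ≠ 0) :
    leadingCoeffP (polyCoeff F P) = algebraMap K F P.trailingCoeff := by
  rw [polyCoeff_eq, leadingCoeffP_ratHom_polynomial 1 (Polynomial.map_ne_zero hP),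
    Polynomial.trailingCoeff, natTrailingDegree_map_algebraMap, Polynomial.coeff_map,
    Polynomial.trailingCoeff]

theorem polyCoeff_ne_zero {P : Polynomial K} (hP : P ≠ 0) : polyCoeff F P ≠ 0 := by
  rw [polyCoeff_eq]
  exact (map_ne_zero _).2 (RatFunc.algebraMap_ne_zero (Polynomial.map_ne_zero hP))

end PolyCoeff

/-! ### The leading term of a solution and the lower Newton polygon -/

section Newton

variable {K : Type*} [Field K] {F : Type*} [Field F] [Algebra K F]
  {b : ℕ+} {r : ℕ} {l : ℕ → Polynomial K}

theorem mahlerP_iterate_ne_zero (k : ℕ) {p : Puiseux F} (hp : p ≠ 0) :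
    (mahlerP F b)^[k] p ≠ 0 := by
  induction k with
  | zero => exact hp
  | succ k ih => rw [Function.iterate_succ_apply']; exact (map_ne_zero _).2 ih

theorem orderP_mahlerP_iterate (k : ℕ) {p : Puiseux F} (hp : p ≠ 0) :
    orderP ((mahlerP F b)^[k] p) = (b : ℚ) ^ k * orderP p := by
  induction k with
  | zero => simp
  | succ k ih =>
    rw [Function.iterate_succ_apply', orderP_mahlerP b (mahlerP_iterate_ne_zero k hp), ih,
      pow_succ']
    ring

theorem leadingCoeffP_mahlerP_iterate (k : ℕ) {p : Puiseux F} (hp : p ≠ 0) :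
    leadingCoeffP ((mahlerP F b)^[k] p) = leadingCoeffP p := by
  induction k with
  | zero => rfl
  | succ k ih =>
    rw [Function.iterate_succ_apply', leadingCoeffP_mahlerP b (mahlerP_iterate_ne_zero k hp), ih]

variable (b l) in
/-- The value at `(b^k, j)`, with `j` the trailing degree of `l_k`, of the linear form
`(x, y) ↦ y + v x`. It is the order of `l_k M^k p` for a Puiseux series `p` of order `v`. -/
def termOrder (v : ℚ) (k : ℕ) : ℚ := (l k).natTrailingDegree + (b : ℚ) ^ k * v

variable (b r l) in
open Classical in
/-- The face of the lower Newton polygon with slope `-v`, given by the set of the indices `k` of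
its points `(b^k, j)`: those for which `termOrder b l v` is minimal. -/
def lowerFace (v : ℚ) : Finset ℕ :=
  {k ∈ Finset.range (r + 1) |
    l k ≠ 0 ∧ ∀ i ≤ r, l i ≠ 0 → termOrder b l v k ≤ termOrder b l v i}

theorem mem_lowerFace {v : ℚ} {k : ℕ} :
    k ∈ lowerFace b r l v ↔
      k ≤ r ∧ l k ≠ 0 ∧ ∀ i ≤ r, l i ≠ 0 → termOrder b l v k ≤ termOrder b l v i := by
  simp [lowerFace]

theorem lowerFace_nonempty (hl0 : l 0 ≠ 0) (v : ℚ) : (lowerFace b r l v).Nonempty := by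
  classical
  obtain ⟨k, hk, hmin⟩ := Finset.exists_min_image {k ∈ Finset.range (r + 1) | l k ≠ 0}
    (termOrder b l v) ⟨0, by simp [hl0]⟩
  simp only [Finset.mem_filter, Finset.mem_range, Nat.lt_succ_iff, and_imp] at hk hmin
  exact ⟨k, mem_lowerFace.2 ⟨hk.1, hk.2, hmin⟩⟩

theorem mem_lowerFace_iff_termOrder_eq {v : ℚ} {k i : ℕ} (hk : k ∈ lowerFace b r l v) (hi : i ≤ r)
    (hli : l i ≠ 0) : i ∈ lowerFace b r l v ↔ termOrder b l v k = termOrder b l v i := by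
  have hk' := mem_lowerFace.1 hk
  refine ⟨fun h => ?_, fun h => mem_lowerFace.2 ⟨hi, hli, fun i' hi' hli' => ?_⟩⟩
  · exact le_antisymm (hk'.2.2 i hi hli) ((mem_lowerFace.1 h).2.2 k hk'.1 hk'.2.1)
  · exact h ▸ hk'.2.2 i' hi' hli'

theorem orderP_twistedOp_term {lam : F} (hlam : lam ≠ 0) {p : Puiseux F} (hp : p ≠ 0) {k : ℕ}
    (hk : l k ≠ 0) :
    orderP (polyCoeff F (l k) * (algebraMap F _ lam ^ k * (mahlerP F b)^[k] p))
      = termOrder b l (orderP p) k := by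
  have hpow : algebraMap F (Puiseux F) (lam ^ k) ≠ 0 := (map_ne_zero _).2 (pow_ne_zero k hlam)
  have hM := mahlerP_iterate_ne_zero (b := b) k hp
  rw [← map_pow, orderP_mul (polyCoeff_ne_zero hk) (mul_ne_zero hpow hM), orderP_mul hpow hM,
    orderP_polyCoeff hk, orderP_mahlerP_iterate k hp, orderP_algebraMap (pow_ne_zero k hlam),
    zero_add, termOrder]

theorem leadingCoeffP_twistedOp_term (lam : F) {p : Puiseux F} (hp : p ≠ 0) {k : ℕ}
    (hk : l k ≠ 0) :
    leadingCoeffP (polyCoeff F (l k) * (algebraMap F _ lam ^ k * (mahlerP F b)^[k] p))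
      = algebraMap K F (l k).trailingCoeff * lam ^ k * leadingCoeffP p := by
  rw [← map_pow, leadingCoeffP_mul, leadingCoeffP_mul, leadingCoeffP_algebraMap,
    leadingCoeffP_polyCoeff hk, leadingCoeffP_mahlerP_iterate k hp, mul_assoc]

theorem coeff_finset_sum {ι : Type*} (s : Finset ι) (f : ι → Puiseux F) (a : ℚ) :
    (∑ i ∈ s, f i).1.coeff a = ∑ i ∈ s, (f i).1.coeff a := by
  rw [AddSubmonoidClass.coe_finsetSum, HahnSeries.coeff_sum]

/-- The vanishing of the coefficient of lowest order in `L (e_lam p)`. -/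
theorem sum_lowerFace_eq_zero {lam : F} (hlam : lam ≠ 0) {p : Puiseux F} (hp : p ≠ 0)
    (h : twistedOp b r l lam p = 0) :
    ∑ k ∈ lowerFace b r l (orderP p), algebraMap K F (l k).trailingCoeff * lam ^ k = 0 := by
  rcases (lowerFace b r l (orderP p)).eq_empty_or_nonempty with hempty | ⟨k₀, hk₀⟩
  · rw [hempty, Finset.sum_empty]
  have hterm : ∀ k ∈ Finset.range (r + 1),
      (polyCoeff F (l k) * (algebraMap F _ lam ^ k * (mahlerP F b)^[k] p)).1.coeff
          (termOrder b l (orderP p) k₀)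
        = if k ∈ lowerFace b r l (orderP p)
          then algebraMap K F (l k).trailingCoeff * lam ^ k * leadingCoeffP p else 0 := by
    intro k hk
    by_cases hlk : l k = 0
    · simp [hlk, polyCoeff_zero, mem_lowerFace]
    have hkr : k ≤ r := Nat.lt_succ_iff.1 (Finset.mem_range.1 hk)
    have hle := (mem_lowerFace.1 hk₀).2.2 k hkr hlk
    rw [← leadingCoeffP_twistedOp_term (b := b) lam hp hlk]
    split_ifs with hmem
    · rw [(mem_lowerFace_iff_termOrder_eq hk₀ hkr hlk).1 hmem, ← orderP_twistedOp_term hlam hp hlk]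
      rfl
    · apply coeff_eq_zero_of_lt
      rw [orderP_twistedOp_term hlam hp hlk]
      exact hle.lt_of_ne fun heq => hmem ((mem_lowerFace_iff_termOrder_eq hk₀ hkr hlk).2 heq)
  have hcoeff := congrArg (fun y : Puiseux F => y.1.coeff (termOrder b l (orderP p) k₀)) h
  simp only [twistedOp_apply, coeff_finset_sum] at hcoeff
  have hface : {k ∈ Finset.range (r + 1) | k ∈ lowerFace b r l (orderP p)}
      = lowerFace b r l (orderP p) := by
    ext k
    simp only [Finset.mem_filter, Finset.mem_range, Nat.lt_succ_iff, and_iff_right_iff_imp]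
    exact fun hk => (mem_lowerFace.1 hk).1
  rw [Finset.sum_congr rfl hterm, ← Finset.sum_filter, hface, ← Finset.sum_mul] at hcoeff
  exact (mul_eq_zero.1 hcoeff).resolve_right (leadingCoeffP_ne_zero hp)

theorem lowerFace_nontrivial (hl0 : l 0 ≠ 0) {lam : F} (hlam : lam ≠ 0) {p : Puiseux F}
    (hp : p ≠ 0) (h : twistedOp b r l lam p = 0) : (lowerFace b r l (orderP p)).Nontrivial := by
  refine ((lowerFace_nonempty hl0 _).exists_eq_singleton_or_nontrivial).resolve_left ?_
  rintro ⟨k, hk⟩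
  have hsum := sum_lowerFace_eq_zero hlam hp h
  rw [hk, Finset.sum_singleton] at hsum
  have hlk : l k ≠ 0 := (mem_lowerFace.1 (hk ▸ Finset.mem_singleton_self k)).2.1
  refine mul_ne_zero ((map_ne_zero _).2 ?_) (pow_ne_zero k hlam) hsum
  exact Polynomial.trailingCoeff_nonzero_iff_nonzero.2 hlk

section Edge

variable {v : ℚ} {k₁ k₂ : ℕ}

theorem edgeSlope_eq_neg (hb : 2 ≤ b) (hlt : k₁ < k₂) (h₁ : k₁ ∈ lowerFace b r l v)
    (h₂ : k₂ ∈ lowerFace b r l v) : edgeSlope b l k₁ k₂ = -v := by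
  have hb1 : (1 : ℚ) < b := by exact_mod_cast hb
  have hpow : (b : ℚ) ^ k₂ - (b : ℚ) ^ k₁ ≠ 0 := sub_ne_zero.2 (pow_lt_pow_right₀ hb1 hlt).ne'
  have h₂' := mem_lowerFace.1 h₂
  have heq := (mem_lowerFace_iff_termOrder_eq h₁ h₂'.1 h₂'.2.1).1 h₂
  rw [termOrder, termOrder] at heq
  rw [edgeSlope, div_eq_iff hpow]
  linarith

theorem lineAt_eq (hslope : edgeSlope b l k₁ k₂ = -v) (k : ℕ) :
    lineAt b l k₁ k₂ k = termOrder b l v k₁ - (b : ℚ) ^ k * v := by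
  rw [lineAt, hslope, termOrder]
  ring

theorem lineAt_le_natTrailingDegree (hslope : edgeSlope b l k₁ k₂ = -v)
    (h₁ : k₁ ∈ lowerFace b r l v) {k : ℕ} (hk : k ≤ r) (hlk : l k ≠ 0) :
    lineAt b l k₁ k₂ k ≤ (l k).natTrailingDegree := by
  have hle := (mem_lowerFace.1 h₁).2.2 k hk hlk
  rw [lineAt_eq hslope, sub_le_iff_le_add]
  exact hle

theorem eq_lineAt_iff (hslope : edgeSlope b l k₁ k₂ = -v) (h₁ : k₁ ∈ lowerFace b r l v) {k j : ℕ}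
    (hk : k ≤ r) (hj : (l k).coeff j ≠ 0) :
    (j : ℚ) = lineAt b l k₁ k₂ k ↔ k ∈ lowerFace b r l v ∧ j = (l k).natTrailingDegree := by
  have hlk : l k ≠ 0 := by
    rintro h
    exact hj (by rw [h, Polynomial.coeff_zero])
  rw [mem_lowerFace_iff_termOrder_eq h₁ hk hlk, lineAt_eq hslope]
  refine ⟨fun heq => ?_, fun ⟨hface, hdeg⟩ => by rw [hface, hdeg, termOrder]; ring⟩
  have hle : (l k).natTrailingDegree ≤ j := Polynomial.natTrailingDegree_le_of_ne_zero hj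
  have hge : (j : ℚ) ≤ (l k).natTrailingDegree := by
    rw [heq, ← lineAt_eq hslope]
    exact lineAt_le_natTrailingDegree hslope h₁ hk hlk
  obtain rfl : j = (l k).natTrailingDegree := le_antisymm (by exact_mod_cast hge) hle
  exact ⟨by rw [termOrder.eq_1 b l v k, heq]; ring, rfl⟩

theorem isEdge_of_isLeast_of_isGreatest (hb : 2 ≤ b) (hlt : k₁ < k₂)
    (h₁ : IsLeast (lowerFace b r l v : Set ℕ) k₁)
    (h₂ : IsGreatest (lowerFace b r l v : Set ℕ) k₂) : IsEdge b r l k₁ k₂ := by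
  have hslope := edgeSlope_eq_neg hb hlt h₁.1 h₂.1
  have hk₂ := mem_lowerFace.1 h₂.1
  refine ⟨hlt, hk₂.1, (mem_lowerFace.1 h₁.1).2.1, hk₂.2.1, fun k hk j hj => ?_,
    fun k hk j hj heq => ?_⟩
  · have hlk : l k ≠ 0 := by
      rintro h
      exact hj (by rw [h, Polynomial.coeff_zero])
    refine (lineAt_le_natTrailingDegree hslope h₁.1 hk hlk).trans ?_
    exact_mod_cast Polynomial.natTrailingDegree_le_of_ne_zero hj
  · have hmem := ((eq_lineAt_iff hslope h₁.1 hk hj).1 heq).1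
    exact ⟨h₁.2 hmem, h₂.2 hmem⟩

open Classical in
theorem sum_coeff_on_line (hslope : edgeSlope b l k₁ k₂ = -v) (h₁ : k₁ ∈ lowerFace b r l v)
    {k : ℕ} (hk : k ≤ r) :
    ∑ j ∈ (l k).support with ((j : ℕ) : ℚ) = lineAt b l k₁ k₂ k, (l k).coeff j
      = if k ∈ lowerFace b r l v then (l k).trailingCoeff else 0 := by
  have hfilter : {j ∈ (l k).support | ((j : ℕ) : ℚ) = lineAt b l k₁ k₂ k}
      = if k ∈ lowerFace b r l v then {(l k).natTrailingDegree} else ∅ := by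
    ext j
    by_cases hj : (l k).coeff j = 0
    · have hne : k ∈ lowerFace b r l v → j ≠ (l k).natTrailingDegree := by
        rintro hmem rfl
        exact (mem_lowerFace.1 hmem).2.1 (Polynomial.trailingCoeff_eq_zero.1 hj)
      split_ifs with hmem <;> simp [hj, hmem, hne]
    · simp only [Finset.mem_filter, Polynomial.mem_support_iff, ne_eq, hj, not_false_eq_true,
        true_and, eq_lineAt_iff hslope h₁ hk hj]
      split_ifs with hmem <;> simp [hmem]
  rw [hfilter]
  split_ifs
  · rw [Finset.sum_singleton, Polynomial.trailingCoeff]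
  · rw [Finset.sum_empty]

theorem pow_mul_aeval_edgePoly (hslope : edgeSlope b l k₁ k₂ = -v)
    (h₁ : IsLeast (lowerFace b r l v : Set ℕ) k₁)
    (h₂ : IsGreatest (lowerFace b r l v : Set ℕ) k₂) (lam : F) :
    lam ^ k₁ * Polynomial.aeval lam (edgePoly b l k₁ k₂)
      = ∑ k ∈ lowerFace b r l v, algebraMap K F (l k).trailingCoeff * lam ^ k := by
  have hface : {k ∈ Finset.Icc k₁ k₂ | k ∈ lowerFace b r l v} = lowerFace b r l v := by
    ext k
    simp only [Finset.mem_filter, Finset.mem_Icc, and_iff_right_iff_imp]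
    exact fun hk => ⟨h₁.2 hk, h₂.2 hk⟩
  rw [edgePoly, map_sum, Finset.mul_sum, ← hface, Finset.sum_filter]
  refine Finset.sum_congr rfl fun k hk => ?_
  obtain ⟨hk₁, hk₂⟩ := Finset.mem_Icc.1 hk
  rw [sum_coeff_on_line hslope h₁.1 (hk₂.trans (mem_lowerFace.1 h₂.1).1), map_mul,
    Polynomial.aeval_C, map_pow, Polynomial.aeval_X, mul_left_comm, ← pow_add,
    Nat.add_sub_cancel' hk₁, apply_ite (algebraMap K F), map_zero, ite_mul, zero_mul]

end Edge

theorem exists_isAdmissible (hb : 2 ≤ b) (hl0 : l 0 ≠ 0) {lam : F} (hlam : lam ≠ 0)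
    {p : Puiseux F} (hp : p ≠ 0) (h : twistedOp b r l lam p = 0) :
    ∃ k₁ k₂, IsAdmissible b r l lam k₁ k₂ ∧ edgeSlope b l k₁ k₂ = -orderP p := by
  set S := lowerFace b r l (orderP p)
  have hS : S.Nonempty := lowerFace_nonempty hl0 _
  have h₁ := S.isLeast_min' hS
  have h₂ := S.isGreatest_max' hS
  have hlt : S.min' hS < S.max' hS := Finset.min'_lt_max'_of_card S
    (Finset.one_lt_card_iff_nontrivial.2 (lowerFace_nontrivial hl0 hlam hp h))
  have hslope := edgeSlope_eq_neg hb hlt h₁.1 h₂.1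
  have hroot := pow_mul_aeval_edgePoly hslope h₁ h₂ lam
  rw [sum_lowerFace_eq_zero hlam hp h] at hroot
  exact ⟨_, _, ⟨isEdge_of_isLeast_of_isGreatest hb hlt h₁ h₂,
    (mul_eq_zero.1 hroot).resolve_left (pow_ne_zero _ hlam)⟩, hslope⟩

end Newton

/-! ### Ramification of solutions -/

section Ramification

variable {F : Type*} [Field F]

/-- The field `F((x^(1/N)))`, as a subfield of the field of Puiseux series. -/
def ramifiedField (F : Type*) [Field F] (N : ℕ+) : Subfield (Puiseux F) where
  carrier := {y | HasRamification N y.1}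
  mul_mem' hy hz := hy.mul hz
  one_mem' := by
    have h := (hasRamification_C (1 : F)).mono N
    rwa [one_mul] at h
  add_mem' hy hz := hy.add hz
  zero_mem' a ha := (ha rfl).elim
  neg_mem' {y} hy a ha := hy a ((HahnSeries.support_neg (x := y.1)) ▸ ha)
  inv_mem' _ hy := hy.inv

theorem mem_ramifiedField {N : ℕ+} {y : Puiseux F} :
    y ∈ ramifiedField F N ↔ HasRamification N y.1 := Iff.rfl

theorem mem_ramifiedField_iff_den_dvd {N : ℕ+} {y : Puiseux F} :
    y ∈ ramifiedField F N ↔ ∀ a, y.1.coeff a ≠ 0 → a.den ∣ N := by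
  refine ⟨fun h a ha => ?_, fun h a ha => ?_⟩
  · obtain ⟨n, rfl⟩ := h a ha
    have hdvd := Rat.den_dvd n N
    rw [Rat.divInt_eq_div] at hdvd
    exact_mod_cast hdvd
  · obtain ⟨e, he⟩ := h a ha
    have he0 : (e : ℚ) ≠ 0 := by
      rintro h0
      rw [Nat.cast_eq_zero.1 h0, mul_zero] at he
      exact N.ne_zero he
    refine ⟨a.num * e, ?_⟩
    rw [he, Int.cast_mul, Nat.cast_mul, Int.cast_natCast, mul_div_mul_right _ _ he0,
      Rat.num_div_den]

theorem algebraMap_mem_ramifiedField (N : ℕ+) (c : F) : algebraMap F _ c ∈ ramifiedField F N := by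
  have h := (hasRamification_C c).mono N
  rwa [one_mul] at h

theorem mahlerP_mul_mem_ramifiedField {d N : ℕ+} {y : Puiseux F} (hy : y ∈ ramifiedField F (d * N))
    (b : ℕ+) : mahlerP F (d * b) y ∈ ramifiedField F N := by
  intro a ha
  rw [HahnSeries.mem_support, coeff_mahlerP] at ha
  obtain ⟨n, hn⟩ := hy _ ha
  refine ⟨b * n, ?_⟩
  rw [div_eq_iff (by exact_mod_cast (d * b).ne_zero)] at hn
  rw [hn]
  push_cast
  field_simp

theorem mahlerP_mem_ramifiedField {N : ℕ+} {y : Puiseux F} (hy : y ∈ ramifiedField F N) (b : ℕ+) :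
    mahlerP F b y ∈ ramifiedField F N := by
  rw [← one_mul N] at hy
  simpa only [one_mul] using mahlerP_mul_mem_ramifiedField hy b

theorem mahlerP_iterate_mem_ramifiedField {N : ℕ+} {y : Puiseux F} (hy : y ∈ ramifiedField F N)
    (b : ℕ+) (k : ℕ) : (mahlerP F b)^[k] y ∈ ramifiedField F N := by
  induction k with
  | zero => exact hy
  | succ k ih => rw [Function.iterate_succ_apply']; exact mahlerP_mem_ramifiedField ih b

/-- The part of a Puiseux series formed by the exponents of denominator `d`. -/
def denPart (F : Type*) [Field F] (d : ℕ) : Puiseux F →ₗ[F] Puiseux F where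
  toFun y := ⟨{ coeff := fun a => if a.den = d then y.1.coeff a else 0
                isPWO_support' := y.1.isPWO_support.mono fun a ha h => ha (by simp [h]) }, by
    obtain ⟨q, hq⟩ := y.2
    exact ⟨q, fun a ha => hq a fun h => ha (by simp [h])⟩⟩
  map_add' y z := by
    refine puiseux_ext fun a => ?_
    change (if a.den = d then y.1.coeff a + z.1.coeff a else 0) = ite _ _ _ + ite _ _ _
    split_ifs <;> simp
  map_smul' c y := by
    refine puiseux_ext fun a => ?_
    rw [RingHom.id_apply, coeff_smul]
    change (if a.den = d then (c • y).1.coeff a else 0) = c * ite _ _ _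
    rw [coeff_smul]
    split_ifs <;> simp

theorem coeff_denPart (d : ℕ) (y : Puiseux F) (a : ℚ) :
    (denPart F d y).1.coeff a = if a.den = d then y.1.coeff a else 0 := rfl

theorem den_orderP_denPart {d : ℕ} {y : Puiseux F} (h : denPart F d y ≠ 0) :
    (orderP (denPart F d y)).den = d := by
  by_contra hne
  refine leadingCoeffP_ne_zero h ?_
  rw [leadingCoeffP, coeff_denPart, if_neg hne]

theorem den_mul_natCast_of_coprime {c : ℚ} {b : ℕ} (hb : b ≠ 0) (h : Nat.Coprime c.den b) :
    (c * b).den = c.den := by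
  apply Nat.dvd_antisymm
  · simpa using Rat.mul_den_dvd c b
  · have hdvd := Rat.mul_den_dvd (c * b) (b : ℚ)⁻¹
    rw [mul_assoc, mul_inv_cancel₀ (Nat.cast_ne_zero.2 hb), mul_one,
      Rat.inv_natCast_den_of_pos (Nat.pos_of_ne_zero hb)] at hdvd
    exact h.dvd_of_dvd_mul_right hdvd

theorem denPart_mahlerP {N : ℕ+} {y : Puiseux F} (hy : y ∈ ramifiedField F N) {b : ℕ+}
    (hN : Nat.Coprime N b) (d : ℕ) :
    denPart F d (mahlerP F b y) = mahlerP F b (denPart F d y) := by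
  refine puiseux_ext fun a => ?_
  rw [coeff_mahlerP, coeff_denPart, coeff_denPart, coeff_mahlerP]
  by_cases h0 : y.1.coeff (a / b) = 0
  · simp [h0]
  · have hcop := hN.coprime_dvd_left (mem_ramifiedField_iff_den_dvd.1 hy _ h0)
    have hden := den_mul_natCast_of_coprime b.ne_zero hcop
    rw [div_mul_cancel₀ a (by exact_mod_cast b.ne_zero)] at hden
    rw [hden]

theorem denPart_mahlerP_iterate {N : ℕ+} {y : Puiseux F} (hy : y ∈ ramifiedField F N) {b : ℕ+}
    (hN : Nat.Coprime N b) (d k : ℕ) :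
    denPart F d ((mahlerP F b)^[k] y) = (mahlerP F b)^[k] (denPart F d y) := by
  induction k with
  | zero => rfl
  | succ k ih =>
    rw [Function.iterate_succ_apply', Function.iterate_succ_apply',
      denPart_mahlerP (mahlerP_iterate_mem_ramifiedField hy b k) hN, ih]

variable {K : Type*} [Field K] [Algebra K F]

theorem polyCoeff_mem_ramifiedField (N : ℕ+) (P : Polynomial K) :
    polyCoeff F P ∈ ramifiedField F N := by
  refine mem_ramifiedField_iff_den_dvd.2 fun a ha => ?_
  obtain ⟨n, rfl⟩ : ∃ n : ℕ, a = n := by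
    by_contra h
    exact ha (coeff_polyCoeff_eq_zero P (not_exists.1 h))
  rw [Rat.den_natCast]
  exact one_dvd _

theorem polyCoeff_add (P Q : Polynomial K) :
    polyCoeff F (P + Q) = polyCoeff F P + polyCoeff F Q := by
  simp only [polyCoeff_eq, Polynomial.map_add, map_add]

theorem polyCoeff_monomial (n : ℕ) (c : K) :
    polyCoeff F (Polynomial.monomial n c) = monomialP (n : ℚ) (algebraMap K F c) := by
  rw [polyCoeff_eq, Polynomial.map_monomial, ← laurentHom_toLaurent,
    ← Polynomial.C_mul_X_pow_eq_monomial, Polynomial.toLaurent_C_mul_X_pow,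
    ← LaurentPolynomial.single_eq_C_mul_T, ← laurentPolyAt_eq, laurentPolyAt_single]
  simp

theorem denPart_polyCoeff_mul (d : ℕ) (P : Polynomial K) (y : Puiseux F) :
    denPart F d (polyCoeff F P * y) = polyCoeff F P * denPart F d y := by
  induction P using Polynomial.induction_on' with
  | add P Q hP hQ => rw [polyCoeff_add, add_mul, map_add, hP, hQ, add_mul]
  | monomial n c =>
    refine puiseux_ext fun a => ?_
    rw [polyCoeff_monomial, coeff_denPart, coeff_monomialP_mul, coeff_monomialP_mul, coeff_denPart,
      Rat.sub_natCast_den, mul_ite, mul_zero]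

variable {b : ℕ+} {r : ℕ} {l : ℕ → Polynomial K}

theorem twistedOp_denPart {N : ℕ+} {y : Puiseux F} (hy : y ∈ ramifiedField F N)
    (hN : Nat.Coprime N b) (lam : F) (d : ℕ) :
    twistedOp b r l lam (denPart F d y) = denPart F d (twistedOp b r l lam y) := by
  rw [twistedOp_apply, twistedOp_apply, map_sum]
  refine Finset.sum_congr rfl fun k _ => ?_
  rw [denPart_polyCoeff_mul, ← map_pow, ← Algebra.smul_def, ← Algebra.smul_def, map_smul,
    denPart_mahlerP_iterate hy hN]

theorem mem_ramifiedField_of_mahlerP_mem (hl0 : l 0 ≠ 0) {lam : F} {p : Puiseux F}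
    (h : twistedOp b r l lam p = 0) {N : ℕ+} (hN : mahlerP F b p ∈ ramifiedField F N) :
    p ∈ ramifiedField F N := by
  have hlead : polyCoeff F (l 0) * p = -∑ k ∈ Finset.range r,
      polyCoeff F (l (k + 1)) * (algebraMap F _ lam ^ (k + 1) * (mahlerP F b)^[k + 1] p) := by
    rw [twistedOp_apply, Finset.sum_range_succ'] at h
    rw [eq_neg_iff_add_eq_zero, ← h, add_comm]
    simp
  rw [← inv_mul_cancel_left₀ (polyCoeff_ne_zero (F := F) hl0) p, hlead]
  refine mul_mem (inv_mem (polyCoeff_mem_ramifiedField N _)) (neg_mem (sum_mem fun k _ => ?_))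
  refine mul_mem (polyCoeff_mem_ramifiedField N _)
    (mul_mem (pow_mem (algebraMap_mem_ramifiedField N _) _) ?_)
  rw [Function.iterate_succ_apply]
  exact mahlerP_iterate_mem_ramifiedField hN b k

/-- Applying `M` removes from the ramification index its common factor with `b`, and the equation
recovers `p` from its images under the powers of `M`. -/
theorem exists_coprime_mem_ramifiedField (hl0 : l 0 ≠ 0) {lam : F} {p : Puiseux F}
    (h : twistedOp b r l lam p = 0) : ∃ N : ℕ+, Nat.Coprime N b ∧ p ∈ ramifiedField F N := by
  obtain ⟨N, hN⟩ := p.2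
  rw [← mem_ramifiedField] at hN
  induction N using PNat.strongInductionOn with
  | _ N ih =>
  by_cases hg : PNat.gcd N b = 1
  · exact ⟨N, PNat.coprime_coe.2 hg, hN⟩
  obtain ⟨N', hN'⟩ : PNat.gcd N b ∣ N := PNat.gcd_dvd_left N b
  obtain ⟨b', hb'⟩ : PNat.gcd N b ∣ b := PNat.gcd_dvd_right N b
  have hlt : N' < N := by
    calc N' = 1 * N' := (one_mul _).symm
      _ < PNat.gcd N b * N' := mul_lt_mul_left (lt_of_le_of_ne one_le (Ne.symm hg)) N'
      _ = N := hN'.symm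
  refine ih N' hlt (mem_ramifiedField_of_mahlerP_mem hl0 h ?_)
  rw [hN'] at hN
  have hM := mahlerP_mul_mem_ramifiedField hN b'
  rwa [← hb'] at hM

theorem exists_isAdmissible_den_eq (hb : 2 ≤ b) (hl0 : l 0 ≠ 0) {lam : F} (hlam : lam ≠ 0)
    {p : Puiseux F} (h : twistedOp b r l lam p = 0) {N : ℕ+} (hNb : Nat.Coprime N b)
    (hN : p ∈ ramifiedField F N) {a : ℚ} (ha : p.1.coeff a ≠ 0) :
    ∃ k₁ k₂, IsAdmissible b r l lam k₁ k₂ ∧ (edgeSlope b l k₁ k₂).den = a.den := by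
  have hne : denPart F a.den p ≠ 0 := by
    intro h0
    have hcoeff := coeff_denPart a.den p a
    rw [h0, if_pos rfl] at hcoeff
    exact ha hcoeff.symm
  have hsol : twistedOp b r l lam (denPart F a.den p) = 0 := by
    rw [twistedOp_denPart hN hNb, h, map_zero]
  obtain ⟨k₁, k₂, hadm, hslope⟩ := exists_isAdmissible hb hl0 hlam hne hsol
  exact ⟨k₁, k₂, hadm, by rw [hslope, Rat.neg_den, den_orderP_denPart hne]⟩

theorem den_edgeSlope_dvd_ramBound {lam : F} {k₁ k₂ : ℕ} (h : IsAdmissible b r l lam k₁ k₂)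
    (hcop : Nat.Coprime (edgeSlope b l k₁ k₂).den b) :
    (edgeSlope b l k₁ k₂).den ∣ ramBound b r l lam := by
  refine Finset.dvd_lcm (f := fun k : ℕ × ℕ => (edgeSlope b l k.1 k.2).den) (b := (k₁, k₂)) ?_
  have hlt := h.1.1
  have hle := h.1.2.1
  simp only [Finset.mem_filter, Finset.mem_product, Finset.mem_range]
  exact ⟨⟨by omega, by omega⟩, h, hcop⟩

theorem mem_ramifiedField_ramBound (hb : 2 ≤ b) (hl0 : l 0 ≠ 0) {lam : F} (hlam : lam ≠ 0)
    {p : Puiseux F} (h : twistedOp b r l lam p = 0) :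
    p ∈ ramifiedField F (ramBound b r l lam) := by
  obtain ⟨N, hNb, hN⟩ := exists_coprime_mem_ramifiedField hl0 h
  refine mem_ramifiedField_iff_den_dvd.2 fun a ha => ?_
  obtain ⟨k₁, k₂, hadm, hden⟩ := exists_isAdmissible_den_eq hb hl0 hlam h hNb hN ha
  rw [← hden]
  refine den_edgeSlope_dvd_ramBound hadm ?_
  rw [hden]
  exact hNb.coprime_dvd_left (mem_ramifiedField_iff_den_dvd.1 hN a ha)

end Ramification

/-! ### Semilinear eigenvectors -/

section Semilinear

open Function in
/-- If `α` is an element of minimal support, then so many coordinates of `T α - d i₀ • α` vanish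
that it must be zero, where `T` is the semilinear map that stabilizes `W`. -/
theorem exists_semilinear_eigenvector {k ι : Type*} [Field k] [Finite ι] (σ : k →+* k) (d : ι → k)
    {W : Submodule k (ι → k)} (hW : W ≠ ⊥)
    (hT : ∀ α ∈ W, (fun i => d i * σ (α i)) ∈ W) :
    ∃ α ∈ W, ∃ i₀, α i₀ = 1 ∧ ∀ i, d i * σ (α i) = d i₀ * α i := by
  obtain ⟨α, ⟨hαW, hα0⟩, hmin⟩ := exists_minimalFor_of_wellFoundedLT
    (fun α : ι → k => α ∈ W ∧ α ≠ 0) (fun α => support α) (W.ne_bot_iff.1 hW)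
  obtain ⟨i₀, hi₀⟩ := Function.ne_iff.1 hα0
  set β : ι → k := (α i₀)⁻¹ • α
  have hβW : β ∈ W := W.smul_mem _ hαW
  have hβ : β i₀ = 1 := inv_mul_cancel₀ hi₀
  set γ : ι → k := (fun i => d i * σ (β i)) - d i₀ • β
  have hγW : γ ∈ W := W.sub_mem (hT β hβW) (W.smul_mem _ hβW)
  have hγ : γ i₀ = 0 := by
    simp only [γ, Pi.sub_apply, Pi.smul_apply, smul_eq_mul, hβ, map_one, sub_self]
  have hsupp : support γ ⊆ support α := by
    intro i hi h0
    exact hi (by simp [γ, β, h0])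
  refine ⟨β, hβW, i₀, hβ, fun i => ?_⟩
  have hγ0 : γ = 0 := by
    by_contra hne
    exact hmin ⟨hγW, hne⟩ hsupp hi₀ hγ
  exact sub_eq_zero.1 (congrFun hγ0 i)

end Semilinear

/-! ### The Casoratian -/

section Casoratian

variable {K : Type*} [Field K] {F : Type*} [Field F] [Algebra K F]
  {b : ℕ+} {r : ℕ} {l : ℕ → Polynomial K} {ι : Type*}

/-- The matrix whose rows are the first `m` iterates under `M` of the `e_(lam i) p i`, up to the
factors `e_(lam i)`. -/
def casoratian (b : ℕ+) (m : ℕ) (lam : ι → Fˣ) (p : ι → Puiseux F) :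
    Matrix ι (Fin m) (Puiseux F) :=
  Matrix.of fun i k => algebraMap F _ (lam i : F) ^ (k : ℕ) * (mahlerP F b)^[k] (p i)

variable [Fintype ι] {lam : ι → Fˣ} {p : ι → Puiseux F}

theorem vecMul_casoratian_eq_zero_iff {m : ℕ} {α : ι → Puiseux F} :
    Matrix.vecMul α (casoratian b m lam p) = 0 ↔
      ∀ k < m, ∑ i, α i * (algebraMap F _ (lam i : F) ^ k * (mahlerP F b)^[k] (p i)) = 0 :=
  ⟨fun h k hk => congrFun h ⟨k, hk⟩, fun h => funext fun k => h k k.2⟩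

theorem exists_vecMul_casoratian_eq_zero {m : ℕ} (h : m < Fintype.card ι) :
    LinearMap.ker (casoratian b m lam p).vecMulLinear ≠ ⊥ :=
  LinearMap.ker_ne_bot_of_finrank_lt (by simpa using h)

/-- Applying `M` to the relation gives the columns of index at least `1`, and `L (e_lam p) = 0`
recovers the column of index `0` from these. -/
theorem vecMul_casoratian_succ (hl0 : l 0 ≠ 0) (hsol : ∀ i, twistedOp b r l (lam i : F) (p i) = 0)
    {α : ι → Puiseux F} (hα : Matrix.vecMul α (casoratian b r lam p) = 0) :
    Matrix.vecMul (fun i => algebraMap F _ (lam i : F)⁻¹ * mahlerP F b (α i))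
      (casoratian b (r + 1) lam p) = 0 := by
  rw [vecMul_casoratian_eq_zero_iff] at hα ⊢
  set β : ι → Puiseux F := fun i => algebraMap F _ (lam i : F)⁻¹ * mahlerP F b (α i)
  have hsucc : ∀ k < r,
      ∑ i, β i * (algebraMap F _ (lam i : F) ^ (k + 1) * (mahlerP F b)^[k + 1] (p i)) = 0 := by
    intro k hk
    rw [← map_zero (mahlerP F b), ← hα k hk, map_sum]
    refine Finset.sum_congr rfl fun i _ => ?_
    have hlam : algebraMap F (Puiseux F) (lam i : F) ≠ 0 := (map_ne_zero _).2 (lam i).ne_zero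
    simp only [β, map_mul, map_pow, map_inv₀, mahlerP_algebraMap, Function.iterate_succ_apply',
      pow_succ]
    field_simp
  have htail : ∑ k ∈ Finset.range r, polyCoeff F (l (k + 1)) *
      ∑ i, β i * (algebraMap F _ (lam i : F) ^ (k + 1) * (mahlerP F b)^[k + 1] (p i)) = 0 :=
    Finset.sum_eq_zero fun k hk => by rw [hsucc k (Finset.mem_range.1 hk), mul_zero]
  have hzero : polyCoeff F (l 0) * ∑ i, β i * p i = 0 := by
    calc polyCoeff F (l 0) * ∑ i, β i * p i
        = ∑ k ∈ Finset.range (r + 1), polyCoeff F (l k) *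
            ∑ i, β i * (algebraMap F _ (lam i : F) ^ k * (mahlerP F b)^[k] (p i)) := by
          rw [Finset.sum_range_succ', htail, zero_add]
          simp only [pow_zero, Function.iterate_zero, id, one_mul]
      _ = ∑ i, β i * twistedOp b r l (lam i : F) (p i) := by
          simp only [twistedOp_apply, Finset.mul_sum, mul_left_comm (β _)]
          exact Finset.sum_comm
      _ = 0 := by simp only [hsol, mul_zero, Finset.sum_const_zero]
  rintro (_ | k) hk
  · simpa only [pow_zero, Function.iterate_zero, id, one_mul] using
      (mul_eq_zero.1 hzero).resolve_left (polyCoeff_ne_zero hl0)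
  · exact hsucc k (Nat.succ_lt_succ_iff.1 hk)

theorem exists_constant_relation (hb : 2 ≤ b) (hl0 : l 0 ≠ 0)
    (hsol : ∀ i, twistedOp b r l (lam i : F) (p i) = 0) (hcard : r < Fintype.card ι) :
    ∃ (e : ι → F) (i₀ : ι), e i₀ ≠ 0 ∧ (∀ i, e i ≠ 0 → lam i = lam i₀) ∧ ∑ i, e i • p i = 0 := by
  obtain ⟨α, hα, i₀, hi₀, heig⟩ := exists_semilinear_eigenvector (mahlerP F b)
    (fun i => algebraMap F _ (lam i : F)⁻¹)
    (exists_vecMul_casoratian_eq_zero (b := b) (p := p) (lam := lam) hcard)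
    fun α hα => vecMul_casoratian_eq_zero_iff.2 fun k hk =>
      vecMul_casoratian_eq_zero_iff.1 (vecMul_casoratian_succ hl0 hsol hα) k (hk.trans_le r.le_succ)
  have hconst : ∀ i, ∃ e : F, α i = algebraMap F _ e ∧ (e ≠ 0 → lam i = lam i₀) := by
    intro i
    by_cases h0 : α i = 0
    · exact ⟨0, by rw [h0, map_zero], fun h => absurd rfl h⟩
    · obtain ⟨heq, e, he⟩ := eq_algebraMap_of_mahlerP_eq_mul hb h0
        (inv_ne_zero (lam i).ne_zero) (heig i)
      exact ⟨e, he, fun _ => Units.ext (inv_injective heq)⟩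
  choose e he hlam using hconst
  refine ⟨e, i₀, fun h => ?_, hlam, ?_⟩
  · rw [he i₀, h, map_zero] at hi₀
    exact zero_ne_one hi₀
  · have hrel := vecMul_casoratian_eq_zero_iff.1 (vecMul_casoratian_succ hl0 hsol hα) 0 r.succ_pos
    simp only [heig, pow_zero, Function.iterate_zero, id, one_mul, mul_assoc,
      ← Finset.mul_sum] at hrel
    simp only [Algebra.smul_def, ← he]
    exact (mul_eq_zero.1 hrel).resolve_left
      ((map_ne_zero _).2 (inv_ne_zero (lam i₀).ne_zero))

theorem card_le_of_linearIndependent (hb : 2 ≤ b) (hl0 : l 0 ≠ 0)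
    (hind : LinearIndependent F fun i => (MonoidAlgebra.single (lam i) (p i) : DRing F))
    (hsol : ∀ i, twistedOp b r l (lam i : F) (p i) = 0) : Fintype.card ι ≤ r := by
  by_contra! hcard
  obtain ⟨e, i₀, he, hlam, hsum⟩ := exists_constant_relation hb hl0 hsol hcard
  refine he (Fintype.linearIndependent_iff.1 hind e ?_ i₀)
  have hterm : ∀ i, e i • (MonoidAlgebra.single (lam i) (p i) : DRing F)
      = MonoidAlgebra.singleAddHom (lam i₀) (e i • p i) := by
    intro i
    by_cases h0 : e i = 0
    · rw [h0, zero_smul, zero_smul, map_zero]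
    · rw [MonoidAlgebra.smul_single, hlam i h0]
      rfl
  rw [Finset.sum_congr rfl fun i _ => hterm i, ← map_sum, hsum, map_zero]

end Casoratian

/-! ### Ramified rational functions -/

section RatFunc

variable {F : Type*} [Field F]

theorem exists_eq_sum_X_pow_mul_expand (N : ℕ+) (P : Polynomial F) :
    ∃ c : ℕ → Polynomial F, P = ∑ i ∈ Finset.range N,
      Polynomial.X ^ i * Polynomial.expand F N (c i) := by
  classical
  induction P using Polynomial.induction_on' with
  | add P Q hP hQ =>
    obtain ⟨c, hc⟩ := hP
    obtain ⟨d, hd⟩ := hQ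
    refine ⟨c + d, ?_⟩
    simp only [Pi.add_apply, map_add, mul_add, Finset.sum_add_distrib, ← hc, ← hd]
  | monomial n a =>
    refine ⟨Pi.single (n % N) (Polynomial.monomial (n / N) a), ?_⟩
    rw [Finset.sum_eq_single (n % N)]
    · rw [Pi.single_eq_same, Polynomial.expand_monomial, Polynomial.X_pow_mul_monomial, mul_comm,
        Nat.div_add_mod]
    · intro i _ hi
      rw [Pi.single_eq_of_ne hi, map_zero, mul_zero]
    · intro h
      exact absurd (Finset.mem_range.2 (Nat.mod_lt n N.pos)) h

theorem ratHom_mem_ramifiedField (q : ℕ+) (f : RatFunc F) : ratHom F 1 q f ∈ ramifiedField F q :=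
  hasRamification_laurent q _

theorem ratHom_X_pow_mul_expand (q N : ℕ+) (i : ℕ) (P : Polynomial F) :
    ratHom F 1 (q * N) (algebraMap _ _ (Polynomial.X ^ i * Polynomial.expand F N P))
      = monomialP (i / (q * N) : ℚ) 1 * ratHom F 1 q (algebraMap _ _ P) := by
  rw [map_mul, map_mul, map_pow, map_pow, RatFunc.algebraMap_X, ratHom_X, monomialP_pow, one_pow,
    ← expandRat_algebraMap, ratHom_expandRat, mul_comm q N, ratHom_mul_mul]
  congr 2
  push_cast
  ring

theorem ratHom_mul_denom (m q : ℕ+) (f : RatFunc F) :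
    ratHom F m q f * ratHom F m q (algebraMap _ _ f.denom)
      = ratHom F m q (algebraMap _ _ f.num) := by
  rw [← map_mul]
  congr 1
  exact ((div_eq_iff (RatFunc.algebraMap_ne_zero f.denom_ne_zero)).1 f.num_div_denom).symm

theorem eq_zero_of_sum_monomialP_mul_eq_zero {q N : ℕ+} {D : ℕ → Puiseux F}
    (hD : ∀ i, D i ∈ ramifiedField F q)
    (h : ∑ i ∈ Finset.range N, monomialP ((i : ℚ) / (q * N)) 1 * D i = 0) {i : ℕ} (hi : i < N) :
    D i = 0 := by
  have hq : (q : ℚ) ≠ 0 := by exact_mod_cast q.ne_zero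
  have hN : (N : ℚ) ≠ 0 := by exact_mod_cast N.ne_zero
  refine puiseux_ext fun a => ?_
  by_contra hne
  obtain ⟨n, rfl⟩ := hD i a hne
  apply hne
  have hcoeff := congrArg (fun y : Puiseux F => y.1.coeff (n / q + (i : ℚ) / (q * N))) h
  simp only [coeff_finset_sum, coeff_monomialP_mul, one_mul] at hcoeff
  rw [Finset.sum_eq_single i] at hcoeff
  · rwa [add_sub_cancel_right] at hcoeff
  · intro j hj hji
    by_contra hne'
    obtain ⟨n', hn'⟩ := hD j _ hne'
    field_simp at hn'
    have hdvd : (N : ℤ) ∣ (i : ℤ) - j := by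
      refine ⟨n' - n, ?_⟩
      have : (n * N + i - j : ℤ) = N * n' := by exact_mod_cast hn'
      linarith
    have hj' := Finset.mem_range.1 hj
    have := Int.eq_zero_of_abs_lt_dvd hdvd (abs_lt.2 (by constructor <;> lia))
    lia
  · intro hnot
    exact absurd (Finset.mem_range.2 hi) hnot

/-- Splitting numerator and denominator of `f` according to the residues of the exponents, one
nonzero component of the denominator and the same component of the numerator have quotient `f`. -/
theorem exists_ratHom_of_mem_ramifiedField {f : Puiseux F} (hf : f ∈ ramRatField F) {q : ℕ+}
    (hq : f ∈ ramifiedField F q) : ∃ g : RatFunc F, f = ratHom F 1 q g := by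
  obtain ⟨N, f₀, hf₀⟩ := hf
  rw [ratAt_eq, ← ratHom_mul_mul q, ← ratHom_expandRat] at hf₀
  set f₁ := expandRat F q f₀
  obtain ⟨A, hA⟩ := exists_eq_sum_X_pow_mul_expand N f₁.num
  obtain ⟨B, hB⟩ := exists_eq_sum_X_pow_mul_expand N f₁.denom
  have hmul := ratHom_mul_denom 1 (q * N) f₁
  rw [← hf₀, hA, hB, map_sum, map_sum, map_sum, map_sum, Finset.mul_sum] at hmul
  simp only [ratHom_X_pow_mul_expand] at hmul
  have hcomp : ∀ i < (N : ℕ),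
      ratHom F 1 q (algebraMap _ _ (A i)) - f * ratHom F 1 q (algebraMap _ _ (B i)) = 0 := by
    refine fun i => eq_zero_of_sum_monomialP_mul_eq_zero
      (D := fun i => ratHom F 1 q (algebraMap _ _ (A i)) - f * ratHom F 1 q (algebraMap _ _ (B i)))
      (fun i => sub_mem (ratHom_mem_ramifiedField q _)
        (mul_mem hq (ratHom_mem_ramifiedField q _))) ?_
    simp only [mul_sub, Finset.sum_sub_distrib, sub_eq_zero, ← hmul]
    exact Finset.sum_congr rfl fun i _ => mul_left_comm ..
  obtain ⟨i, hi, hBi⟩ : ∃ i < (N : ℕ), B i ≠ 0 := by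
    by_contra! hcon
    refine f₁.denom_ne_zero (hB.trans (Finset.sum_eq_zero fun i hi => ?_))
    rw [hcon i (Finset.mem_range.1 hi), map_zero, mul_zero]
  refine ⟨algebraMap _ _ (A i) / algebraMap _ _ (B i), ?_⟩
  rw [map_div₀, eq_div_iff ((map_ne_zero _).2 (RatFunc.algebraMap_ne_zero hBi))]
  exact (sub_eq_zero.1 (hcomp i hi)).symm

theorem natTrailingDegree_denom_eq_zero {f : RatFunc F}
    (h : f.denom.natTrailingDegree = f.num.natTrailingDegree) :
    f.denom.natTrailingDegree = 0 := by
  by_contra hne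
  have X_dvd : ∀ P : Polynomial F, P.natTrailingDegree ≠ 0 → Polynomial.X ∣ P := fun P hP =>
    Polynomial.X_dvd_iff.2
      (Polynomial.coeff_eq_zero_of_lt_natTrailingDegree (Nat.pos_of_ne_zero hP))
  exact Polynomial.not_isUnit_X
    ((RatFunc.isCoprime_num_denom f).isUnit_of_dvd' (X_dvd _ (h ▸ hne)) (X_dvd _ hne))

theorem eval_zero_eq_one {q : ℕ+} {f : RatFunc F} (hf : f ≠ 0)
    (ho : orderP (ratHom F 1 q f) = 0) (hl : leadingCoeffP (ratHom F 1 q f) = 1) :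
    RatFunc.eval (RingHom.id F) 0 f = 1 := by
  have hden := f.denom_ne_zero
  have hnum := RatFunc.num_ne_zero hf
  have hmul := ratHom_mul_denom 1 q f
  have hdeg : f.denom.natTrailingDegree = f.num.natTrailingDegree := by
    have := congrArg orderP hmul
    rw [orderP_mul ((map_ne_zero _).2 hf) ((map_ne_zero _).2 (RatFunc.algebraMap_ne_zero hden)),
      ho, zero_add, orderP_ratHom_polynomial q hden, orderP_ratHom_polynomial q hnum,
      div_left_inj' (by exact_mod_cast q.ne_zero)] at this
    exact_mod_cast this
  have hcoeff : f.denom.trailingCoeff = f.num.trailingCoeff := by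
    have := congrArg leadingCoeffP hmul
    rwa [leadingCoeffP_mul, hl, one_mul, leadingCoeffP_ratHom_polynomial q hden,
      leadingCoeffP_ratHom_polynomial q hnum] at this
  have hd0 : f.denom.trailingCoeff ≠ 0 := Polynomial.trailingCoeff_nonzero_iff_nonzero.2 hden
  have hzero := natTrailingDegree_denom_eq_zero hdeg
  simp only [Polynomial.trailingCoeff, ← hdeg, hzero] at hcoeff hd0
  rw [RatFunc.eval, Polynomial.eval₂_id, Polynomial.eval₂_id,
    ← Polynomial.coeff_zero_eq_eval_zero, ← Polynomial.coeff_zero_eq_eval_zero, ← hcoeff,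
    div_self hd0]

/-! ### The functional equation of the infinite product -/

theorem coeff_zero_infProd {b : ℕ+} {g : RatFunc F}
    (hg : RatFunc.eval (RingHom.id F) 0 g = 1) :
    PowerSeries.coeff 0 (infProd b g) = 1 := by
  simp [infProd, partialProd, constantCoeff_invSeries hg]

theorem partialProd_succ (b : ℕ+) (g : RatFunc F) (N : ℕ) :
    partialProd b g (N + 1)
      = invSeries g * PowerSeries.expand b b.ne_zero (partialProd b g N) := by
  rw [partialProd, Finset.prod_range_succ', mul_comm, partialProd, map_prod]
  congr 1
  · simp
  · refine Finset.prod_congr rfl fun k _ => ?_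
    ext n
    simp only [PowerSeries.coeff_expand, PNat.pow_coe, pow_succ']
    have hb := b.pos
    by_cases h : (b : ℕ) ∣ n
    · obtain ⟨m, rfl⟩ := h
      simp [Nat.mul_div_mul_left, Nat.mul_dvd_mul_iff_left, hb]
    · rw [if_neg h, if_neg (fun h' => h (dvd_trans ⟨(b : ℕ) ^ k, by simp⟩ h'))]

theorem infProd_eq {b : ℕ+} (hb : 2 ≤ b) {g : RatFunc F}
    (hg : RatFunc.eval (RingHom.id F) 0 g = 1) :
    infProd b g = invSeries g * PowerSeries.expand b b.ne_zero (infProd b g) := by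
  ext n
  rw [← coeff_partialProd hb hg (show n < n + 1 + 1 by lia), partialProd_succ,
    PowerSeries.coeff_mul, PowerSeries.coeff_mul]
  refine Finset.sum_congr rfl fun x hx => ?_
  congr 1
  rw [PowerSeries.coeff_expand, PowerSeries.coeff_expand]
  split_ifs with h
  · apply coeff_partialProd hb hg
    have hsum := Finset.HasAntidiagonal.mem_antidiagonal.1 hx
    have hdiv := Nat.div_le_self x.2 b
    lia
  · rfl

theorem mahlerP_powerSeriesAt (b q : ℕ+) (s : PowerSeries F) :
    mahlerP F b (powerSeriesAt 1 q s) = powerSeriesAt 1 q (PowerSeries.expand b b.ne_zero s) := by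
  have hb : (b : ℚ) ≠ 0 := by exact_mod_cast b.ne_zero
  have hq : (q : ℚ) ≠ 0 := by exact_mod_cast q.ne_zero
  refine puiseux_ext fun a => ?_
  rw [coeff_mahlerP]
  by_cases h : ∃ n : ℕ, a / b = (n : ℚ) / q
  · obtain ⟨n, hn⟩ := h
    have ha : a = ((b * n : ℕ) : ℚ) / q := by
      rw [div_eq_iff hb] at hn
      rw [hn]
      push_cast
      ring
    rw [hn, coeff_powerSeriesAt, ha, coeff_powerSeriesAt, PowerSeries.coeff_expand,
      if_pos (Dvd.intro _ rfl), Nat.mul_div_cancel_left _ b.pos]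
  · push Not at h
    rw [coeff_powerSeriesAt_eq_zero q s h]
    by_cases h' : ∃ n : ℕ, a = (n : ℚ) / q
    · obtain ⟨n, rfl⟩ := h'
      rw [coeff_powerSeriesAt, PowerSeries.coeff_expand, if_neg]
      rintro ⟨m, rfl⟩
      apply h m
      push_cast
      field_simp
    · push Not at h'
      rw [coeff_powerSeriesAt_eq_zero q _ h']

theorem powerSeriesAt_mul (m q : ℕ+) (s t : PowerSeries F) :
    powerSeriesAt m q (s * t) = powerSeriesAt m q s * powerSeriesAt m q t := by
  simp only [powerSeriesAt, map_mul]

theorem constantCoeff_num_ne_zero {g : RatFunc F} (hg : RatFunc.eval (RingHom.id F) 0 g = 1) :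
    PowerSeries.constantCoeff (g.num : PowerSeries F) ≠ 0 := by
  intro h
  have := constantCoeff_invSeries hg
  rw [invSeries, map_mul, PowerSeries.constantCoeff_inv, h, inv_zero, mul_zero] at this
  exact zero_ne_one this

theorem ratHom_mul_invSeries (q : ℕ+) {g : RatFunc F}
    (hg : RatFunc.eval (RingHom.id F) 0 g = 1) :
    ratHom F 1 q g * powerSeriesAt 1 q (invSeries g) = 1 := by
  rw [invSeries, powerSeriesAt_mul, ← ratHom_polynomial_eq_powerSeriesAt, ← mul_assoc,
    ratHom_mul_denom, ratHom_polynomial_eq_powerSeriesAt, ← powerSeriesAt_mul,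
    PowerSeries.mul_inv_cancel _ (constantCoeff_num_ne_zero hg)]
  simp [powerSeriesAt]

theorem mahlerP_infProd {b : ℕ+} (hb : 2 ≤ b) (q : ℕ+) {g : RatFunc F}
    (hg : RatFunc.eval (RingHom.id F) 0 g = 1) :
    mahlerP F b (powerSeriesAt 1 q (infProd b g))
      = ratHom F 1 q g * powerSeriesAt 1 q (infProd b g) := by
  conv_rhs => rw [infProd_eq hb hg]
  rw [powerSeriesAt_mul, ← mul_assoc, ratHom_mul_invSeries q hg, one_mul, mahlerP_powerSeriesAt]

theorem coeff_zero_powerSeriesAt (q : ℕ+) (s : PowerSeries F) :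
    (powerSeriesAt 1 q s).1.coeff 0 = PowerSeries.coeff 0 s := by
  simpa only [Nat.cast_zero, zero_div] using coeff_powerSeriesAt q s 0

theorem orderP_infProd {b : ℕ+} (q : ℕ+) {g : RatFunc F}
    (hg : RatFunc.eval (RingHom.id F) 0 g = 1) :
    orderP (powerSeriesAt 1 q (infProd b g)) = 0 := by
  apply orderP_eq
  · rw [coeff_zero_powerSeriesAt, coeff_zero_infProd hg]
    exact one_ne_zero
  · intro e he
    apply coeff_powerSeriesAt_eq_zero
    rintro n rfl
    exact absurd he (not_lt.2 (by positivity))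

theorem leadingCoeffP_infProd {b : ℕ+} (q : ℕ+) {g : RatFunc F}
    (hg : RatFunc.eval (RingHom.id F) 0 g = 1) :
    leadingCoeffP (powerSeriesAt 1 q (infProd b g)) = 1 := by
  rw [leadingCoeffP, orderP_infProd q hg, coeff_zero_powerSeriesAt, coeff_zero_infProd hg]

theorem infProd_ne_zero {b : ℕ+} (q : ℕ+) {g : RatFunc F}
    (hg : RatFunc.eval (RingHom.id F) 0 g = 1) : powerSeriesAt 1 q (infProd b g) ≠ 0 := by
  intro h
  have := leadingCoeffP_infProd (b := b) q hg
  rw [h] at this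
  exact zero_ne_one this

theorem powerSeriesAt_mem_ramifiedField (q : ℕ+) (s : PowerSeries F) :
    powerSeriesAt 1 q s ∈ ramifiedField F q := hasRamification_laurent q _

theorem eq_infProd {b : ℕ+} (hb : 2 ≤ b) {q : ℕ+} {g : RatFunc F}
    (hg : RatFunc.eval (RingHom.id F) 0 g = 1) {w : Puiseux F} (hl : leadingCoeffP w = 1)
    (hw : mahlerP F b w = ratHom F 1 q g * w) : w = powerSeriesAt 1 q (infProd b g) := by
  have hg0 : g ≠ 0 := by
    rintro rfl
    simp at hg
  have hfixed : mahlerP F b (w / powerSeriesAt 1 q (infProd b g))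
      = w / powerSeriesAt 1 q (infProd b g) := by
    rw [map_div₀, hw, mahlerP_infProd hb q hg, mul_div_mul_left _ _ ((map_ne_zero _).2 hg0)]
  obtain ⟨c, hc⟩ := eq_algebraMap_of_mahlerP_eq hb hfixed
  rw [div_eq_iff (infProd_ne_zero q hg)] at hc
  have hc1 := congrArg leadingCoeffP hc
  rw [leadingCoeffP_mul, hl, leadingCoeffP_algebraMap, leadingCoeffP_infProd q hg, mul_one] at hc1
  rw [hc, ← hc1, map_one, one_mul]

/-! ### First-order equations -/

theorem orderP_monomialP {a : ℚ} {c : F} (hc : c ≠ 0) : orderP (monomialP a c) = a :=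
  HahnSeries.order_single hc

theorem leadingCoeffP_monomialP {a : ℚ} {c : F} (hc : c ≠ 0) :
    leadingCoeffP (monomialP a c) = c := by
  rw [leadingCoeffP, orderP_monomialP hc, coeff_monomialP, if_pos rfl]

theorem monomialP_zpow (a : ℚ) (n : ℤ) : monomialP a (1 : F) ^ n = monomialP (n * a) 1 := by
  rcases n with n | n
  · simpa using monomialP_pow a (1 : F) n
  · rw [zpow_negSucc, monomialP_pow, one_pow]
    refine inv_eq_of_mul_eq_one_right ?_
    rw [monomialP_mul, Int.cast_negSucc, neg_mul, add_neg_cancel, mul_one]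
    rfl

theorem ratHom_C_mul_X_zpow (q : ℕ+) (c : F) (n : ℤ) :
    ratHom F 1 q (RatFunc.C c * RatFunc.X ^ n) = monomialP (n / q : ℚ) c := by
  rw [map_mul, map_zpow₀, ratHom_C, ratHom_X, monomialP_zpow, algebraMap_eq_monomialP,
    monomialP_mul, mul_one, zero_add]
  congr 1
  simp only [PNat.val_ofNat, Nat.cast_one]
  ring

theorem exists_ratHom_eq_monomialP_mul {q : ℕ+} {f : RatFunc F} (hf : f ≠ 0) :
    ∃ (a : ℚ) (c : Fˣ) (g : RatFunc F), RatFunc.eval (RingHom.id F) 0 g = 1 ∧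
      ratHom F 1 q f = monomialP a (c : F) * ratHom F 1 q g := by
  have hf' : ratHom F 1 q f ≠ 0 := (map_ne_zero _).2 hf
  set c := leadingCoeffP (ratHom F 1 q f) with hc
  have hc0 : c ≠ 0 := leadingCoeffP_ne_zero hf'
  obtain ⟨n, hn⟩ := ratHom_mem_ramifiedField q f _ hc0
  have hm0 : RatFunc.C c * RatFunc.X ^ n ≠ 0 :=
    mul_ne_zero ((map_ne_zero _).2 hc0) (zpow_ne_zero _ RatFunc.X_ne_zero)
  set g := f / (RatFunc.C c * RatFunc.X ^ n)
  have hg0 : g ≠ 0 := div_ne_zero hf hm0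
  have heq : ratHom F 1 q f = monomialP (n / q : ℚ) c * ratHom F 1 q g := by
    rw [← ratHom_C_mul_X_zpow, ← map_mul, mul_div_cancel₀ _ hm0]
  refine ⟨n / q, Units.mk0 c hc0, g, eval_zero_eq_one hg0 (q := q) ?_ ?_, heq⟩
  · have := congrArg orderP heq
    rw [orderP_mul (monomialP_ne_zero hc0) ((map_ne_zero _).2 hg0), orderP_monomialP hc0,
      hn] at this
    exact left_eq_add.1 this
  · have := congrArg leadingCoeffP heq
    rw [leadingCoeffP_mul, leadingCoeffP_monomialP hc0, ← hc] at this
    exact (left_eq_mul₀ hc0).1 this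

theorem exists_mahlerP_eq_mul {b : ℕ+} (hb : 2 ≤ b) {u : Puiseux F} (hu : u ∈ ramRatField F)
    (hu0 : u ≠ 0) :
    ∃ (lam : Fˣ) (p : Puiseux F), p ≠ 0 ∧ algebraMap F _ (lam : F) * mahlerP F b p = u * p := by
  obtain ⟨q, f, rfl⟩ := hu
  rw [ratAt_eq] at hu0 ⊢
  obtain ⟨a, c, g, hg, hf⟩ := exists_ratHom_eq_monomialP_mul (q := q) ((map_ne_zero _).1 hu0)
  have hb' : (b : ℚ) - 1 ≠ 0 := by
    have : (2 : ℚ) ≤ b := by exact_mod_cast hb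
    linarith
  have hmonomial : algebraMap F _ (c : F) * mahlerP F b (monomialP (a / (b - 1)) 1)
      = monomialP a (c : F) * monomialP (a / (b - 1)) 1 := by
    rw [mahlerP, subst_monomialP, algebraMap_eq_monomialP, monomialP_mul, monomialP_mul]
    congr 1
    simp only [PNat.val_ofNat, Nat.cast_one, div_one]
    field_simp
    ring
  refine ⟨c, monomialP (a / (b - 1)) 1 * powerSeriesAt 1 q (infProd b g),
    mul_ne_zero (monomialP_ne_zero one_ne_zero) (infProd_ne_zero q hg), ?_⟩
  rw [map_mul, mahlerP_infProd hb q hg, ← mul_assoc, hmonomial, hf]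
  ring

end RatFunc

/-! ### Extension of the field of constants -/

section Extension

variable {F G : Type*} [Field F] [Field G] [Algebra F G]

/-- The inclusion of Puiseux series over `F` in those over an extension `G` of `F`. -/
def mapP (F G : Type*) [Field F] [Field G] [Algebra F G] : Puiseux F →+ Puiseux G where
  toFun y := ⟨y.1.map (algebraMap F G), by
    obtain ⟨q, hq⟩ := y.2
    refine ⟨q, fun a ha => hq a fun h => ha ?_⟩
    change algebraMap F G (y.1.coeff a) = 0
    rw [h, map_zero]⟩
  map_zero' := puiseux_ext fun _ => map_zero (algebraMap F G)
  map_add' y z := puiseux_ext fun a => map_add (algebraMap F G) (y.1.coeff a) (z.1.coeff a)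

theorem coeff_mapP (y : Puiseux F) (a : ℚ) :
    (mapP F G y).1.coeff a = algebraMap F G (y.1.coeff a) := rfl

theorem mapP_mahlerP (b : ℕ+) (y : Puiseux F) :
    mapP F G (mahlerP F b y) = mahlerP G b (mapP F G y) :=
  puiseux_ext fun a => by rw [coeff_mapP, coeff_mahlerP, coeff_mahlerP, coeff_mapP]

theorem mapP_mahlerP_iterate (b : ℕ+) (k : ℕ) (y : Puiseux F) :
    mapP F G ((mahlerP F b)^[k] y) = (mahlerP G b)^[k] (mapP F G y) :=
  (show Function.Semiconj (mapP F G) _ _ from mapP_mahlerP b).iterate_right k y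

theorem mapP_monomialP_mul (a : ℚ) (c : F) (y : Puiseux F) :
    mapP F G (monomialP a c * y) = monomialP a (algebraMap F G c) * mapP F G y :=
  puiseux_ext fun e => by
    rw [coeff_mapP, coeff_monomialP_mul, map_mul, coeff_monomialP_mul, coeff_mapP]

variable {K : Type*} [Field K] [Algebra K F] [Algebra K G] [IsScalarTower K F G]

theorem mapP_polyCoeff_mul (P : Polynomial K) (y : Puiseux F) :
    mapP F G (polyCoeff F P * y) = polyCoeff G P * mapP F G y := by
  induction P using Polynomial.induction_on' with
  | add P Q hP hQ => rw [polyCoeff_add, polyCoeff_add, add_mul, add_mul, map_add, hP, hQ]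
  | monomial n c =>
    rw [polyCoeff_monomial, polyCoeff_monomial, mapP_monomialP_mul,
      ← IsScalarTower.algebraMap_apply K F G]

theorem mapP_twistedOp (b : ℕ+) (r : ℕ) (l : ℕ → Polynomial K) (lam : F) (p : Puiseux F) :
    mapP F G (twistedOp b r l lam p) = twistedOp b r l (algebraMap F G lam) (mapP F G p) := by
  rw [twistedOp_apply, twistedOp_apply, map_sum]
  refine Finset.sum_congr rfl fun k _ => ?_
  rw [mapP_polyCoeff_mul, ← map_pow, ← map_pow, algebraMap_eq_monomialP, mapP_monomialP_mul,
    mapP_mahlerP_iterate, map_pow, algebraMap_eq_monomialP]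

theorem mapP_ne_zero {y : Puiseux F} (hy : y ≠ 0) : mapP F G y ≠ 0 := by
  refine mt (fun h => puiseux_ext fun a => (map_eq_zero (algebraMap F G)).1 ?_) hy
  rw [← coeff_mapP y a, h]
  rfl

theorem algebraMap_mem_Lam' {b : ℕ+} (hb : 2 ≤ b) {r : ℕ} {l : ℕ → Polynomial K} (hl0 : l 0 ≠ 0)
    (lam : Fˣ) {p : Puiseux F} (hp : p ≠ 0) (h : twistedOp b r l (lam : F) p = 0) :
    algebraMap F G (lam : F) ∈ Lam' b r l G := by
  have hlam : algebraMap F G (lam : F) ≠ 0 := by simp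
  have hsol : twistedOp b r l (algebraMap F G (lam : F)) (mapP F G p) = 0 := by
    rw [← mapP_twistedOp, h, map_zero]
  obtain ⟨k₁, k₂, hadm, -⟩ := exists_isAdmissible hb hl0 hlam (mapP_ne_zero hp) hsol
  refine ⟨⟨k₁, k₂, hadm⟩, Units.mk0 _ hlam, rfl, mapP F G p, mapP_ne_zero hp, ?_⟩
  rw [applyL_single_eq_zero_iff]
  exact hsol

end Extension

/-! ### Reduced echelon form -/

section Echelon

variable {F : Type*} [Field F]

/-- The nonzero Laurent polynomial `f` has order `n`. -/
def HasOrder (f : LaurentPolynomial F) (n : ℤ) : Prop :=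
  f.coeff n ≠ 0 ∧ ∀ m < n, f.coeff m = 0

theorem exists_hasOrder {f : LaurentPolynomial F} (hf : f ≠ 0) : ∃ n, HasOrder f n := by
  have hne : f.coeff.support.Nonempty :=
    Finsupp.support_nonempty_iff.2 fun h => hf (AddMonoidAlgebra.coeff_eq_zero.1 h)
  refine ⟨f.coeff.support.min' hne, Finsupp.mem_support_iff.1 (Finset.min'_mem _ hne), ?_⟩
  intro m hm
  by_contra h
  exact absurd (Finset.min'_le _ m (Finsupp.mem_support_iff.2 h)) (not_le.2 hm)

/-- The coefficient of `x^n` as a linear form on Laurent polynomials. -/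
def coeffForm (F : Type*) [Field F] (n : ℤ) : LaurentPolynomial F →ₗ[F] F where
  toFun f := f.coeff n
  map_add' f g := by simp
  map_smul' c f := by simp

theorem coeff_sum_smul {ι : Type*} (s : Finset ι) (c : ι → F) (f : ι → LaurentPolynomial F)
    (n : ℤ) : (∑ i ∈ s, c i • f i).coeff n = ∑ i ∈ s, c i * (f i).coeff n := by
  change coeffForm F n (∑ i ∈ s, c i • f i) = _
  simp only [map_sum, map_smul, smul_eq_mul]
  rfl

theorem linearIndependent_of_hasOrder {ι : Type*} [Finite ι] {f : ι → LaurentPolynomial F}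
    {n : ι → ℤ} (hn : Function.Injective n) (hf : ∀ i, HasOrder (f i) (n i)) :
    LinearIndependent F f := by
  have := Fintype.ofFinite ι
  rw [Fintype.linearIndependent_iff]
  intro c hc
  by_contra! hne
  obtain ⟨i₀, hci₀, hmin⟩ := Set.exists_min_image {i | c i ≠ 0} n (Set.toFinite _) hne
  have hcoeff := congrArg (coeffForm F (n i₀)) hc
  rw [map_zero] at hcoeff
  change (∑ i, c i • f i).coeff (n i₀) = 0 at hcoeff
  rw [coeff_sum_smul, Finset.sum_eq_single_of_mem i₀ (Finset.mem_univ _)] at hcoeff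
  · exact mul_ne_zero hci₀ (hf i₀).1 hcoeff
  · intro j _ hj
    by_cases hcj : c j = 0
    · rw [hcj, zero_mul]
    · rw [(hf j).2 _ ((hmin j hcj).lt_of_ne fun h => hj (hn h.symm)), mul_zero]

section Orders

variable (V : Submodule F (LaurentPolynomial F))

/-- The set of the orders of the nonzero elements of `V`: the pivots of its reduced echelon
basis. -/
def orders : Set ℤ := {n | ∃ f ∈ V, HasOrder f n}

variable {V}

theorem eq_zero_of_coeff_orders {f : LaurentPolynomial F} (hf : f ∈ V)
    (h : ∀ n ∈ orders V, f.coeff n = 0) : f = 0 := by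
  by_contra hne
  obtain ⟨n, hn⟩ := exists_hasOrder hne
  exact hn.1 (h n ⟨f, hf, hn⟩)

theorem card_le_finrank_of_subset_orders [FiniteDimensional F V] {T : Finset ℤ}
    (hT : (T : Set ℤ) ⊆ orders V) : T.card ≤ Module.finrank F V := by
  choose f hfV hf using fun n : T => hT n.2
  have hind : LinearIndependent F (fun n : T => (⟨f n, hfV n⟩ : V)) :=
    .of_comp V.subtype (linearIndependent_of_hasOrder Subtype.val_injective hf)
  simpa using hind.fintype_card_le_finrank

theorem finite_orders [FiniteDimensional F V] : (orders V).Finite := by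
  by_contra hinf
  obtain ⟨T, hTV, hT⟩ := Set.Infinite.exists_subset_card_eq hinf (Module.finrank F V + 1)
  have := card_le_finrank_of_subset_orders hTV
  omega

theorem exists_mem_coeff_eq [FiniteDimensional F V] (c : orders V → F) :
    ∃ f ∈ V, ∀ n : orders V, f.coeff n = c n := by
  have := finite_orders (V := V)
  have := this.fintype
  let coeffs : V →ₗ[F] (orders V → F) :=
    LinearMap.pi fun n => (coeffForm F (n : ℤ)).comp V.subtype
  have hinj : Function.Injective coeffs := by
    rw [← LinearMap.ker_eq_bot, LinearMap.ker_eq_bot']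
    exact fun f hf => Subtype.ext
      (eq_zero_of_coeff_orders f.2 fun n hn => congrFun hf ⟨n, hn⟩)
  have hdim : Module.finrank F V = Module.finrank F (orders V → F) := by
    refine (LinearMap.finrank_le_finrank_of_injective hinj).antisymm ?_
    rw [Module.finrank_fintype_fun_eq_card, ← Set.toFinset_card]
    exact card_le_finrank_of_subset_orders (Set.coe_toFinset _).subset
  obtain ⟨f, hf⟩ := (LinearMap.injective_iff_surjective_of_finrank_eq_finrank hdim).1 hinj c
  exact ⟨f, f.2, congrFun hf⟩

end Orders

/-- The family `p` is reduced with pivots at the degrees `v i`, so that `IsReducedEchelon p` means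
that `p` has strictly increasing pivots. -/
def HasPivots {ι : Type*} (p : ι → LaurentPolynomial F) (v : ι → ℤ) : Prop :=
  ∀ i, (∀ n < v i, (p i).coeff n = 0) ∧ (p i).coeff (v i) = 1 ∧ ∀ j ≠ i, (p j).coeff (v i) = 0

theorem HasPivots.hasOrder {ι : Type*} {p : ι → LaurentPolynomial F} {v : ι → ℤ}
    (hp : HasPivots p v) (i : ι) : HasOrder (p i) (v i) :=
  ⟨(hp i).2.1 ▸ one_ne_zero, (hp i).1⟩

theorem HasPivots.eq_sum {ι : Type*} [Fintype ι] {p : ι → LaurentPolynomial F} {v : ι → ℤ}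
    (hp : HasPivots p v) {f : LaurentPolynomial F} (hf : f ∈ Submodule.span F (Set.range p)) :
    f = ∑ i, f.coeff (v i) • p i := by
  obtain ⟨c, rfl⟩ := (Submodule.mem_span_range_iff_exists_fun F).1 hf
  refine Finset.sum_congr rfl fun i _ => ?_
  rw [coeff_sum_smul, Finset.sum_eq_single_of_mem i (Finset.mem_univ _), (hp i).2.1, mul_one]
  intro j _ hj
  rw [(hp i).2.2 j hj, mul_zero]

theorem HasPivots.range_eq {ι : Type*} [Finite ι] {p : ι → LaurentPolynomial F} {v : ι → ℤ}
    (hp : HasPivots p v) : Set.range v = orders (Submodule.span F (Set.range p)) := by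
  have := Fintype.ofFinite ι
  ext n
  constructor
  · rintro ⟨i, rfl⟩
    exact ⟨p i, Submodule.subset_span ⟨i, rfl⟩, hp.hasOrder i⟩
  · rintro ⟨f, hf, hn⟩
    by_contra hnot
    apply hn.1
    rw [hp.eq_sum hf, coeff_sum_smul]
    refine Finset.sum_eq_zero fun i _ => ?_
    rcases le_or_gt (v i) n with h | h
    · rw [hn.2 _ (h.lt_of_ne fun heq => hnot ⟨i, heq⟩), zero_mul]
    · rw [(hp i).1 n h, mul_zero]

theorem exists_isReducedEchelon (V : Submodule F (LaurentPolynomial F)) [FiniteDimensional F V] :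
    ∃ (s : ℕ) (p : Fin s → LaurentPolynomial F),
      IsReducedEchelon p ∧ Submodule.span F (Set.range p) = V := by
  classical
  have hfin := finite_orders (V := V)
  let v := hfin.toFinset.orderEmbOfFin rfl
  have hv (i) : v i ∈ orders V := hfin.mem_toFinset.1 (Finset.orderEmbOfFin_mem _ _ i)
  choose p hpV hp using fun i => exists_mem_coeff_eq (V := V) (Pi.single ⟨v i, hv i⟩ 1)
  have hcoeff (i n) (hn : n ∈ orders V) : (p i).coeff n = if n = v i then 1 else 0 := by
    rw [hp i ⟨n, hn⟩, Pi.single_apply]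
    simp only [Subtype.mk.injEq]
  have hpivots : HasPivots p v := by
    refine fun i => ⟨?_, by rw [hcoeff i _ (hv i), if_pos rfl], fun j hj => ?_⟩
    · obtain ⟨n, hn⟩ : ∃ n, HasOrder (p i) n := by
        refine exists_hasOrder fun h => one_ne_zero (α := F) ?_
        rw [← if_pos (rfl : v i = v i) (t := (1 : F)) (e := 0), ← hcoeff i _ (hv i), h]
        rfl
      have hni : n = v i := by
        by_contra h
        exact hn.1 (by rw [hcoeff i n ⟨p i, hpV i, hn⟩, if_neg h])
      exact hni ▸ hn.2
    · rw [hcoeff j _ (hv i), if_neg fun h => hj (v.injective h).symm]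
  have hle : Submodule.span F (Set.range p) ≤ V :=
    Submodule.span_le.2 (Set.range_subset_iff.2 hpV)
  refine ⟨_, p, ⟨v, v.strictMono, hpivots⟩, hle.antisymm fun f hf => ?_⟩
  have hsum : ∑ i, f.coeff (v i) • p i ∈ Submodule.span F (Set.range p) :=
    Submodule.sum_mem _ fun i _ => Submodule.smul_mem _ _ (Submodule.subset_span ⟨i, rfl⟩)
  suffices h : f - ∑ i, f.coeff (v i) • p i = 0 from sub_eq_zero.1 h ▸ hsum
  refine eq_zero_of_coeff_orders (V.sub_mem hf (hle hsum)) fun n hn => ?_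
  obtain ⟨i, rfl⟩ : n ∈ Set.range v := by simpa [v] using hn
  rw [AddMonoidAlgebra.coeff_sub, Finsupp.sub_apply, coeff_sum_smul,
    Finset.sum_eq_single_of_mem i (Finset.mem_univ _), (hpivots i).2.1, mul_one, sub_self]
  intro j _ hj
  rw [(hpivots i).2.2 j hj, mul_zero]

theorem IsReducedEchelon.linearIndependent {s : ℕ} {p : Fin s → LaurentPolynomial F}
    (h : IsReducedEchelon p) : LinearIndependent F p := by
  obtain ⟨v, hv, hp⟩ := h
  exact linearIndependent_of_hasOrder hv.injective (HasPivots.hasOrder hp)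

theorem IsReducedEchelon.unique {s s' : ℕ} {p : Fin s → LaurentPolynomial F}
    {p' : Fin s' → LaurentPolynomial F} (h : IsReducedEchelon p) (h' : IsReducedEchelon p')
    (hspan : Submodule.span F (Set.range p) = Submodule.span F (Set.range p')) :
    s = s' ∧ HEq p p' := by
  obtain ⟨v, hv, hp⟩ := h
  obtain ⟨v', hv', hp'⟩ := h'
  have hrange : Set.range v = Set.range v' := by
    rw [HasPivots.range_eq hp, HasPivots.range_eq hp', hspan]
  obtain rfl : s = s' := by
    simpa [Set.ncard_range_of_injective, hv.injective, hv'.injective] using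
      congrArg Set.ncard hrange
  obtain rfl := (StrictMono.range_inj hv hv').1 hrange
  refine ⟨rfl, heq_of_eq (funext fun i => ?_)⟩
  rw [HasPivots.eq_sum hp (hspan ▸ Submodule.subset_span ⟨i, rfl⟩ : p' i ∈ _),
    Finset.sum_eq_single_of_mem i (Finset.mem_univ _), (hp' i).2.1, one_smul]
  intro j _ hj
  rw [(hp' j).2.2 i hj.symm, zero_smul]

end Echelon

/-! ### Coprime families -/

section Coprime

theorem exists_eq_mul_of_bezout {R ι : Type*} [CommRing R] [IsDomain R] [IsBezout R] [Fintype ι]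
    {N : ι → R} (hN : N ≠ 0) :
    ∃ (d : R) (m a : ι → R), (∀ i, N i = d * m i) ∧ ∑ i, a i * m i = 1 := by
  obtain ⟨d, hd⟩ := IsBezout.isPrincipal_of_FG _ (Submodule.fg_span (Set.finite_range N))
  replace hd : Ideal.span (Set.range N) = Ideal.span {d} := hd
  have hdvd (i) : d ∣ N i := by
    rw [← Ideal.mem_span_singleton, ← hd]
    exact Ideal.subset_span ⟨i, rfl⟩
  choose m hm using hdvd
  have hd0 : d ≠ 0 := by
    rintro rfl
    exact hN (funext fun i => by rw [hm, zero_mul, Pi.zero_apply])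
  obtain ⟨a, ha⟩ := Ideal.mem_span_range_iff_exists_fun.1
    (hd ▸ Ideal.mem_span_singleton_self d : d ∈ Ideal.span (Set.range N))
  refine ⟨d, m, a, hm, mul_left_cancel₀ hd0 ?_⟩
  rw [mul_one, Finset.mul_sum]
  conv_rhs => rw [← ha]
  exact Finset.sum_congr rfl fun i _ => by rw [hm]; ring

theorem exists_eq_mul_algebraMap_of_bezout (R : Type*) {L ι : Type*} [CommRing R] [IsDomain R]
    [IsBezout R] [Field L] [Algebra R L] [IsFractionRing R L] [Fintype ι] {f : ι → L}
    (hf : f ≠ 0) :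
    ∃ (c : L) (m a : ι → R), (∀ i, f i = c * algebraMap R L (m i)) ∧ ∑ i, a i * m i = 1 := by
  obtain ⟨⟨d, hd⟩, hint⟩ := IsLocalization.exist_integer_multiples_of_finite (nonZeroDivisors R) f
  choose N hN using hint
  replace hN (i) : algebraMap R L (N i) = algebraMap R L d * f i :=
    (hN i).trans (Algebra.smul_def d (f i))
  have hd0 : algebraMap R L d ≠ 0 :=
    IsFractionRing.to_map_ne_zero_of_mem_nonZeroDivisors hd
  have hN0 : N ≠ 0 := by
    rintro rfl
    refine hf (funext fun i => (mul_eq_zero_iff_left hd0).1 ?_)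
    rw [← hN, Pi.zero_apply, map_zero]
  obtain ⟨γ, m, a, hm, ha⟩ := exists_eq_mul_of_bezout hN0
  refine ⟨algebraMap R L γ / algebraMap R L d, m, a, fun i => ?_, ha⟩
  rw [div_mul_eq_mul_div, eq_div_iff hd0, ← map_mul, ← hm, hN, mul_comm]

variable {F : Type*} [Field F]

theorem exists_eq_single_of_isUnit {m : LaurentPolynomial F} (hm : IsUnit m) :
    ∃ (n : ℤ) (c : F), m = AddMonoidAlgebra.single n c := by
  obtain ⟨m', hm'⟩ := hm.exists_right_inv
  obtain ⟨k, P, hP⟩ := m.exists_T_pow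
  obtain ⟨k', P', hP'⟩ := m'.exists_T_pow
  have hmul : P * P' = Polynomial.X ^ (k + k') := by
    apply Polynomial.toLaurent_injective
    rw [map_mul, hP, hP', Polynomial.toLaurent_X_pow, mul_mul_mul_comm, hm', one_mul,
      ← LaurentPolynomial.T_add, Nat.cast_add]
  obtain ⟨j, -, hj⟩ := (dvd_prime_pow Polynomial.prime_X _).1 (Dvd.intro _ hmul)
  obtain ⟨u, hu⟩ := hj.symm
  obtain ⟨c, -, hcu⟩ := Polynomial.isUnit_iff.1 u.isUnit
  have hmP : m = Polynomial.toLaurent P * LaurentPolynomial.T (-k) := by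
    rw [hP, mul_assoc, ← LaurentPolynomial.T_add, add_neg_cancel, LaurentPolynomial.T_zero,
      mul_one]
  refine ⟨j - k, c, ?_⟩
  rw [hmP, ← hu, ← hcu, map_mul, Polynomial.toLaurent_C, Polynomial.toLaurent_X_pow,
    LaurentPolynomial.single_eq_C_mul_T, sub_eq_add_neg, LaurentPolynomial.T_add]
  ring

theorem ratHom_mem_range_laurentHom {q : ℕ+} {ι : Type*} {p : ι → LaurentPolynomial F}
    (hcop : ∀ c : LaurentPolynomial F, (∀ j, c ∣ p j) → IsUnit c) {ρ : RatFunc F}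
    (h : ∀ j, ratHom F 1 q ρ * laurentHom F 1 q (p j) ∈ (laurentHom F 1 q).range) :
    ratHom F 1 q ρ ∈ (laurentHom F 1 q).range := by
  set A := Polynomial.toLaurent ρ.num with hA
  set B := Polynomial.toLaurent ρ.denom with hB
  have hρ : ratHom F 1 q ρ * laurentHom F 1 q B = laurentHom F 1 q A := by
    rw [hA, hB, laurentHom_toLaurent, laurentHom_toLaurent, ratHom_mul_denom]
  have hBA : IsCoprime B A := (RatFunc.isCoprime_num_denom ρ).symm.map Polynomial.toLaurent
  have hunit : IsUnit B := by
    refine hcop B fun j => ?_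
    obtain ⟨m, hm⟩ := h j
    refine hBA.dvd_of_dvd_mul_left (Dvd.intro m (laurentHom_injective q ?_))
    rw [map_mul, map_mul, ← hρ]
    linear_combination laurentHom F 1 q B * hm
  obtain ⟨B', hB'⟩ := hunit.exists_right_inv
  refine ⟨A * B', ?_⟩
  change laurentHom F 1 q (A * B') = _
  rw [map_mul, ← hρ, mul_assoc, ← map_mul, hB', map_one, mul_one]

theorem ratHom_eq_one_of_coprime {q : ℕ+} {ι ι' : Type*} {p : ι → LaurentPolynomial F}
    {p' : ι' → LaurentPolynomial F}
    (hcop : ∀ c : LaurentPolynomial F, (∀ j, c ∣ p j) → IsUnit c)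
    (hcop' : ∀ c : LaurentPolynomial F, (∀ j, c ∣ p' j) → IsUnit c) {ρ : RatFunc F} (hρ : ρ ≠ 0)
    (h : ∀ j, ratHom F 1 q ρ * laurentHom F 1 q (p j) ∈ (laurentHom F 1 q).range)
    (h' : ∀ j, ratHom F 1 q ρ⁻¹ * laurentHom F 1 q (p' j) ∈ (laurentHom F 1 q).range)
    (ho : orderP (ratHom F 1 q ρ) = 0) (hl : leadingCoeffP (ratHom F 1 q ρ) = 1) :
    ratHom F 1 q ρ = 1 := by
  obtain ⟨μ, hμ⟩ := ratHom_mem_range_laurentHom hcop h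
  obtain ⟨μ', hμ'⟩ := ratHom_mem_range_laurentHom hcop' h'
  change laurentHom F 1 q μ = _ at hμ
  change laurentHom F 1 q μ' = _ at hμ'
  have hunit : IsUnit μ := by
    refine .of_mul_eq_one μ' (laurentHom_injective q ?_)
    rw [map_mul, hμ, hμ', ← map_mul, mul_inv_cancel₀ hρ, map_one, map_one]
  obtain ⟨n, c, rfl⟩ := exists_eq_single_of_isUnit hunit
  rw [← laurentPolyAt_eq, laurentPolyAt_single] at hμ
  have hc : c ≠ 0 := by
    rintro rfl
    exact hunit.ne_zero (AddMonoidAlgebra.single_zero n)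
  rw [← hμ, orderP_monomialP hc] at ho
  rw [← hμ, leadingCoeffP_monomialP hc] at hl
  rw [← hμ, ho, hl]
  rfl

end Coprime

/-! ### Hypergeometric elements and similarity -/

section Hypergeometric

variable {F : Type*} [Field F] {b : ℕ+}

theorem mahler_smul (f : Puiseux F) (y : DRing F) :
    mahler F b (f • y) = mahlerP F b f • mahler F b y := by
  ext1
  ext1 lam
  rw [coeff_mahler, MonoidAlgebra.coeff_smul_apply, MonoidAlgebra.coeff_smul_apply, coeff_mahler,
    smul_eq_mul, smul_eq_mul, map_mul, mul_left_comm]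

theorem mahler_single_eq_smul_iff (lam : Fˣ) (p u : Puiseux F) :
    mahler F b (MonoidAlgebra.single lam p) = u • MonoidAlgebra.single lam p
      ↔ algebraMap F _ (lam : F) * mahlerP F b p = u * p := by
  rw [mahler_single, MonoidAlgebra.smul_single, MonoidAlgebra.single_right_inj, smul_eq_mul]

theorem eq_smul_of_mahler_eq (hb : 2 ≤ b) {lam lam' : Fˣ} {p p' u : Puiseux F} (hp : p ≠ 0)
    (hp' : p' ≠ 0) (hu : algebraMap F _ (lam : F) * mahlerP F b p = u * p)
    (hu' : algebraMap F _ (lam' : F) * mahlerP F b p' = u * p') :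
    lam = lam' ∧ ∃ c : F, p = c • p' := by
  have hM : mahlerP F b p' ≠ 0 := (map_ne_zero _).2 hp'
  have hquot : algebraMap F _ (lam : F) * mahlerP F b (p / p')
      = algebraMap F _ (lam' : F) * (p / p') := by
    rw [map_div₀]
    field_simp
    linear_combination p' * hu - p * hu'
  obtain ⟨hlam, c, hc⟩ := eq_algebraMap_of_mahlerP_eq_mul hb (div_ne_zero hp hp') lam.ne_zero hquot
  refine ⟨Units.ext hlam, c, ?_⟩
  rw [Algebra.smul_def, ← hc, div_mul_cancel₀ _ hp']

theorem exists_single_of_mahler_eq (hb : 2 ≤ b) {y : DRing F} (hy : y ≠ 0) {u : Puiseux F}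
    (hu : mahler F b y = u • y) :
    ∃ (lam : Fˣ) (p : Puiseux F), p ≠ 0 ∧ y = MonoidAlgebra.single lam p := by
  have hcoeff (m : Fˣ) : algebraMap F _ (m : F) * mahlerP F b (y.coeff m) = u * y.coeff m := by
    rw [← coeff_mahler, hu, MonoidAlgebra.coeff_smul_apply, smul_eq_mul]
  obtain ⟨lam, hlam⟩ : ∃ lam, y.coeff lam ≠ 0 := by
    by_contra! hzero
    exact hy (MonoidAlgebra.coeff_eq_zero.1 (Finsupp.ext hzero))
  refine ⟨lam, y.coeff lam, hlam, ?_⟩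
  ext1
  ext1 m
  rw [MonoidAlgebra.coeff_single]
  by_cases h : m = lam
  · rw [h, Finsupp.single_eq_same]
  · rw [Finsupp.single_eq_of_ne h]
    by_contra hm
    exact h (eq_smul_of_mahler_eq hb hm hlam (hcoeff m) (hcoeff lam)).1

theorem exists_smul_of_mahler_eq (hb : 2 ≤ b) {y z : DRing F} (hy : y ≠ 0) (hz : z ≠ 0)
    {u : Puiseux F} (hu : mahler F b y = u • y) (hu' : mahler F b z = u • z) :
    ∃ c : F, c ≠ 0 ∧ y = c • z := by
  obtain ⟨lam, p, hp, rfl⟩ := exists_single_of_mahler_eq hb hy hu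
  obtain ⟨lam', p', hp', rfl⟩ := exists_single_of_mahler_eq hb hz hu'
  rw [mahler_single_eq_smul_iff] at hu hu'
  obtain ⟨rfl, c, rfl⟩ := eq_smul_of_mahler_eq hb hp hp' hu hu'
  refine ⟨c, ?_, by rw [MonoidAlgebra.smul_single]⟩
  rintro rfl
  exact hp (zero_smul _ _)

theorem Similar.refl (y : DRing F) : Similar F y y :=
  ⟨1, (ramRatField F).one_mem, one_ne_zero, (one_smul _ _).symm⟩

theorem Similar.symm {y z : DRing F} (h : Similar F y z) : Similar F z y := by
  obtain ⟨f, hf, hf0, rfl⟩ := h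
  exact ⟨f⁻¹, (ramRatField F).inv_mem hf, inv_ne_zero hf0, (inv_smul_smul₀ hf0 _).symm⟩

theorem Similar.trans {x y z : DRing F} (h : Similar F x y) (h' : Similar F y z) :
    Similar F x z := by
  obtain ⟨f, hf, hf0, rfl⟩ := h
  obtain ⟨g, hg, hg0, rfl⟩ := h'
  exact ⟨f * g, (ramRatField F).mul_mem hf hg, mul_ne_zero hf0 hg0, smul_smul f g z⟩

theorem similar_constant_smul {c : F} (hc : c ≠ 0) (y : DRing F) : Similar F (c • y) y :=
  ⟨algebraMap F _ c, algebraMap_mem_ramRatField c, by simpa using hc,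
    (algebraMap_smul (Puiseux F) c y).symm⟩

/-- By `exists_semilinear_eigenvector`, a nontrivial relation yields one all of whose terms
`α i • z i` satisfy the same equation `M y = u y` as one of the `z i`, so are similar to it. -/
theorem linearIndependent_of_not_similar (hb : 2 ≤ b) {ι : Type*} [Finite ι] {z : ι → DRing F}
    (hz0 : ∀ i, z i ≠ 0) (hz : ∀ i, IsHypergeometric F b (z i))
    (hsim : ∀ i j, Similar F (z i) (z j) → i = j) : LinearIndependent (ramRatField F) z := by
  have := Fintype.ofFinite ι
  replace hz (i) : ∃ u : ramRatField F, mahler F b (z i) = u • z i :=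
    let ⟨u, hu, hMz⟩ := hz i
    ⟨⟨u, hu⟩, hMz⟩
  choose u hMz using hz
  let σ : ramRatField F →+* ramRatField F :=
    (mahlerP F b).restrict (ramRatField F) (ramRatField F) fun _ => mahlerP_mem_ramRatField b
  have hMsmul (a : ramRatField F) (i) : mahler F b (a • z i) = (u i * σ a) • z i := by
    rw [mul_comm, mul_smul, ← hMz]
    exact mahler_smul _ _
  rw [linearIndependent_iff_injective_fintypeLinearCombination, ← LinearMap.ker_eq_bot]
  by_contra hker
  obtain ⟨α, hα, i₀, hαi₀, hασ⟩ := exists_semilinear_eigenvector σ u hker fun α hα => by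
    rw [LinearMap.mem_ker, Fintype.linearCombination_apply] at hα ⊢
    rw [← map_zero (mahler F b), ← hα, map_sum]
    exact Finset.sum_congr rfl fun i _ => (hMsmul (α i) i).symm
  have hvanish : ∀ i ≠ i₀, α i • z i = 0 := by
    intro i hi
    by_contra hαzi
    have hαi : α i ≠ 0 := fun h => hαzi (by rw [h, zero_smul])
    have hM : mahler F b (α i • z i) = u i₀ • α i • z i := by rw [hMsmul, hασ, mul_smul]
    obtain ⟨c, hc, hcz⟩ := exists_smul_of_mahler_eq hb hαzi (hz0 i₀) hM (hMz i₀)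
    have hαz : Similar F (α i • z i) (z i) :=
      ⟨α i, (α i).2, by simpa using hαi, rfl⟩
    exact hi (hsim i i₀ (hαz.symm.trans (hcz ▸ similar_constant_smul hc _)))
  rw [LinearMap.mem_ker, Fintype.linearCombination_apply,
    Finset.sum_eq_single_of_mem i₀ (Finset.mem_univ _) fun i _ => hvanish i, hαi₀, one_smul] at hα
  exact hz0 i₀ hα

end Hypergeometric

/-! ### Normal form of a similarity class -/

section Classes

variable {K : Type*} [Field K] {F : Type*} [Field F] [Algebra K F]
  {b : ℕ+} {r : ℕ} {l : ℕ → Polynomial K}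

theorem Similar.isHypergeometric {y z : DRing F} (h : Similar F z y)
    (hy : IsHypergeometric F b y) : IsHypergeometric F b z := by
  obtain ⟨f, hf, hf0, rfl⟩ := h
  obtain ⟨u, hu, hMy⟩ := hy
  refine ⟨mahlerP F b f / f * u, (ramRatField F).mul_mem
    ((ramRatField F).div_mem (mahlerP_mem_ramRatField b hf) hf) hu, ?_⟩
  rw [mahler_smul, hMy, smul_smul, smul_smul]
  congr 1
  field_simp

theorem similar_single_mul {f : Puiseux F} (hf : f ∈ ramRatField F) (hf0 : f ≠ 0) (lam : Fˣ)
    (p : Puiseux F) : Similar F (MonoidAlgebra.single lam (f * p)) (MonoidAlgebra.single lam p) :=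
  ⟨f, hf, hf0, by rw [MonoidAlgebra.smul_single, smul_eq_mul]⟩

theorem laurentHom_single (q : ℕ+) (n : ℤ) (c : F) :
    laurentHom F 1 q (AddMonoidAlgebra.single n c)
      = ratHom F 1 q (RatFunc.C c * RatFunc.X ^ n) := by
  rw [← laurentPolyAt_eq, laurentPolyAt_single, ratHom_C_mul_X_zpow]
  congr 1
  simp only [PNat.val_ofNat, Nat.cast_one]
  ring

theorem laurentHom_mem_ramRatField (q : ℕ+) (m : LaurentPolynomial F) :
    laurentHom F 1 q m ∈ ramRatField F := by
  induction m using LaurentPolynomial.induction_on' with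
  | add m m' hm hm' => exact map_add (laurentHom F 1 q) m m' ▸ add_mem hm hm'
  | C_mul_T n c =>
    rw [← LaurentPolynomial.single_eq_C_mul_T, laurentHom_single]
    exact ratHom_mem_ramRat 1 q _

/-- The linear map `m ↦ e_lam * m(x^(1/q)) * w` on Laurent polynomials. -/
def laurentSeries (lam : Fˣ) (q : ℕ+) (w : Puiseux F) : LaurentPolynomial F →ₗ[F] DRing F :=
  MonoidAlgebra.lsingle lam ∘ₗ LinearMap.mulRight F w ∘ₗ (laurentHom F 1 q).toLinearMap

theorem laurentSeries_injective (lam : Fˣ) (q : ℕ+) {w : Puiseux F} (hw : w ≠ 0) :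
    Function.Injective (laurentSeries lam q w) :=
  MonoidAlgebra.single_right_injective.comp
    ((mul_left_injective₀ hw).comp (laurentHom_injective q))

theorem series_eq_laurentSeries (d : ClassData F) :
    d.series b r l = laurentSeries d.lam (ramBound b r l (d.lam : F))
      (powerSeriesAt 1 (ramBound b r l (d.lam : F)) (infProd b d.g)) ∘ d.p := rfl

theorem span_series (d : ClassData F) :
    Submodule.span F (Set.range (d.series b r l))
      = (Submodule.span F (Set.range d.p)).map
        (laurentSeries d.lam (ramBound b r l (d.lam : F))
          (powerSeriesAt 1 (ramBound b r l (d.lam : F)) (infProd b d.g))) := by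
  rw [Submodule.map_span, ← Set.range_comp, ← series_eq_laurentSeries]

theorem rank_ker_twistedOp_le (hb : 2 ≤ b) (hl0 : l 0 ≠ 0) (lam : Fˣ) :
    Module.rank F (LinearMap.ker (twistedOp (F := F) b r l (lam : F))) ≤ r := by
  refine rank_le fun s hs => ?_
  have hind := hs.map' (MonoidAlgebra.lsingle lam ∘ₗ Submodule.subtype _)
    (LinearMap.ker_eq_bot.2 (MonoidAlgebra.single_right_injective.comp Subtype.val_injective))
  simpa using card_le_of_linearIndependent (b := b) (lam := fun _ : s => lam)
    (p := fun i => i.1.1) hb hl0 hind fun i => i.1.2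

/-- The linear map `f ↦ f(x^(1/q)) * p` on rational functions. -/
def ratMul (q : ℕ+) (p : Puiseux F) : RatFunc F →ₗ[F] Puiseux F where
  toFun f := ratHom F 1 q f * p
  map_add' f f' := by rw [map_add, add_mul]
  map_smul' c f := by
    rw [RatFunc.smul_eq_C_mul, map_mul, ratHom_C, ← Algebra.smul_def, smul_mul_assoc,
      RingHom.id_apply]

/-- The space of the rational functions `f` such that `f(x^(1/q)) * p` solves the equation
twisted by `lam`. -/
def cofactors (b : ℕ+) (r : ℕ) (l : ℕ → Polynomial K) (lam : Fˣ) (q : ℕ+) (p : Puiseux F) :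
    Submodule F (RatFunc F) :=
  (LinearMap.ker (twistedOp b r l (lam : F))).comap (ratMul q p)

theorem finiteDimensional_cofactors (hb : 2 ≤ b) (hl0 : l 0 ≠ 0) (lam : Fˣ) (q : ℕ+)
    {p : Puiseux F} (hp : p ≠ 0) : FiniteDimensional F (cofactors b r l lam q p) := by
  have hker : FiniteDimensional F (LinearMap.ker (twistedOp (F := F) b r l (lam : F))) :=
    Module.rank_lt_aleph0_iff.1
      ((rank_ker_twistedOp_le hb hl0 lam).trans_lt Cardinal.natCast_lt_aleph0)
  refine FiniteDimensional.of_injective ((ratMul q p).restrict (p := cofactors b r l lam q p)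
    (q := LinearMap.ker (twistedOp b r l (lam : F))) fun _ hf => hf) fun f f' h => ?_
  exact Subtype.ext ((ratHom F 1 q).injective (mul_right_cancel₀ hp (congrArg Subtype.val h)))

theorem insert_simClass_eq_map (hb : 2 ≤ b) (hl0 : l 0 ≠ 0) {lam : Fˣ} {p : Puiseux F}
    (hy : MonoidAlgebra.single lam p ∈ hypSolutions F b r l) :
    insert 0 {z | z ∈ hypSolutions F b r l ∧ Similar F z (MonoidAlgebra.single lam p)}
      = (((cofactors b r l lam (ramBound b r l (lam : F)) p).map
          (MonoidAlgebra.lsingle lam ∘ₗ ratMul (ramBound b r l (lam : F)) p) :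
            Submodule F (DRing F)) : Set (DRing F)) := by
  have hp : p ≠ 0 := MonoidAlgebra.single_ne_zero.1 hy.1
  ext z
  constructor
  · rintro (rfl | ⟨hz, f, hf, hf0, rfl⟩)
    · exact zero_mem _
    · rw [MonoidAlgebra.smul_single, smul_eq_mul] at hz ⊢
      have hLp := (applyL_single_eq_zero_iff b r l lam p).1 hy.2.2
      have hLf := (applyL_single_eq_zero_iff b r l lam (f * p)).1 hz.2.2
      have hramified : f ∈ ramifiedField F (ramBound b r l (lam : F)) := by
        rw [← mul_div_cancel_right₀ f hp]
        exact div_mem (mem_ramifiedField_ramBound hb hl0 lam.ne_zero hLf)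
          (mem_ramifiedField_ramBound hb hl0 lam.ne_zero hLp)
      obtain ⟨g, rfl⟩ := exists_ratHom_of_mem_ramifiedField hf hramified
      exact ⟨g, hLf, rfl⟩
  · rintro ⟨g, hg, rfl⟩
    rcases eq_or_ne g 0 with rfl | hg0
    · exact Or.inl (map_zero _)
    · have hg0' := (map_ne_zero (ratHom F 1 (ramBound b r l (lam : F)))).2 hg0
      have hsim : Similar F (MonoidAlgebra.single lam (ratMul (ramBound b r l (lam : F)) p g))
          (MonoidAlgebra.single lam p) :=
        similar_single_mul (ratHom_mem_ramRat 1 _ g) hg0' lam p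
      exact Or.inr ⟨⟨MonoidAlgebra.single_ne_zero.2 (mul_ne_zero hg0' hp),
        hsim.isHypergeometric hy.2.1, (applyL_single_eq_zero_iff b r l lam _).2 hg⟩, hsim⟩

theorem exists_coprime_span_eq (V : Submodule F (RatFunc F)) [FiniteDimensional F V]
    (hV : V ≠ ⊥) :
    ∃ (n : ℕ) (c : RatFunc F) (m a : Fin n → Polynomial F), c ≠ 0 ∧
      Submodule.span F (Set.range fun i => c * algebraMap _ _ (m i)) = V ∧
      ∑ i, a i * m i = 1 := by
  let f (i) : RatFunc F := Module.finBasis F V i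
  have hspan : Submodule.span F (Set.range f) = V := by
    rw [show f = V.subtype ∘ Module.finBasis F V from rfl, Set.range_comp, ← Submodule.map_span,
      Module.Basis.span_eq, Submodule.map_top, Submodule.range_subtype]
  have hf0 : f ≠ 0 := fun hf => hV <| by
    rw [← hspan, Submodule.span_eq_bot]
    rintro _ ⟨i, rfl⟩
    exact congrFun hf i
  obtain ⟨c, m, a, hfm, ham⟩ := exists_eq_mul_algebraMap_of_bezout (Polynomial F) hf0
  refine ⟨_, c, m, a, ?_, ?_, ham⟩
  · rintro rfl
    exact hf0 (funext fun i => (hfm i).trans (zero_mul _))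
  · rw [← funext hfm, hspan]

theorem exists_isReducedEchelon_coprime {n : ℕ} {m a : Fin n → LaurentPolynomial F}
    (ham : IsUnit (∑ i, a i * m i)) :
    ∃ (s : ℕ) (p : Fin s → LaurentPolynomial F), 0 < s ∧ IsReducedEchelon p ∧
      Submodule.span F (Set.range p) = Submodule.span F (Set.range m) ∧
      ∀ c : LaurentPolynomial F, (∀ j, c ∣ p j) → IsUnit c := by
  have := FiniteDimensional.span_of_finite F (Set.finite_range m)
  obtain ⟨s, p, hp, hspan⟩ := exists_isReducedEchelon (Submodule.span F (Set.range m))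
  have hmem (i) : m i ∈ Submodule.span F (Set.range p) :=
    hspan ▸ Submodule.subset_span ⟨i, rfl⟩
  have hdvd (c) (hc : ∀ j, c ∣ p j) : c ∣ ∑ i, a i * m i := by
    refine Finset.dvd_sum fun i _ => Dvd.dvd.mul_left ?_ _
    obtain ⟨t, ht⟩ := (Submodule.mem_span_range_iff_exists_fun F).1 (hmem i)
    rw [← ht]
    exact Finset.dvd_sum fun j _ => (hc j).trans (Dvd.intro_left (.C (t j))
      (LaurentPolynomial.smul_eq_C_mul (t j) (p j)).symm)
  refine ⟨s, p, Nat.pos_of_ne_zero ?_, hp, hspan, fun c hc => isUnit_of_dvd_unit (hdvd c hc) ham⟩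
  rintro rfl
  exact (isUnit_of_dvd_unit (hdvd 0 fun j => j.elim0) ham).ne_zero rfl

theorem exists_eq_powerSeriesAt_infProd (hb : 2 ≤ b) {q : ℕ+} {w u : Puiseux F}
    (hq : w ∈ ramifiedField F q) (ho : orderP w = 0) (hl : leadingCoeffP w = 1)
    (hu : u ∈ ramRatField F) (hM : mahlerP F b w = u * w) :
    ∃ g : RatFunc F, RatFunc.eval (RingHom.id F) 0 g = 1 ∧
      w = powerSeriesAt 1 q (infProd b g) := by
  have hw : w ≠ 0 := by
    rintro rfl
    simp [leadingCoeffP] at hl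
  have hu0 : u ≠ 0 := left_ne_zero_of_mul (hM ▸ (map_ne_zero _).2 hw)
  have hramified : u ∈ ramifiedField F q := by
    rw [← mul_div_cancel_right₀ u hw, ← hM]
    exact div_mem (mahlerP_mem_ramifiedField hq b) hq
  obtain ⟨g, rfl⟩ := exists_ratHom_of_mem_ramifiedField hu hramified
  have hou : orderP (ratHom F 1 q g) = 0 := by
    have := congrArg orderP hM
    rwa [orderP_mahlerP b hw, orderP_mul hu0 hw, ho, mul_zero, add_zero, eq_comm] at this
  have hlu : leadingCoeffP (ratHom F 1 q g) = 1 := by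
    have := congrArg leadingCoeffP hM
    rwa [leadingCoeffP_mahlerP b hw, leadingCoeffP_mul, hl, mul_one, eq_comm] at this
  have hg := eval_zero_eq_one ((map_ne_zero _).1 hu0) hou hlu
  exact ⟨g, hg, eq_infProd hb hg hl hM⟩

theorem exists_eq_monomial_mul {q : ℕ+} {p : Puiseux F} (hp : p ≠ 0)
    (hq : p ∈ ramifiedField F q) :
    ∃ (n : ℤ) (κ : F) (w : Puiseux F), κ ≠ 0 ∧ orderP w = 0 ∧ leadingCoeffP w = 1 ∧
      p = laurentHom F 1 q (AddMonoidAlgebra.single n κ) * w := by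
  set κ := leadingCoeffP p with hκ
  have hκ0 : κ ≠ 0 := leadingCoeffP_ne_zero hp
  obtain ⟨n, hn⟩ := hq (orderP p) hκ0
  have hμ0 : monomialP (orderP p) κ ≠ 0 := monomialP_ne_zero hκ0
  have hw0 : p / monomialP (orderP p) κ ≠ 0 := div_ne_zero hp hμ0
  have hmul : monomialP (orderP p) κ * (p / monomialP (orderP p) κ) = p := mul_div_cancel₀ _ hμ0
  refine ⟨n, κ, p / monomialP (orderP p) κ, hκ0, ?_, ?_, ?_⟩
  · have := congrArg orderP hmul
    rwa [orderP_mul hμ0 hw0, orderP_monomialP hκ0, add_eq_left] at this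
  · have := congrArg leadingCoeffP hmul
    rwa [leadingCoeffP_mul, leadingCoeffP_monomialP hκ0, ← hκ, mul_eq_left₀ hκ0] at this
  · rw [laurentHom_single, ratHom_C_mul_X_zpow, ← hn, hmul]

theorem IsHypergeometric.exists_eq_monomial_mul_infProd (hb : 2 ≤ b) {q : ℕ+} {lam : Fˣ}
    {p : Puiseux F} (hy : IsHypergeometric F b (MonoidAlgebra.single lam p)) (hp : p ≠ 0)
    (hq : p ∈ ramifiedField F q) :
    ∃ (n : ℤ) (κ : F) (g : RatFunc F), κ ≠ 0 ∧ RatFunc.eval (RingHom.id F) 0 g = 1 ∧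
      p = laurentHom F 1 q (AddMonoidAlgebra.single n κ)
        * powerSeriesAt 1 q (infProd b g) := by
  obtain ⟨n, κ, w, hκ, ho, hl, rfl⟩ := exists_eq_monomial_mul hp hq
  set μ := laurentHom F 1 q (AddMonoidAlgebra.single n κ)
  have hμ0 : μ ≠ 0 := left_ne_zero_of_mul hp
  have hμq : μ ∈ ramifiedField F q := hasRamification_laurent q _
  have hwq : w ∈ ramifiedField F q := mul_div_cancel_left₀ w hμ0 ▸ div_mem hq hμq
  have hsim : Similar F (MonoidAlgebra.single lam w) (MonoidAlgebra.single lam (μ * w)) :=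
    (similar_single_mul (laurentHom_mem_ramRatField q _) hμ0 lam w).symm
  obtain ⟨u, hu, hM⟩ := hsim.isHypergeometric hy
  rw [mahler_single_eq_smul_iff] at hM
  have hMw : mahlerP F b w = (algebraMap F _ (lam : F))⁻¹ * u * w := by
    rw [mul_assoc, ← hM, inv_mul_cancel_left₀ (by simp)]
  obtain ⟨g, hg, rfl⟩ := exists_eq_powerSeriesAt_infProd hb hwq ho hl
    (mul_mem (inv_mem (algebraMap_mem_ramRatField _)) hu) hMw
  exact ⟨n, κ, g, hκ, hg, rfl⟩

theorem map_laurentSeries_span {q : ℕ+} {p w : Puiseux F} {c : RatFunc F}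
    {ε : LaurentPolynomial F} (h : ratHom F 1 q c * p = laurentHom F 1 q ε * w) (lam : Fˣ)
    {n : ℕ} (m : Fin n → Polynomial F) :
    (Submodule.span F (Set.range fun i => Polynomial.toLaurent (m i) * ε)).map
        (laurentSeries lam q w)
      = (Submodule.span F (Set.range fun i => c * algebraMap _ (RatFunc F) (m i))).map
        (MonoidAlgebra.lsingle lam ∘ₗ ratMul q p) := by
  rw [Submodule.map_span, Submodule.map_span, ← Set.range_comp, ← Set.range_comp]
  congr 2
  funext i
  refine congrArg (MonoidAlgebra.single lam) ?_
  change laurentHom F 1 q (Polynomial.toLaurent (m i) * ε) * w = ratHom F 1 q (c * _) * p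
  rw [map_mul, mul_assoc, ← h, laurentHom_toLaurent, map_mul, mul_left_comm, mul_assoc]

theorem ClassData.represents_of_map_span {d : ClassData F} {H : Set (DRing F)} (hs : 0 < d.s)
    (hg : RatFunc.eval (RingHom.id F) 0 d.g = 1) (hech : IsReducedEchelon d.p)
    (hcop : ∀ c : LaurentPolynomial F, (∀ j, c ∣ d.p j) → IsUnit c)
    (hspan : ((Submodule.span F (Set.range d.p)).map
      (laurentSeries d.lam (ramBound b r l (d.lam : F))
        (powerSeriesAt 1 (ramBound b r l (d.lam : F)) (infProd b d.g))) : Set (DRing F))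
      = insert 0 H) : d.Represents b r l H where
  s_pos := hs
  g_zero := hg
  linearIndependent := by
    rw [series_eq_laurentSeries]
    exact hech.linearIndependent.map' _ (LinearMap.ker_eq_bot.2
      (laurentSeries_injective d.lam _ (infProd_ne_zero _ hg)))
  span_eq := by rw [span_series, hspan]
  echelon := hech
  coprime := hcop

theorem exists_represents (hb : 2 ≤ b) (hl0 : l 0 ≠ 0) {H : Set (DRing F)}
    (hH : H ∈ simClasses F b r l) : ∃ d : ClassData F, d.Represents b r l H := by
  obtain ⟨y, hy, rfl⟩ := hH
  obtain ⟨lam, p, hp, rfl⟩ := exists_single_of_mahler_eq hb hy.1 hy.2.1.choose_spec.2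
  have hLp := (applyL_single_eq_zero_iff b r l lam p).1 hy.2.2
  set q := ramBound b r l (lam : F) with hq
  have := finiteDimensional_cofactors (r := r) hb hl0 lam q hp
  have hone : 1 ∈ cofactors b r l lam q p := by
    change twistedOp b r l (lam : F) (ratHom F 1 q 1 * p) = 0
    rw [map_one, one_mul, hLp]
  obtain ⟨k, c, m, a, hc, hspan, ham⟩ := exists_coprime_span_eq (cofactors b r l lam q p)
    ((Submodule.ne_bot_iff _).2 ⟨1, hone, one_ne_zero⟩)
  have hc0 : ratHom F 1 q c ≠ 0 := (map_ne_zero _).2 hc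
  have hsim : Similar F (MonoidAlgebra.single lam (ratHom F 1 q c * p))
      (MonoidAlgebra.single lam p) :=
    similar_single_mul (ratHom_mem_ramRat 1 q c) hc0 lam p
  obtain ⟨n, κ, g, hκ, hg, hcp⟩ :=
    (hsim.isHypergeometric hy.2.1).exists_eq_monomial_mul_infProd hb (mul_ne_zero hc0 hp)
      (mul_mem (ratHom_mem_ramifiedField q c)
        (mem_ramifiedField_ramBound hb hl0 lam.ne_zero hLp))
  set ε : LaurentPolynomial F := AddMonoidAlgebra.single n κ with hε
  have hεunit : IsUnit ε := by
    rw [hε, LaurentPolynomial.single_eq_C_mul_T]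
    exact ((isUnit_iff_ne_zero.2 hκ).map LaurentPolynomial.C).mul (LaurentPolynomial.isUnit_T n)
  have hbezout : ∑ i, Polynomial.toLaurent (a i) * (Polynomial.toLaurent (m i) * ε) = ε := by
    simp only [← mul_assoc, ← map_mul]
    rw [← Finset.sum_mul, ← map_sum, ham, map_one, one_mul]
  obtain ⟨s, P, hs, hech, hPspan, hcop⟩ := exists_isReducedEchelon_coprime (hbezout ▸ hεunit)
  refine ⟨⟨lam, g, s, P⟩, ClassData.represents_of_map_span hs hg hech hcop ?_⟩
  rw [insert_simClass_eq_map hb hl0 hy, SetLike.coe_set_eq, ← hq, ← hspan,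
    ← map_laurentSeries_span hcp, ← hPspan]

end Classes

/-! ### Uniqueness of the normal form -/

section Classification

variable {K : Type*} [Field K] {F : Type*} [Field F] [Algebra K F]
  {b : ℕ+} {r : ℕ} {l : ℕ → Polynomial K} {H H' : Set (DRing F)} {d d' : ClassData F}

theorem subset_hypSolutions (hH : H ∈ simClasses F b r l) : H ⊆ hypSolutions F b r l := by
  obtain ⟨x, -, rfl⟩ := hH
  exact fun z hz => hz.1

theorem similar_of_mem (hH : H ∈ simClasses F b r l) {y z : DRing F} (hy : y ∈ H) (hz : z ∈ H) :
    Similar F y z := by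
  obtain ⟨x, -, rfl⟩ := hH
  exact hy.2.trans hz.2.symm

theorem simClass_eq_of_similar (hH : H ∈ simClasses F b r l) (hH' : H' ∈ simClasses F b r l)
    {y y' : DRing F} (hy : y ∈ H) (hy' : y' ∈ H') (h : Similar F y y') : H = H' := by
  obtain ⟨x, -, rfl⟩ := hH
  obtain ⟨x', -, rfl⟩ := hH'
  have hxx' : Similar F x x' := hy.2.symm.trans (h.trans hy'.2)
  ext z
  exact ⟨fun hz => ⟨hz.1, hz.2.trans hxx'⟩, fun hz => ⟨hz.1, hz.2.trans hxx'.symm⟩⟩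

theorem lam_eq_of_similar {lam lam' : Fˣ} {p p' : Puiseux F} (hp : p ≠ 0)
    (h : Similar F (MonoidAlgebra.single lam p) (MonoidAlgebra.single lam' p')) : lam = lam' := by
  obtain ⟨f, -, -, h⟩ := h
  rw [MonoidAlgebra.smul_single, MonoidAlgebra.single_inj] at h
  exact h.elim And.left fun h => absurd h.1 hp

namespace ClassData.Represents

theorem series_mem (hd : d.Represents b r l H) (j : Fin d.s) : d.series b r l j ∈ H := by
  have hmem : d.series b r l j ∈ insert 0 H := hd.span_eq ▸ Submodule.subset_span ⟨j, rfl⟩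
  exact hmem.resolve_left (hd.linearIndependent.ne_zero j)

theorem exists_series_mem (hd : d.Represents b r l H) : ∃ j, d.series b r l j ∈ H :=
  ⟨⟨0, hd.s_pos⟩, hd.series_mem _⟩

theorem p_ne_zero (hd : d.Represents b r l H) (j : Fin d.s) : d.p j ≠ 0 := fun h =>
  hd.linearIndependent.ne_zero j (by rw [series_eq_laurentSeries, Function.comp, h, map_zero])

theorem lam_eq (hH : H ∈ simClasses F b r l) (hd : d.Represents b r l H) {lam : Fˣ}
    {p : Puiseux F} (hp : MonoidAlgebra.single lam p ∈ H) : d.lam = lam := by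
  obtain ⟨j, hj⟩ := hd.exists_series_mem
  exact lam_eq_of_similar (MonoidAlgebra.single_ne_zero.1 (hd.linearIndependent.ne_zero j))
    (similar_of_mem hH hj hp)

end ClassData.Represents

theorem div_mul_laurentHom_mem_range {lam : Fˣ} {q : ℕ+} {w w' : Puiseux F} (hw' : w' ≠ 0)
    {V V' : Submodule F (LaurentPolynomial F)}
    (hV : V.map (laurentSeries lam q w) ≤ V'.map (laurentSeries lam q w'))
    {m : LaurentPolynomial F} (hm : m ∈ V) :
    w / w' * laurentHom F 1 q m ∈ (laurentHom F 1 q).range := by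
  obtain ⟨m', -, h⟩ := hV (Submodule.mem_map_of_mem hm)
  have heq : laurentHom F 1 q m' * w' = laurentHom F 1 q m * w :=
    MonoidAlgebra.single_right_injective h
  refine ⟨m', ?_⟩
  rw [div_mul_eq_mul_div, eq_div_iff hw', mul_comm w, ← heq]
  rfl

/-- By `div_mul_laurentHom_mem_range`, multiplication by `w / w'` and by `w' / w` preserves
Laurent polynomials on the coprime families `p` and `p'`. Hence `w / w'` is a unit of the ring of
Laurent polynomials, and a monic monomial of degree zero. -/
theorem eq_of_map_laurentSeries_span_eq {lam : Fˣ} {q : ℕ+} {w w' : Puiseux F} (hw : w ≠ 0)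
    (hw' : w' ≠ 0) (hwq : w ∈ ramifiedField F q) (hwq' : w' ∈ ramifiedField F q)
    (ho : orderP w = orderP w') (hl : leadingCoeffP w = leadingCoeffP w')
    {ι ι' : Type*} {p : ι → LaurentPolynomial F} {p' : ι' → LaurentPolynomial F}
    (hp : ∃ j, p j ≠ 0) (hcop : ∀ c : LaurentPolynomial F, (∀ j, c ∣ p j) → IsUnit c)
    (hcop' : ∀ c : LaurentPolynomial F, (∀ j, c ∣ p' j) → IsUnit c)
    (hspan : (Submodule.span F (Set.range p)).map (laurentSeries lam q w)
      = (Submodule.span F (Set.range p')).map (laurentSeries lam q w')) : w = w' := by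
  have hmem (j) := div_mul_laurentHom_mem_range hw' hspan.le (Submodule.subset_span ⟨j, rfl⟩)
  have hmem' (j) := div_mul_laurentHom_mem_range hw hspan.ge (Submodule.subset_span ⟨j, rfl⟩)
  have hratio : w / w' ∈ ramRatField F := by
    obtain ⟨j, hj⟩ := hp
    obtain ⟨m, hm⟩ := hmem j
    have hj' : laurentHom F 1 q (p j) ≠ 0 := (map_ne_zero_iff _ (laurentHom_injective q)).2 hj
    rw [← mul_div_cancel_right₀ (w / w') hj', ← hm]
    exact div_mem (laurentHom_mem_ramRatField q m) (laurentHom_mem_ramRatField q _)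
  obtain ⟨ρ, hρ⟩ := exists_ratHom_of_mem_ramifiedField hratio (div_mem hwq hwq')
  have hρ0 : ratHom F 1 q ρ ≠ 0 := hρ ▸ div_ne_zero hw hw'
  have hmul : ratHom F 1 q ρ * w' = w := hρ ▸ div_mul_cancel₀ w hw'
  have hone : ratHom F 1 q ρ = 1 := by
    refine ratHom_eq_one_of_coprime hcop hcop' ((map_ne_zero _).1 hρ0) (fun j => hρ ▸ hmem j)
      (fun j => ?_) ?_ ?_
    · rw [map_inv₀, ← hρ, inv_div]
      exact hmem' j
    · rwa [← hmul, orderP_mul hρ0 hw', add_eq_right] at ho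
    · rwa [← hmul, leadingCoeffP_mul, mul_eq_right₀ (leadingCoeffP_ne_zero hw')] at hl
  rw [← hmul, hone, one_mul]

theorem infProd_injOn (hb : 2 ≤ b) (q : ℕ+) {g g' : RatFunc F}
    (hg : RatFunc.eval (RingHom.id F) 0 g = 1) (hg' : RatFunc.eval (RingHom.id F) 0 g' = 1)
    (h : powerSeriesAt 1 q (infProd b g) = powerSeriesAt 1 q (infProd b g')) : g = g' := by
  refine (ratHom F 1 q).injective (mul_right_cancel₀ (infProd_ne_zero (b := b) q hg) ?_)
  rw [← mahlerP_infProd hb q hg, h, mahlerP_infProd hb q hg']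

theorem ClassData.Represents.unique (hb : 2 ≤ b) (hH : H ∈ simClasses F b r l)
    (hd : d.Represents b r l H) (hd' : d'.Represents b r l H) : d = d' := by
  obtain ⟨j, hj⟩ := hd.exists_series_mem
  obtain ⟨j', hj'⟩ := hd'.exists_series_mem
  have hlam : d.lam = d'.lam := hd.lam_eq hH hj'
  have hspan : Submodule.span F (Set.range (d.series b r l))
      = Submodule.span F (Set.range (d'.series b r l)) :=
    SetLike.coe_injective (hd.span_eq.trans hd'.span_eq.symm)
  rw [span_series, span_series] at hspan
  have hp := hd.p_ne_zero j
  obtain ⟨lam, g, s, p⟩ := d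
  obtain ⟨lam', g', s', p'⟩ := d'
  obtain rfl : lam = lam' := hlam
  obtain ⟨-, hg, -, -, hech, hcop⟩ := hd
  obtain ⟨-, hg', -, -, hech', hcop'⟩ := hd'
  dsimp only at hg hg' hech hech' hcop hcop' hspan hp
  set q := ramBound b r l (lam : F)
  obtain rfl : g = g' := infProd_injOn hb q hg hg' <|
    eq_of_map_laurentSeries_span_eq (infProd_ne_zero q hg) (infProd_ne_zero q hg')
      (powerSeriesAt_mem_ramifiedField q _) (powerSeriesAt_mem_ramifiedField q _)
      ((orderP_infProd q hg).trans (orderP_infProd q hg').symm)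
      ((leadingCoeffP_infProd q hg).trans (leadingCoeffP_infProd q hg').symm)
      ⟨j, hp⟩ hcop hcop' hspan
  obtain ⟨rfl, hp⟩ := hech.unique hech' (Submodule.map_injective_of_injective
    (laurentSeries_injective lam q (infProd_ne_zero q hg)) hspan)
  rw [eq_of_heq hp]

theorem existsUnique_represents (hb : 2 ≤ b) (hl0 : l 0 ≠ 0) (hH : H ∈ simClasses F b r l) :
    ∃! d : ClassData F, d.Represents b r l H :=
  let ⟨d, hd⟩ := exists_represents hb hl0 hH
  ⟨d, hd, fun _ hd' => hd'.unique hb hH hd⟩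

theorem similar_laurentSeries {q : ℕ+} {m m' : LaurentPolynomial F} (hm : m ≠ 0) (hm' : m' ≠ 0)
    (lam : Fˣ) (w : Puiseux F) :
    Similar F (laurentSeries lam q w m) (laurentSeries lam q w m') := by
  have hsim {m} (hm : m ≠ 0) : Similar F (laurentSeries lam q w m) (MonoidAlgebra.single lam w) :=
    similar_single_mul (laurentHom_mem_ramRatField q m)
      ((map_ne_zero_iff _ (laurentHom_injective q)).2 hm) lam w
  exact (hsim hm).trans (hsim hm').symm

theorem simClass_eq_of_represents (hH : H ∈ simClasses F b r l) (hH' : H' ∈ simClasses F b r l)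
    (hd : d.Represents b r l H) (hd' : d'.Represents b r l H')
    (h : (d.lam, d.g) = (d'.lam, d'.g)) : H = H' := by
  obtain ⟨j, hj⟩ := hd.exists_series_mem
  obtain ⟨j', hj'⟩ := hd'.exists_series_mem
  refine simClass_eq_of_similar hH hH' hj hj' ?_
  have hsim := similar_laurentSeries (q := ramBound b r l (d.lam : F)) (hd.p_ne_zero j)
    (hd'.p_ne_zero j') d.lam (powerSeriesAt 1 (ramBound b r l (d.lam : F)) (infProd b d.g))
  obtain ⟨hlam, hg⟩ := Prod.mk.inj h
  rw [series_eq_laurentSeries, series_eq_laurentSeries, ← hlam, ← hg]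
  exact hsim

theorem classOf_eq (hH : H ∈ simClasses F b r l) (hd : d.Represents b r l H) :
    classOf b r l (d.lam, d.g) = H := by
  ext y
  refine ⟨?_, fun hy => ⟨H, hH, hy, d, hd, rfl⟩⟩
  rintro ⟨H', hH', hy, d', hd', heq⟩
  rwa [simClass_eq_of_represents hH hH' hd hd' heq.symm]

theorem classOf_mem_simClasses {i : Fˣ × RatFunc F} (hi : i ∈ classIndices b r l F) :
    classOf b r l i ∈ simClasses F b r l := by
  obtain ⟨H, hH, d, hd, rfl⟩ := hi
  rwa [classOf_eq hH hd]

variable (b r l) in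
theorem exists_represents_classOf : ∃ D : Fˣ × RatFunc F → ClassData F,
    ∀ i ∈ classIndices b r l F,
      (D i).Represents b r l (classOf b r l i) ∧ ((D i).lam, (D i).g) = i := by
  have hex (i : Fˣ × RatFunc F) (hi : i ∈ classIndices b r l F) :
      ∃ d : ClassData F, d.Represents b r l (classOf b r l i) ∧ (d.lam, d.g) = i := by
    obtain ⟨H, hH, d, hd, rfl⟩ := hi
    exact ⟨d, (classOf_eq hH hd).symm ▸ hd, rfl⟩
  have : Nonempty (ClassData F) := ⟨⟨1, 0, 0, 0⟩⟩
  choose! D hD using hex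
  exact ⟨D, hD⟩

theorem exists_mem_classOf (hb : 2 ≤ b) (hl0 : l 0 ≠ 0) {y : DRing F}
    (hy : y ∈ hypSolutions F b r l) : ∃ i ∈ classIndices b r l F, y ∈ classOf b r l i := by
  have hH : {z | z ∈ hypSolutions F b r l ∧ Similar F z y} ∈ simClasses F b r l := ⟨y, hy, rfl⟩
  obtain ⟨d, hd⟩ := exists_represents hb hl0 hH
  refine ⟨(d.lam, d.g), ⟨_, hH, d, hd, rfl⟩, ?_⟩
  rw [classOf_eq hH hd]
  exact ⟨hy, Similar.refl y⟩

theorem eq_of_similar_of_mem_classOf (hb : 2 ≤ b) {i i' : Fˣ × RatFunc F}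
    (hi : i ∈ classIndices b r l F) (hi' : i' ∈ classIndices b r l F) {y z : DRing F}
    (hy : y ∈ classOf b r l i) (hz : z ∈ classOf b r l i') (h : Similar F y z) : i = i' := by
  obtain ⟨H, hH, d, hd, rfl⟩ := hi
  obtain ⟨H', hH', d', hd', rfl⟩ := hi'
  rw [classOf_eq hH hd] at hy
  rw [classOf_eq hH' hd'] at hz
  obtain rfl := simClass_eq_of_similar hH hH' hy hz h
  rw [hd.unique hb hH hd']

theorem fst_eq_of_single_mem_classOf {i : Fˣ × RatFunc F} (hi : i ∈ classIndices b r l F)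
    {lam : Fˣ} {p : Puiseux F} (hp : MonoidAlgebra.single lam p ∈ classOf b r l i) :
    i.1 = lam := by
  obtain ⟨H, hH, d, hd, rfl⟩ := hi
  exact hd.lam_eq hH (classOf_eq hH hd ▸ hp)

theorem disjoint_classOf (hb : 2 ≤ b) :
    (classIndices b r l F).PairwiseDisjoint (classOf b r l) := fun _ hi _ hi' hne =>
  Set.disjoint_left.2 fun y hy hy' =>
    hne (eq_of_similar_of_mem_classOf hb hi hi' hy hy' (Similar.refl y))

theorem hypSolutions_single_eq (hb : 2 ≤ b) (hl0 : l 0 ≠ 0) (lam : Fˣ) :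
    {y | y ∈ hypSolutions F b r l ∧ ∃ p : Puiseux F, y = MonoidAlgebra.single lam p}
      = ⋃ i ∈ {i | i ∈ classIndices b r l F ∧ i.1 = lam}, classOf b r l i := by
  ext y
  simp only [Set.mem_iUnion, Set.mem_ofPred_eq, exists_prop]
  constructor
  · rintro ⟨hy, p, rfl⟩
    obtain ⟨i, hi, hyi⟩ := exists_mem_classOf hb hl0 hy
    exact ⟨i, ⟨hi, fst_eq_of_single_mem_classOf hi hyi⟩, hyi⟩
  · rintro ⟨i, ⟨hi, rfl⟩, hyi⟩
    have hy := subset_hypSolutions (classOf_mem_simClasses hi) hyi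
    obtain ⟨lam, p, -, rfl⟩ := exists_single_of_mahler_eq hb hy.1 hy.2.1.choose_spec.2
    exact ⟨hy, p, by rw [fst_eq_of_single_mem_classOf hi hyi]⟩

theorem fst_mem_Lam'_and_eval_snd_eq_one {E : Type*} [Field E] [Algebra K E] [Algebra F E]
    [IsScalarTower K F E] (hb : 2 ≤ b) (hl0 : l 0 ≠ 0) {i : Fˣ × RatFunc F}
    (hi : i ∈ classIndices b r l F) :
    algebraMap F E (i.1 : F) ∈ Lam' b r l E ∧ RatFunc.eval (RingHom.id F) 0 i.2 = 1 := by
  obtain ⟨H, hH, d, hd, rfl⟩ := hi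
  obtain ⟨j, hj⟩ := hd.exists_series_mem
  have hy := subset_hypSolutions hH hj
  exact ⟨algebraMap_mem_Lam' hb hl0 d.lam (MonoidAlgebra.single_ne_zero.1 hy.1)
    ((applyL_single_eq_zero_iff b r l d.lam _).1 hy.2.2), hd.g_zero⟩

end Classification

/-! ### Finiteness of the number of classes -/

section Counting

variable {K : Type*} [Field K] {F : Type*} [Field F] [Algebra K F]
  {b : ℕ+} {r : ℕ} {l : ℕ → Polynomial K}

theorem linearIndependent_sigma_of_similar (hb : 2 ≤ b) {ι : Type*} [Finite ι] {κ : ι → Type*}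
    [∀ i, Finite (κ i)] {z : ι → DRing F} (hz0 : ∀ i, z i ≠ 0)
    (hz : ∀ i, IsHypergeometric F b (z i)) (hsim : ∀ i i', Similar F (z i) (z i') → i = i')
    {y : ∀ i, κ i → DRing F} (hy : ∀ i, LinearIndependent F (y i))
    (hyz : ∀ i j, Similar F (y i j) (z i)) :
    LinearIndependent F fun x : Σ i, κ i => y x.1 x.2 := by
  have := Fintype.ofFinite ι
  have (i : ι) := Fintype.ofFinite (κ i)
  choose f hf _ hfz using hyz
  rw [Fintype.linearIndependent_iff]
  rintro c hc ⟨i, j⟩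
  have hterm (i) : ∑ j, c ⟨i, j⟩ • y i j = (∑ j, c ⟨i, j⟩ • f i j) • z i := by
    rw [Finset.sum_smul]
    exact Finset.sum_congr rfl fun j _ => by rw [hfz, smul_assoc]
  have hcoeff (i) : ∑ j, c ⟨i, j⟩ • f i j ∈ ramRatField F := sum_mem fun j _ => by
    rw [Algebra.smul_def]
    exact mul_mem (algebraMap_mem_ramRatField _) (hf i j)
  rw [Fintype.sum_sigma] at hc
  simp only [hterm] at hc
  have hzero : ∑ j, c ⟨i, j⟩ • f i j = 0 := congrArg Subtype.val
    (Fintype.linearIndependent_iff.1 (linearIndependent_of_not_similar hb hz0 hz hsim)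
      (fun i => ⟨_, hcoeff i⟩) hc i)
  refine Fintype.linearIndependent_iff.1 (hy i) (fun j => c ⟨i, j⟩) ?_ j
  rw [hterm, hzero, zero_smul]

theorem sum_s_le (hb : 2 ≤ b) (hl0 : l 0 ≠ 0) {D : Fˣ × RatFunc F → ClassData F}
    {T : Finset (Fˣ × RatFunc F)} (hT : ∀ i ∈ T, i ∈ classIndices b r l F)
    (hD : ∀ i ∈ T, (D i).Represents b r l (classOf b r l i)) : ∑ i ∈ T, (D i).s ≤ r := by
  have hmem (i : T) (j) : (D i).series b r l j ∈ classOf b r l i := (hD i i.2).series_mem j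
  have hsol (i : T) : classOf b r l i ⊆ hypSolutions F b r l :=
    subset_hypSolutions (classOf_mem_simClasses (hT i i.2))
  choose z hz using fun i : T => (hD i i.2).exists_series_mem
  have hind := linearIndependent_sigma_of_similar hb (fun i => (hsol i (hz i)).1)
    (fun i => (hsol i (hz i)).2.1)
    (fun i i' h => Subtype.ext
      (eq_of_similar_of_mem_classOf hb (hT i i.2) (hT i' i'.2) (hz i) (hz i') h))
    (fun i => (hD i i.2).linearIndependent)
    (fun i j => similar_of_mem (classOf_mem_simClasses (hT i i.2)) (hmem i j) (hz i))
  have hcard := card_le_of_linearIndependent hb hl0 hind fun ⟨i, j⟩ =>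
    (applyL_single_eq_zero_iff b r l _ _).1 (hsol i (hmem i j)).2.2
  simpa only [Fintype.card_sigma, Fintype.card_fin, Finset.sum_coe_sort T fun i => (D i).s]
    using hcard

theorem finite_classIndices (hb : 2 ≤ b) (hl0 : l 0 ≠ 0) : (classIndices b r l F).Finite := by
  obtain ⟨D, hD⟩ := exists_represents_classOf (F := F) b r l
  by_contra hinf
  obtain ⟨T, hT, hcard⟩ := Set.Infinite.exists_subset_card_eq hinf (r + 1)
  have hs : T.card ≤ ∑ i ∈ T, (D i).s := by
    rw [Finset.card_eq_sum_ones]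
    exact Finset.sum_le_sum fun i hi => (hD i (hT hi)).1.s_pos
  have := sum_s_le hb hl0 hT fun i hi => (hD i (hT hi)).1
  lia

end Counting

/-! ### The Riccati equation -/

section Riccati

variable {K : Type*} [Field K] {F : Type*} [Field F] [Algebra K F]
  {b : ℕ+} {r : ℕ} {l : ℕ → Polynomial K}

theorem pow_mul_mahlerP_iterate {lam : F} {p u : Puiseux F}
    (hM : algebraMap F _ lam * mahlerP F b p = u * p) (k : ℕ) :
    algebraMap F _ lam ^ k * (mahlerP F b)^[k] p
      = (∏ i ∈ Finset.range k, (mahlerP F b)^[i] u) * p := by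
  induction k with
  | zero => simp
  | succ k ih =>
    have hstep := congrArg (mahlerP F b)^[k] hM
    rw [iterate_map_mul, iterate_map_mul, Function.iterate_fixed (mahlerP_algebraMap b lam),
      ← Function.iterate_succ_apply] at hstep
    rw [pow_succ, mul_assoc, hstep, mul_left_comm, ih, Finset.prod_range_succ]
    ring

theorem twistedOp_eq_riccati_mul {lam : F} {p u : Puiseux F}
    (hM : algebraMap F _ lam * mahlerP F b p = u * p) :
    twistedOp b r l lam p = (∑ k ∈ Finset.range (r + 1),
      polyCoeff F (l k) * ∏ i ∈ Finset.range k, (mahlerP F b)^[i] u) * p := by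
  rw [twistedOp_apply, Finset.sum_mul]
  exact Finset.sum_congr rfl fun k _ => by rw [pow_mul_mahlerP_iterate hM, mul_assoc]

theorem ne_zero_of_mem_riccatiSolutions (hl0 : l 0 ≠ 0) {u : Puiseux F}
    (hu : u ∈ riccatiSolutions F b r l) : u ≠ 0 := by
  rintro rfl
  have hsum := hu.2
  rw [Finset.sum_range_succ', Finset.sum_eq_zero, zero_add, Finset.prod_range_zero,
    mul_one] at hsum
  · exact polyCoeff_ne_zero hl0 hsum
  · intro k _
    rw [Finset.prod_range_succ', Function.iterate_zero, id, mul_zero, mul_zero]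

theorem isUnit_single {lam : Fˣ} {p : Puiseux F} (hp : p ≠ 0) :
    IsUnit (MonoidAlgebra.single lam p : DRing F) := by
  refine IsUnit.of_mul_eq_one (MonoidAlgebra.single lam⁻¹ p⁻¹) ?_
  rw [MonoidAlgebra.single_mul_single, mul_inv_cancel, mul_inv_cancel₀ hp, MonoidAlgebra.one_def]

theorem isUnit_of_mem_hypSolutions (hb : 2 ≤ b) {y : DRing F} (hy : y ∈ hypSolutions F b r l) :
    IsUnit y := by
  obtain ⟨lam, p, hp, rfl⟩ := exists_single_of_mahler_eq hb hy.1 hy.2.1.choose_spec.2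
  exact isUnit_single hp

theorem eq_of_mahler_eq (hb : 2 ≤ b) {y : DRing F} (hy : y ≠ 0) {u u' : Puiseux F}
    (hu : mahler F b y = u • y) (hu' : mahler F b y = u' • y) : u = u' := by
  obtain ⟨lam, p, hp, rfl⟩ := exists_single_of_mahler_eq hb hy hu
  rw [mahler_single_eq_smul_iff] at hu hu'
  exact mul_right_cancel₀ hp (hu.symm.trans hu')

theorem mem_riccatiSolutions_iff (hb : 2 ≤ b) (hl0 : l 0 ≠ 0) {u : Puiseux F} :
    u ∈ riccatiSolutions F b r l ↔ ∃ y ∈ hypSolutions F b r l, mahler F b y = u • y := by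
  constructor
  · intro hu
    obtain ⟨lam, p, hp, hM⟩ :=
      exists_mahlerP_eq_mul hb hu.1 (ne_zero_of_mem_riccatiSolutions hl0 hu)
    have hM' := (mahler_single_eq_smul_iff lam p u).2 hM
    refine ⟨MonoidAlgebra.single lam p, ⟨MonoidAlgebra.single_ne_zero.2 hp, ⟨u, hu.1, hM'⟩,
      (applyL_single_eq_zero_iff b r l lam p).2 ?_⟩, hM'⟩
    rw [twistedOp_eq_riccati_mul hM, hu.2, zero_mul]
  · rintro ⟨y, ⟨hy0, ⟨u', hu', hM'⟩, hL⟩, hM⟩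
    obtain rfl := eq_of_mahler_eq hb hy0 hM hM'
    obtain ⟨lam, p, hp, rfl⟩ := exists_single_of_mahler_eq hb hy0 hM
    rw [applyL_single_eq_zero_iff,
      twistedOp_eq_riccati_mul ((mahler_single_eq_smul_iff lam p u).1 hM)] at hL
    exact ⟨hu', (mul_eq_zero.1 hL).resolve_right hp⟩

theorem riccatiSolutions_eq (hb : 2 ≤ b) (hl0 : l 0 ≠ 0) :
    riccatiSolutions F b r l
      = ⋃ i ∈ classIndices b r l F, quotImage F b (classOf b r l i) := by
  ext u
  simp only [Set.mem_iUnion, exists_prop, mem_riccatiSolutions_iff hb hl0]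
  constructor
  · rintro ⟨y, hy, hM⟩
    obtain ⟨i, hi, hyi⟩ := exists_mem_classOf hb hl0 hy
    exact ⟨i, hi, y, hyi, isUnit_of_mem_hypSolutions hb hy, hM⟩
  · rintro ⟨i, hi, y, hy, -, hM⟩
    exact ⟨y, subset_hypSolutions (classOf_mem_simClasses hi) hy, hM⟩

theorem disjoint_quotImage (hb : 2 ≤ b) :
    (classIndices b r l F).PairwiseDisjoint fun i => quotImage F b (classOf b r l i) := by
  refine fun i hi i' hi' hne => Set.disjoint_left.2 ?_
  rintro u ⟨y, hy, -, hM⟩ ⟨z, hz, -, hM'⟩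
  have hy0 := (subset_hypSolutions (classOf_mem_simClasses hi) hy).1
  have hz0 := (subset_hypSolutions (classOf_mem_simClasses hi') hz).1
  obtain ⟨c, hc, rfl⟩ := exists_smul_of_mahler_eq hb hy0 hz0 hM hM'
  exact hne (eq_of_similar_of_mem_classOf hb hi hi' hy hz (similar_constant_smul hc z))

end Riccati

/-! ### Parametrisation of the solutions attached to a class -/

section Parametrisation

variable {K : Type*} [Field K] {F : Type*} [Field F] [Algebra K F]
  {b : ℕ+} {r : ℕ} {l : ℕ → Polynomial K} {d : ClassData F} {H : Set (DRing F)}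

namespace ClassData

theorem combination_eq (d : ClassData F) (m : ℕ+) (c : Fin d.s → F) :
    d.combination b r l m c
      = laurentHom F m (ramBound b r l (d.lam : F)) (∑ j, c j • d.p j) := by
  simp only [combination, map_sum, map_smul, laurentPolyAt_eq]

theorem sum_series (d : ClassData F) (c : Fin d.s → F) :
    ∑ j, c j • d.series b r l j = MonoidAlgebra.single d.lam (d.combination b r l 1 c
      * powerSeriesAt 1 (ramBound b r l (d.lam : F)) (infProd b d.g)) := by
  simp only [series_eq_laurentSeries, Function.comp, ← map_smul, ← map_sum]
  rw [combination_eq]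
  rfl

/-- The quotient `M y / y` for `y = ∑ j, c j • y j`, where the `y j` are the series defined by
the tuple `d`. -/
def riccati (b : ℕ+) (r : ℕ) (l : ℕ → Polynomial K) (d : ClassData F) (c : Fin d.s → F) :
    Puiseux F :=
  algebraMap F (Puiseux F) (d.lam : F) * (d.combination b r l b c / d.combination b r l 1 c)
    * ratAt 1 (ramBound b r l (d.lam : F)) d.g

theorem riccati_smul {t : F} (ht : t ≠ 0) (c : Fin d.s → F) :
    d.riccati b r l (t • c) = d.riccati b r l c := by
  have hcomb (m) : d.combination b r l m (t • c) = algebraMap F _ t * d.combination b r l m c := by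
    simp only [combination, ← Algebra.smul_def, Finset.smul_sum, Pi.smul_apply, smul_assoc]
  rw [riccati, riccati, hcomb, hcomb, mul_div_mul_left _ _ (by simpa using ht)]

namespace Represents

theorem sum_series_ne_zero (hd : d.Represents b r l H) {c : Fin d.s → F} (hc : c ≠ 0) :
    ∑ j, c j • d.series b r l j ≠ 0 := fun h =>
  hc (funext (Fintype.linearIndependent_iff.1 hd.linearIndependent c h))

theorem combination_ne_zero (hd : d.Represents b r l H) {c : Fin d.s → F} (hc : c ≠ 0) :
    d.combination b r l 1 c ≠ 0 := fun h =>
  hd.sum_series_ne_zero hc (by rw [sum_series, h, zero_mul, MonoidAlgebra.single_zero])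

theorem mahler_sum_series (hb : 2 ≤ b) (hd : d.Represents b r l H) {c : Fin d.s → F}
    (hc : c ≠ 0) :
    mahler F b (∑ j, c j • d.series b r l j)
      = d.riccati b r l c • ∑ j, c j • d.series b r l j := by
  have hcomb : mahlerP F b (d.combination b r l 1 c) = d.combination b r l b c := by
    rw [combination_eq, combination_eq, mahlerP_laurentHom, mul_one]
  have hne := hd.combination_ne_zero hc
  rw [sum_series, mahler_single_eq_smul_iff, map_mul, mahlerP_infProd hb _ hd.g_zero, riccati,
    ratAt_eq, hcomb]
  field_simp

theorem exists_eq_smul_of_riccati_eq (hb : 2 ≤ b) (hd : d.Represents b r l H)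
    {c c' : Fin d.s → F} (hc : c ≠ 0) (hc' : c' ≠ 0)
    (h : d.riccati b r l c = d.riccati b r l c') : ∃ t : F, t • c' = c := by
  obtain ⟨t, -, ht⟩ := exists_smul_of_mahler_eq hb (hd.sum_series_ne_zero hc)
    (hd.sum_series_ne_zero hc') (hd.mahler_sum_series hb hc) (h ▸ hd.mahler_sum_series hb hc')
  refine ⟨t, linearIndependent_iff_injective_fintypeLinearCombination.1 hd.linearIndependent ?_⟩
  rw [map_smul]
  exact ht.symm

theorem mem_quotImage_iff (hb : 2 ≤ b) (hH : H ∈ simClasses F b r l)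
    (hd : d.Represents b r l H) {u : Puiseux F} :
    u ∈ quotImage F b H ↔ ∃ c, c ≠ 0 ∧ d.riccati b r l c = u := by
  have hmem (y) : y ∈ insert 0 H ↔ ∃ c : Fin d.s → F, ∑ j, c j • d.series b r l j = y := by
    rw [← hd.span_eq, SetLike.mem_coe, Submodule.mem_span_range_iff_exists_fun]
  constructor
  · rintro ⟨y, hy, -, hM⟩
    have hy0 := (subset_hypSolutions hH hy).1
    obtain ⟨c, rfl⟩ := (hmem y).1 (Or.inr hy)
    have hc : c ≠ 0 := by
      rintro rfl
      exact hy0 (by simp)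
    exact ⟨c, hc, eq_of_mahler_eq hb hy0 (hd.mahler_sum_series hb hc) hM⟩
  · rintro ⟨c, hc, rfl⟩
    have hy := ((hmem _).2 ⟨c, rfl⟩).resolve_left (hd.sum_series_ne_zero hc)
    exact ⟨_, hy, isUnit_of_mem_hypSolutions hb (subset_hypSolutions hH hy),
      hd.mahler_sum_series hb hc⟩

theorem exists_parametrisation (hb : 2 ≤ b) (hH : H ∈ simClasses F b r l)
    (hd : d.Represents b r l H) :
    ∃ φ : Projectivization F (Fin d.s → F) → Puiseux F,
      Function.Injective φ ∧ Set.range φ = quotImage F b H ∧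
      ∀ (c : Fin d.s → F) (hc : c ≠ 0), d.combination b r l 1 c ≠ 0 ∧
        φ (Projectivization.mk F c hc) = d.riccati b r l c := by
  let φ : Projectivization F (Fin d.s → F) → Puiseux F :=
    Projectivization.lift (fun c => d.riccati b r l c.1) <| by
      rintro ⟨c, hc⟩ ⟨c', hc'⟩ t (rfl : c = t • c')
      exact riccati_smul (left_ne_zero_of_smul hc) c'
  refine ⟨φ, ?_, ?_, fun c hc => ⟨hd.combination_ne_zero hc, rfl⟩⟩
  · intro x y h
    induction x using Projectivization.ind with | h c hc =>
    induction y using Projectivization.ind with | h c' hc' =>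
    exact (Projectivization.mk_eq_mk_iff' F c c' hc hc').2
      (hd.exists_eq_smul_of_riccati_eq hb hc hc' h)
  · ext u
    rw [hd.mem_quotImage_iff hb hH]
    constructor
    · rintro ⟨x, rfl⟩
      induction x using Projectivization.ind with | h c hc =>
      exact ⟨c, hc, rfl⟩
    · rintro ⟨c, hc, rfl⟩
      exact ⟨Projectivization.mk F c hc, rfl⟩

end Represents

end ClassData

end Parametrisation

end

end Mahler

open Mahler in
theorem mainTheorem4_general {K F E : Type*} [Field K] [Field F] [Field E] [Algebra K F]
    [Algebra F E] [Algebra K E] [IsScalarTower K F E] (b : ℕ+) (hb : 2 ≤ b) (r : ℕ)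
    (l : ℕ → Polynomial K) (hl0 : l 0 ≠ 0) :
    (∀ H ∈ simClasses F b r l, ∃! d : ClassData F, d.Represents b r l H) ∧
    (∀ i ∈ classIndices b r l F, classOf b r l i ∈ simClasses F b r l) ∧
    ∃ (I : Finset (Fˣ × RatFunc F)) (D : Fˣ × RatFunc F → ClassData F),
      (I : Set (Fˣ × RatFunc F)) = classIndices b r l F ∧
      (∀ i ∈ I,
        algebraMap F E (i.1 : F) ∈ Lam' b r l E ∧ RatFunc.eval (RingHom.id F) 0 i.2 = 1) ∧
      riccatiSolutions F b r l = ⋃ i ∈ I, quotImage F b (classOf b r l i) ∧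
      (I : Set (Fˣ × RatFunc F)).PairwiseDisjoint (fun i => quotImage F b (classOf b r l i)) ∧
      (∀ lam : Fˣ, algebraMap F E (lam : F) ∈ Lam' b r l E →
        {y | y ∈ hypSolutions F b r l ∧ ∃ p : Puiseux F, y = MonoidAlgebra.single lam p}
          = ⋃ i ∈ {i | i ∈ I ∧ i.1 = lam}, classOf b r l i) ∧
      (I : Set (Fˣ × RatFunc F)).PairwiseDisjoint (fun i => classOf b r l i) ∧
      (∀ i ∈ I,
        ((D i).lam, (D i).g) = i ∧
        (D i).Represents b r l (classOf b r l i) ∧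
        ∃ φ : Projectivization F (Fin (D i).s → F) → Puiseux F,
          Function.Injective φ ∧
          Set.range φ = quotImage F b (classOf b r l i) ∧
          ∀ (c : Fin (D i).s → F) (hc : c ≠ 0),
            (D i).combination b r l 1 c ≠ 0 ∧
            φ (Projectivization.mk F c hc)
              = algebraMap F (Puiseux F) (i.1 : F)
                * ((D i).combination b r l b c / (D i).combination b r l 1 c)
                * ratAt 1 (ramBound b r l (i.1 : F)) i.2) ∧
      ∑ i ∈ I, (((D i).s : ℤ) - 1) ≤ (r : ℤ) - (I.card : ℤ) := by
  obtain ⟨D, hD⟩ := exists_represents_classOf (F := F) b r l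
  obtain ⟨I, hI⟩ := (finite_classIndices (F := F) (r := r) hb hl0).exists_finset_coe
  have hmem (i) : i ∈ I ↔ i ∈ classIndices b r l F := by rw [← hI, Finset.mem_coe]
  refine ⟨fun H hH => existsUnique_represents hb hl0 hH, fun i => classOf_mem_simClasses, I, D, hI,
    fun i hi => fst_mem_Lam'_and_eval_snd_eq_one hb hl0 ((hmem i).1 hi), ?_,
    hI ▸ disjoint_quotImage hb, fun lam _ => ?_, hI ▸ disjoint_classOf hb, ?_, ?_⟩
  · simpa only [hmem] using riccatiSolutions_eq hb hl0
  · simpa only [hmem] using hypSolutions_single_eq hb hl0 lam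
  · rintro ⟨lam, g⟩ hi
    rw [hmem] at hi
    obtain ⟨hd, hdi⟩ := hD _ hi
    obtain ⟨φ, hinj, hrange, hφ⟩ := hd.exists_parametrisation hb (classOf_mem_simClasses hi)
    obtain ⟨hlam, hg⟩ := Prod.mk.inj hdi
    refine ⟨hdi, hd, φ, hinj, hrange, fun c hc => ⟨(hφ c hc).1, ?_⟩⟩
    rw [(hφ c hc).2, ClassData.riccati, hlam, hg]
  · have hsum := sum_s_le hb hl0 (fun i => (hmem i).1) fun i hi => (hD i ((hmem i).1 hi)).1
    rw [Finset.sum_sub_distrib, Finset.sum_const, nsmul_one]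
    exact sub_le_sub_right (mod_cast hsum) _

theorem mainTheorem4 {K Kbar : Type*} [Field K] [CharZero K] [Field Kbar] [Algebra K Kbar]
    [IsAlgClosure K Kbar] (𝕃 : IntermediateField K Kbar)
    (b : ℕ+) (hb : 2 ≤ b) (r : ℕ) (l : ℕ → Polynomial K)
    (hl0 : l 0 ≠ 0) (hlr : l r ≠ 0)
    (hprim : ∀ c : Polynomial K, (∀ k ≤ r, c ∣ l k) → IsUnit c) :
    (∀ H ∈ Mahler.simClasses 𝕃 b r l,
      ∃! d : Mahler.ClassData 𝕃, d.Represents b r l H) ∧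
    (∀ i ∈ Mahler.classIndices b r l 𝕃,
      Mahler.classOf b r l i ∈ Mahler.simClasses 𝕃 b r l) ∧
    ∃ (I : Finset (𝕃ˣ × RatFunc 𝕃)) (D : 𝕃ˣ × RatFunc 𝕃 → Mahler.ClassData 𝕃),
      (I : Set (𝕃ˣ × RatFunc 𝕃)) = Mahler.classIndices b r l 𝕃 ∧
      (∀ i ∈ I,
        algebraMap 𝕃 Kbar (i.1 : 𝕃) ∈ Mahler.Lam' b r l Kbar ∧
        RatFunc.eval (RingHom.id 𝕃) 0 i.2 = 1) ∧
      Mahler.riccatiSolutions 𝕃 b r l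
        = ⋃ i ∈ I, Mahler.quotImage 𝕃 b (Mahler.classOf b r l i) ∧
      (I : Set (𝕃ˣ × RatFunc 𝕃)).PairwiseDisjoint
        (fun i => Mahler.quotImage 𝕃 b (Mahler.classOf b r l i)) ∧
      (∀ lam : 𝕃ˣ, algebraMap 𝕃 Kbar (lam : 𝕃) ∈ Mahler.Lam' b r l Kbar →
        {y | y ∈ Mahler.hypSolutions 𝕃 b r l ∧
            ∃ p : Mahler.Puiseux 𝕃, y = MonoidAlgebra.single lam p}
          = ⋃ i ∈ {i | i ∈ I ∧ i.1 = lam}, Mahler.classOf b r l i) ∧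
      (I : Set (𝕃ˣ × RatFunc 𝕃)).PairwiseDisjoint (fun i => Mahler.classOf b r l i) ∧
      (∀ i ∈ I,
        ((D i).lam, (D i).g) = i ∧
        (D i).Represents b r l (Mahler.classOf b r l i) ∧
        ∃ φ : Projectivization 𝕃 (Fin (D i).s → 𝕃) → Mahler.Puiseux 𝕃,
          Function.Injective φ ∧
          Set.range φ = Mahler.quotImage 𝕃 b (Mahler.classOf b r l i) ∧
          ∀ (c : Fin (D i).s → 𝕃) (hc : c ≠ 0),
            (D i).combination b r l 1 c ≠ 0 ∧
            φ (Projectivization.mk 𝕃 c hc)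
              = algebraMap 𝕃 (Mahler.Puiseux 𝕃) (i.1 : 𝕃)
                * ((D i).combination b r l b c / (D i).combination b r l 1 c)
                * Mahler.ratAt 1 (Mahler.ramBound b r l (i.1 : 𝕃)) i.2) ∧
      ∑ i ∈ I, (((D i).s : ℤ) - 1) ≤ (r : ℤ) - (I.card : ℤ) :=
  mainTheorem4_general b hb r l hl0
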